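/- **Setting.** Let $d\ge 1$ and let $\|\cdot\|$ be the Euclidean norm on $\mathbb R^d$ (and the operator norm on matrices). Let $\epsilon,L_1,L_2,\Delta_f>0$ and $\delta\in(0,1)$. Let $f:\mathbb R^d\to\mathbb R$ be $L_1$-smooth ($f$ is differentiable and $\nabla f$ is $L_1$-Lipschitz) and twice differentiable with $L_2$-Lipschitz Hessian, bounded below, with $f(x_1)-\inf f\le\Delta_f$ at the starting point $x_1$. The following basic operations each take time at most $\mathcal T$: evaluating $\nabla f(x)$; evaluating $\nabla^2 f(x)v$; an arithmetic operation on vectors in $\mathbb R^d$. Running time is the total time of all basic operations performed (exact arithmetic; scalar computations are not charged). **Procedures.** *AGD*$(g,y_1,\epsilon,L,\sigma)$: set $\kappa=L/\sigma$, $\beta=\frac{\sqrt\kappa-1}{\sqrt\kappa+1}$, $z_1=y_1$; for $j=1,2,\dots$: if $\|\nabla g(y_j)\|\le\epsilon$ return $y_j$; else $y_{j+1}=z_j-\frac1L\nabla g(z_j)$, $z_{j+1}=(1+\beta)y_{j+1}-\beta y_j$. *ACAGD*$(g,z_1,\epsilon,\gamma,L)$: for $j=1,2,\dots$: if $\|\nabla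 g(z_j)\|\le\epsilon$ return $z_j$; else $z_{j+1}=\text{AGD}\big(g(\cdot)+\gamma\|\cdot-z_j\|^2,\ z_j,\ \epsilon\sqrt{\gamma/(50(L+2\gamma))},\ L+2\gamma,\ \gamma\big)$. *Eigenvector routine with constant $A$*: a randomized routine that, given a symmetric $H$ (through products $Hv$), numbers $L\ge\|H\|$, $\eta\in(0,2L)$ and $\delta'\in(0,1)$, always returns a unit vector $v$, in time at most $A\,\mathcal T\,(1+\log(d/\delta')\sqrt{L/\eta})$, and with probability at least $1-\delta'$ satisfies $v^THv\le\lambda_{\min}(H)+\eta$. *NCD*$(z_1,f,L_2,\alpha,\Delta_f,\delta)$: set $\delta'=\delta/(1+12L_2^2\Delta_f/\alpha^3)$; for $j=1,2,\dots$: let $v_j$ be the output of the eigenvector routine on $(\nabla^2f(z_j),L_1,\alpha/2,\delta')$, with fresh randomness, and $q_j=v_j^T\nabla^2f(z_j)v_j$; if $q_j\le-\alpha/2$ set $z_{j+1}=z_j-\frac{2|q_j|}{L_2}\operatorname{sign}(v_j^T\nabla f(z_j))\,v_j$ (with $\operatorname{sign}(0)=1$), else return $z_j$. *Accelerated non-convex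 method*$(x_1,f,\epsilon,L_1,L_2,\alpha,\Delta_f,\delta)$: set $K=\big\lceil1+\Delta_f\big(12L_2^2/\alpha^3+\sqrt{10}L_2/(\alpha\epsilon)\big)\big\rceil$ and $\delta''=\delta/K$; for $k=1,2,\dots$: let $\hat x_k=\text{NCD}(x_k,f,L_2,\alpha,\Delta_f,\delta'')$ if $\alpha<L_1$ and $\hat x_k=x_k$ otherwise; if $\|\nabla f(\hat x_k)\|\le\epsilon$ return $\hat x_k$; else let $f_k(x)=f(x)+L_1\max\{\|x-\hat x_k\|-\alpha/L_2,0\}^2$ and $x_{k+1}=\text{ACAGD}(f_k,\hat x_k,\epsilon/2,3\alpha,5L_1)$. The method is run with $\alpha=\min\{L_1,\max\{\epsilon^2\Delta_f^{-1},\epsilon^{1/2}L_2^{1/2}\}\}$. Put $\tau=1+L_1+L_2+\Delta_f+d+1/\delta+1/\epsilon$. **Statement.** (a) Eigenvector routines exist: there is a universal constant $A$ such that, in every dimension $d\ge 1$, the Lanczos method is an eigenvector routine with constant $A$. Here the Lanczos method starts from a random vector $g$ with independent coordinates uniform on $\{1,\dots,\lceil1/\delta'\rceil+1\}$ and returns a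 unit vector minimizing the Rayleigh quotient of $H$ over the span of $g,Hg,\dots,H^{k-1}g$, where $k=\lceil8\sqrt{L/\eta}\,\log(d/\delta')\rceil+1$. (b) For every $A>0$ there is a constant $C$, depending only on $A$, such that the following holds for all data as above and every eigenvector routine with constant $A$ (whose random output takes countably many values). If in addition $\epsilon\le(\Delta_f^2L_2)^{1/3}$, then with probability at least $1-\delta$ the accelerated non-convex method terminates, returns a point $x$ with $\|\nabla f(x)\|\le\epsilon$ and $\lambda_{\min}(\nabla^2f(x))\ge-2\epsilon^{1/2}L_2^{1/2}$, and has total running time at most $$C\,\mathcal T\,\max\Big\{1,\ \Delta_f\frac{L_1^{1/2}L_2^{1/4}}{\epsilon^{7/4}}\Big\}\log\tau .$$ If moreover $\epsilon\le L_1^2/L_2$, the same holds with running time at most $$C\,\mathcal T\,\Delta_f\frac{L_1^{1/2}L_2^{1/4}}{\epsilon^{7/4}}\,\log\tau .$$ -/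

import Mathlib

open scoped ENNReal

noncomputable section

namespace NCAccel

/-- `ℝ^d` with the Euclidean norm. -/
abbrev Vec (d : ℕ) : Type := EuclideanSpace ℝ (Fin d)

/-! ### The class of functions -/

/-- The Hessian `∇²f(x)`, as the derivative of the gradient. -/
def hess {d : ℕ} (f : Vec d → ℝ) (x : Vec d) : Vec d →L[ℝ] Vec d :=
  fderiv ℝ (gradient f) x

/-- `f` is `L₁`-smooth: it is differentiable with `L₁`-Lipschitz gradient. -/
def Smooth {d : ℕ} (f : Vec d → ℝ) (L₁ : ℝ) : Prop :=
  Differentiable ℝ f ∧ ∀ x y, ‖gradient f x - gradient f y‖ ≤ L₁ * ‖x - y‖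

/-- `f` is twice differentiable and its Hessian is `L₂`-Lipschitz in operator norm. -/
def HessianLipschitz {d : ℕ} (f : Vec d → ℝ) (L₂ : ℝ) : Prop :=
  Differentiable ℝ f ∧ Differentiable ℝ (gradient f) ∧
    ∀ x y, ‖hess f x - hess f y‖ ≤ L₂ * ‖x - y‖

/-- `f` is bounded below and `f x - inf f ≤ Δ`. -/
def OptGap {d : ℕ} (f : Vec d → ℝ) (x : Vec d) (Δ : ℝ) : Prop :=
  BddBelow (Set.range f) ∧ f x - ⨅ y, f y ≤ Δ

/-- The smallest (real) eigenvalue of `H`; used for symmetric `H` in dimension at least one. -/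
def lamMin {d : ℕ} (H : Vec d →L[ℝ] Vec d) : ℝ :=
  sInf {μ : ℝ | Module.End.HasEigenvalue (H : Vec d →ₗ[ℝ] Vec d) μ}

/-! ### Running time

The basic operations are the evaluation of `∇f(x)`, the evaluation of `∇²f(x) v`, and an
arithmetic operation on vectors (sum, difference, scaling, inner product, norm, or writing down a
fresh vector).  Every procedure below returns, besides its result, the total time of the basic
operations that it performed. -/

/-- The times of the three kinds of basic operations. -/
structure OpTimes where
  /-- one gradient evaluation -/
  grad : ℝ
  /-- one Hessian-vector product -/
  hess : ℝ
  /-- one vector operation -/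
  vec : ℝ

/-- Every basic operation takes time at most `T`. -/
def OpTimes.Within (tm : OpTimes) (T : ℝ) : Prop :=
  tm.grad ≤ T ∧ tm.hess ≤ T ∧ tm.vec ≤ T

/-- The result of a procedure whose loops are cut off after a given number of passes: `none` if
some loop was cut off, and `some (x, t)` if the procedure returned `x` after time `t`. -/
abbrev Outcome (d : ℕ) : Type := Option (Vec d × ℝ)

/-- Add the time `c` to an outcome. -/
def Outcome.addTime {d : ℕ} (c : ℝ) (o : Outcome d) : Outcome d :=
  o.map fun p => (p.1, c + p.2)

/-! ### Accelerated gradient descent -/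

/-- Accelerated gradient descent on the `L`-smooth and `σ`-strongly convex function `g`, run from
the current pair `(y, z)` for at most `n` passes until `‖∇g(y)‖ ≤ ε`.
The time of one evaluation of `∇g` is `w`. -/
def agdLoop {d : ℕ} (tm : OpTimes) (w : ℝ) (g : Vec d → ℝ) (ε L σ : ℝ) :
    ℕ → Vec d → Vec d → Outcome d
  | 0, _, _ => none
  | n + 1, y, z =>
    if ‖gradient g y‖ ≤ ε then some (y, w + tm.vec)
    else
      let κ := L / σ
      let β := (√κ - 1) / (√κ + 1)
      let y' := z - (1 / L) • gradient g z
      let z' := (1 + β) • y' - β • y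
      Outcome.addTime (2 * w + 6 * tm.vec) (agdLoop tm w g ε L σ n y' z')

/-- Accelerated gradient descent started at `y₁`. -/
def agd {d : ℕ} (tm : OpTimes) (w : ℝ) (n : ℕ) (g : Vec d → ℝ) (y₁ : Vec d) (ε L σ : ℝ) :
    Outcome d :=
  agdLoop tm w g ε L σ n y₁ y₁

/-! ### Accelerated gradient descent for almost convex functions -/

/-- The proximal model `g(z) = f(z) + γ ‖z - z₀‖²`. -/
def proxModel {d : ℕ} (f : Vec d → ℝ) (γ : ℝ) (z₀ : Vec d) (z : Vec d) : ℝ :=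
  f z + γ * ‖z - z₀‖ ^ 2

/-- The loop of the method for almost convex functions; `N` caps the inner loops.  The model is
`(L + 2γ)`-smooth and `γ`-strongly convex for an `L`-smooth `γ`-almost convex `f`, and its gradient
`∇f(z) + 2γ (z - z₀)` costs three vector operations more than `∇f(z)`. -/
def acagdLoop {d : ℕ} (tm : OpTimes) (w : ℝ) (N : ℕ) (f : Vec d → ℝ) (ε γ L : ℝ) :
    ℕ → Vec d → Outcome d
  | 0, _ => none
  | n + 1, z =>
    if ‖gradient f z‖ ≤ ε then some (z, w + tm.vec)
    else
      let ε' := ε * √(γ / (50 * (L + 2 * γ)))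
      match agd tm (w + 3 * tm.vec) N (proxModel f γ z) z ε' (L + 2 * γ) γ with
      | none => none
      | some (z', c) => Outcome.addTime (w + tm.vec + c) (acagdLoop tm w N f ε γ L n z')

/-- The method for almost convex functions, started at `z₁`. -/
def acagd {d : ℕ} (tm : OpTimes) (w : ℝ) (n : ℕ) (f : Vec d → ℝ) (z₁ : Vec d) (ε γ L : ℝ) :
    Outcome d :=
  acagdLoop tm w n f ε γ L n z₁

/-! ### Approximate smallest eigenvectors -/

/-- A randomized routine which, on input of a linear map `H`, a bound `L` on its norm, an accuracy
`ε` and a failure probability `δ`, returns a vector together with the time spent. -/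
abbrev EigRoutine (d : ℕ) : Type :=
  (Vec d →L[ℝ] Vec d) → ℝ → ℝ → ℝ → PMF (Vec d × ℝ)

/-- The routine finds an additive `ε`-approximate smallest eigenvector with probability at least
`1 - δ`, in time at most `A T (1 + log (d/δ) √(L/ε))`; its output is always a unit vector. -/
def EigRoutine.Meets {d : ℕ} (R : EigRoutine d) (A T : ℝ) : Prop :=
  ∀ H : Vec d →L[ℝ] Vec d, (H : Vec d →ₗ[ℝ] Vec d).IsSymmetric →
    ∀ L ε δ : ℝ, ‖H‖ ≤ L → 0 < ε → ε < 2 * L → 0 < δ → δ < 1 →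
      (∀ p ∈ (R H L ε δ).support,
        ‖p.1‖ = 1 ∧ p.2 ≤ A * T * (1 + Real.log (d / δ) * √(L / ε))) ∧
      ENNReal.ofReal (1 - δ) ≤
        (R H L ε δ).toOuterMeasure {p | inner ℝ p.1 (H p.1) ≤ lamMin H + ε}

/-- The moments `⟪g, H^m g⟫` of a symmetric `H`, computed from the vectors `H^i g` with
`i ≤ (m + 1) / 2` by one inner product each. -/
def moment {d : ℕ} (H : Vec d →L[ℝ] Vec d) (g : Vec d) (m : ℕ) : ℝ :=
  inner ℝ (H^[m / 2] g) (H^[(m + 1) / 2] g)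

/-- Coefficients `c` for which `v = ∑ i, c i • H^i g` minimizes `⟪v, H v⟫` among the unit vectors
of the Krylov space spanned by `g, H g, …, H^(k-1) g`, determined by the moments alone. -/
def ritzCoeffs (k : ℕ) (m : ℕ → ℝ) : Fin k → ℝ :=
  Classical.epsilon fun c : Fin k → ℝ =>
    ∑ i, ∑ j, c i * c j * m (i + j) = 1 ∧
    ∀ c' : Fin k → ℝ, ∑ i, ∑ j, c' i * c' j * m (i + j) = 1 →
      ∑ i, ∑ j, c i * c j * m (i + j + 1) ≤ ∑ i, ∑ j, c' i * c' j * m (i + j + 1)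

/-- The Lanczos (Krylov subspace, Rayleigh-Ritz) routine in exact arithmetic.  The start vector has
independent coordinates, uniform on `{1, …, ⌈1/δ⌉ + 1}`; the Krylov space has order
`k = ⌈8 √(L/ε) log (d/δ)⌉ + 1`.  It uses `k` products with `H`, and `4 k + 1` vector operations: one
for the start vector, `2 k` for the moments, and `2 k` for the final linear combination. -/
def lanczos (d : ℕ) (tm : OpTimes) : EigRoutine d := fun H L ε δ =>
  (PMF.uniformOfFintype (Fin d → Fin (⌈1 / δ⌉₊ + 1))).map fun s =>
    let g : Vec d := WithLp.toLp 2 fun i => ((s i : ℕ) : ℝ) + 1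
    let k : ℕ := ⌈8 * √(L / ε) * Real.log (d / δ)⌉₊ + 1
    let c := ritzCoeffs k (moment H g)
    (∑ i : Fin k, c i • (H^[(i : ℕ)] g), k * tm.hess + (4 * k + 1) * tm.vec)

/-! ### Negative curvature descent -/

/-- The loop of negative curvature descent: `δ'` is the failure probability granted to each
eigenvector computation.  The sign of `⟪v, ∇f(z)⟫` is taken to be `1` when the product is zero. -/
def ncdLoop {d : ℕ} (tm : OpTimes) (R : EigRoutine d) (f : Vec d → ℝ) (L₁ L₂ α δ' : ℝ) :
    ℕ → Vec d → PMF (Outcome d)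
  | 0, _ => PMF.pure none
  | n + 1, z =>
    (R (hess f z) L₁ (α / 2) δ').bind fun p =>
      let v := p.1
      let q := inner ℝ v (hess f z v)
      let c := p.2 + tm.hess + tm.vec
      if q ≤ -(α / 2) then
        let s : ℝ := if 0 ≤ inner ℝ v (gradient f z) then 1 else -1
        let z' := z - (2 * |q| / L₂ * s) • v
        (ncdLoop tm R f L₁ L₂ α δ' n z').map
          (Outcome.addTime (c + tm.grad + 3 * tm.vec))
      else PMF.pure (some (z, c))

/-- Negative curvature descent started at `z₁`, with total failure probability `δ`. -/
def ncd {d : ℕ} (tm : OpTimes) (R : EigRoutine d) (n : ℕ) (z₁ : Vec d) (f : Vec d → ℝ)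
    (L₁ L₂ α Δ δ : ℝ) : PMF (Outcome d) :=
  ncdLoop tm R f L₁ L₂ α (δ / (1 + 12 * L₂ ^ 2 * Δ / α ^ 3)) n z₁

/-! ### The accelerated method for non-convex functions -/

/-- The function `f(x) + L₁ [‖x - x₀‖ - α/L₂]₊²`. -/
def penalized {d : ℕ} (f : Vec d → ℝ) (L₁ L₂ α : ℝ) (x₀ : Vec d) (x : Vec d) : ℝ :=
  f x + L₁ * (max (‖x - x₀‖ - α / L₂) 0) ^ 2

/-- The loop of the accelerated non-convex method; `N` caps the loops of the subroutines.  The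
gradient `∇f(x) + 2 L₁ [‖x - x₀‖ - α/L₂]₊ (x - x₀) / ‖x - x₀‖` of the penalized function costs four
vector operations more than `∇f(x)`. -/
def accncLoop {d : ℕ} (tm : OpTimes) (R : EigRoutine d) (N : ℕ) (f : Vec d → ℝ)
    (ε L₁ L₂ α Δ δ'' : ℝ) : ℕ → Vec d → PMF (Outcome d)
  | 0, _ => PMF.pure none
  | n + 1, x =>
    (if α < L₁ then ncd tm R N x f L₁ L₂ α Δ δ'' else PMF.pure (some (x, 0))).bind fun o =>
      match o with
      | none => PMF.pure none
      | some (xh, c) =>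
        if ‖gradient f xh‖ ≤ ε then PMF.pure (some (xh, c + tm.grad + tm.vec))
        else
          match acagd tm (tm.grad + 4 * tm.vec) N (penalized f L₁ L₂ α xh) xh
              (ε / 2) (3 * α) (5 * L₁) with
          | none => PMF.pure none
          | some (x', c') =>
            (accncLoop tm R N f ε L₁ L₂ α Δ δ'' n x').map
              (Outcome.addTime (c + tm.grad + tm.vec + c'))

/-- The accelerated non-convex method started at `x₁`, with all loops cut off after `n` passes. -/
def accnc {d : ℕ} (tm : OpTimes) (R : EigRoutine d) (n : ℕ) (x₁ : Vec d) (f : Vec d → ℝ)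
    (ε L₁ L₂ α Δ δ : ℝ) : PMF (Outcome d) :=
  let K : ℕ := ⌈1 + Δ * (12 * L₂ ^ 2 / α ^ 3 + √10 * L₂ / (α * ε))⌉₊
  accncLoop tm R n f ε L₁ L₂ α Δ (δ / K) n x₁

/-- The parameter `α = min {L₁, max {ε² Δ⁻¹, ε^(1/2) L₂^(1/2)}}`. -/
def alphaParam (ε L₁ L₂ Δ : ℝ) : ℝ :=
  min L₁ (max (ε ^ 2 * Δ⁻¹) (ε ^ (1 / 2 : ℝ) * L₂ ^ (1 / 2 : ℝ)))

/-- With probability at least `1 - δ` the method terminates within time `t` and returns a point `x`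
with `‖∇f(x)‖ ≤ ε` and `λ_min(∇²f(x)) ≥ -2 ε^(1/2) L₂^(1/2)`: this holds for the method cut off
after any sufficiently large number `n` of passes through its loops. -/
def SucceedsWithin {d : ℕ} (tm : OpTimes) (R : EigRoutine d) (x₁ : Vec d) (f : Vec d → ℝ)
    (ε L₁ L₂ Δ δ t : ℝ) : Prop :=
  ∃ n₀ : ℕ, ∀ n ≥ n₀,
    ENNReal.ofReal (1 - δ) ≤
      (accnc tm R n x₁ f ε L₁ L₂ (alphaParam ε L₁ L₂ Δ) Δ δ).toOuterMeasure
        {o | ∃ (x : Vec d) (s : ℝ), o = some (x, s) ∧ ‖gradient f x‖ ≤ ε ∧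
          -2 * ε ^ (1 / 2 : ℝ) * L₂ ^ (1 / 2 : ℝ) ≤ lamMin (hess f x) ∧ s ≤ t}

/-- The quantity `Δ L₁^(1/2) L₂^(1/4) ε^(-7/4)`. -/
def rate (ε L₁ L₂ Δ : ℝ) : ℝ :=
  Δ * L₁ ^ (1 / 2 : ℝ) * L₂ ^ (1 / 4 : ℝ) * ε ^ (-(7 / 4) : ℝ)

/-- The logarithmic factor hidden in the soft-O notation. -/
def logFactor (d : ℕ) (ε L₁ L₂ Δ δ : ℝ) : ℝ :=
  Real.log (1 + L₁ + L₂ + Δ + d + 1 / δ + 1 / ε)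

end NCAccel

end

open NCAccel

/-! Eigenvector routines. If the overlap of the start vector $g$ with a bottom eigenvector is at
least $\|g\|$ divided by a Chebyshev growth factor, some polynomial in $H$ applied to $g$ has
Rayleigh quotient at most $\lambda_{\min}+\eta$ (`exists_krylov_rayleigh_le`), and the Ritz vector
is at least as good (`inner_ritz_le`). An integer grid of side about $1/\delta'$ gives such an
overlap with probability $1-\delta'$ by a counting argument (`uniform_large_sum_ge`).

The non-convex method. Negative curvature descent lowers $f$ by at least $u=\alpha^3/(12L_2^2)$ per
step and otherwise stops at $\hat x$ with $\lambda_{\min}(\nabla^2 f(\hat x))\ge-\alpha$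
(`ncdLoop_spec`). Around such a point the Hessian stays above $-3\alpha$ up to distance
$2\alpha/L_2$; farther out the penalty compensates the curvature $-L_1$. Hence the penalized
function is $3\alpha$-almost convex and $5L_1$-smooth (`GradMono.penalized`, `Smooth.penalized`),
and accelerated proximal steps apply. They either reach a point where $\|\nabla f\|\le\epsilon$, or
travel a definite distance $\rho$, and travelling costs function value, at least $2u$
(`acagdLoop_spec`, `acagd_penalized_spec`).

Both phases pay in decrease of $f$, so the potential `passBound` bounds the number of passes by
$\Delta_f/u+2$, and failure probabilities add along the run (`accncLoop_spec`).

The condition on $\epsilon$ makes $\alpha=\min\{L_1,\sqrt{\epsilon L_2}\}$. If $\alpha=L_1$,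
smoothness alone bounds the curvature and no eigenvectors are needed. If $\alpha=\sqrt{\epsilon
L_2}$, there are $O(\Delta_f\alpha/\epsilon^2)$ units of work, each costing
$\sqrt{L_1/\alpha}\,\log\tau$ operations; the product is the claimed rate. -/

namespace NCAccel

/-! ### Symmetric operators in an eigenbasis -/

/-- Diagonalization of a symmetric operator, with the smallest eigenvalue attained. -/
theorem exists_eigenbasis {d : ℕ} (hd : 0 < d) (H : Vec d →L[ℝ] Vec d)
    (hH : (H : Vec d →ₗ[ℝ] Vec d).IsSymmetric) :
    ∃ (e : OrthonormalBasis (Fin d) ℝ (Vec d)) (lam : Fin d → ℝ),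
      (∀ i, H (e i) = lam i • e i) ∧ ∃ i₀, lam i₀ = lamMin H ∧ ∀ i, lamMin H ≤ lam i := by
  have hn : Module.finrank ℝ (Vec d) = d := by simp
  let e := hH.eigenvectorBasis hn
  let lam : Fin d → ℝ := hH.eigenvalues hn
  have he : ∀ i, H (e i) = lam i • e i := fun i => hH.apply_eigenvectorBasis hn i
  have : Nonempty (Fin d) := ⟨⟨0, hd⟩⟩
  obtain ⟨i₀, hi₀⟩ := Finite.exists_min lam
  have hleast : IsLeast {μ : ℝ | Module.End.HasEigenvalue (H : Vec d →ₗ[ℝ] Vec d) μ} (lam i₀) := by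
    refine ⟨hH.hasEigenvalue_eigenvalues hn i₀, fun μ hμ => ?_⟩
    obtain ⟨v, hv⟩ := hμ.exists_hasEigenvector
    have hv0 : v ≠ 0 := hv.2
    have hHv : H v = μ • v := hv.apply_eq_smul
    obtain ⟨i, hi⟩ : ∃ i, inner ℝ (e i) v ≠ 0 := by
      by_contra! hcon
      exact hv0 (by
        have := e.sum_repr' v
        simpa [hcon] using this.symm)
    have h1 : inner ℝ (e i) (H v) = inner ℝ (H (e i)) v := (hH (e i) v).symm
    rw [hHv, he i, inner_smul_right, inner_smul_left] at h1
    have : μ = lam i := mul_right_cancel₀ hi (by simpa using h1)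
    exact this ▸ hi₀ i
  have hmin : lamMin H = lam i₀ := hleast.csInf_eq
  exact ⟨e, lam, he, i₀, hmin.symm, fun i => hmin ▸ hi₀ i⟩

theorem inner_apply_eq_sum {d : ℕ} {H : Vec d →L[ℝ] Vec d}
    (hH : (H : Vec d →ₗ[ℝ] Vec d).IsSymmetric)
    {e : OrthonormalBasis (Fin d) ℝ (Vec d)} {lam : Fin d → ℝ} (he : ∀ i, H (e i) = lam i • e i)
    (v : Vec d) : inner ℝ v (H v) = ∑ i, lam i * inner ℝ (e i) v ^ 2 := by
  rw [← e.sum_inner_mul_inner]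
  refine Finset.sum_congr rfl fun i _ => ?_
  have h1 : inner ℝ (e i) (H v) = inner ℝ (H (e i)) v := (hH (e i) v).symm
  rw [h1, he i, inner_smul_left, real_inner_comm v]
  simp only [conj_trivial]; ring

theorem norm_sq_eq_sum_inner {d : ℕ} (e : OrthonormalBasis (Fin d) ℝ (Vec d)) (v : Vec d) :
    ‖v‖ ^ 2 = ∑ i, inner ℝ (e i) v ^ 2 := by
  rw [← e.sum_sq_norm_inner_right v]
  simp

/-- The Rayleigh quotient is bounded below by the smallest eigenvalue. -/
theorem lamMin_mul_le_inner {d : ℕ} (hd : 0 < d) {H : Vec d →L[ℝ] Vec d}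
    (hH : (H : Vec d →ₗ[ℝ] Vec d).IsSymmetric) (v : Vec d) :
    lamMin H * ‖v‖ ^ 2 ≤ inner ℝ v (H v) := by
  obtain ⟨e, lam, he, i₀, -, hmin⟩ := exists_eigenbasis hd H hH
  rw [inner_apply_eq_sum hH he, norm_sq_eq_sum_inner e, Finset.mul_sum]
  exact Finset.sum_le_sum fun i _ => mul_le_mul_of_nonneg_right (hmin i) (sq_nonneg _)

theorem neg_norm_le_lamMin {d : ℕ} (hd : 0 < d) {H : Vec d →L[ℝ] Vec d}
    (hH : (H : Vec d →ₗ[ℝ] Vec d).IsSymmetric) : -‖H‖ ≤ lamMin H := by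
  obtain ⟨e, lam, he, i₀, h0, -⟩ := exists_eigenbasis hd H hH
  have h1 := H.le_opNorm (e i₀)
  rw [he, norm_smul, e.orthonormal.1 i₀, mul_one, mul_one, h0, Real.norm_eq_abs] at h1
  linarith [neg_abs_le (lamMin H)]

/-! ### Odd Chebyshev polynomials -/

open Polynomial in
/-- A polynomial `p` of degree at most `n` such that `y p(y²)` is, up to sign, the Chebyshev
polynomial of degree `2 n + 1`. -/
theorem exists_odd_chebyshev (n : ℕ) : ∃ p : ℝ[X], p.natDegree ≤ n ∧
    (∀ φ : ℝ, Real.sin φ * p.eval (Real.sin φ ^ 2) = Real.sin ((2 * n + 1) * φ)) ∧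
    ∀ ψ : ℝ, Real.sinh ψ * p.eval (-Real.sinh ψ ^ 2) = Real.sinh ((2 * n + 1) * ψ) := by
  induction n using Nat.twoStepInduction with
  | zero => exact ⟨1, by simp, fun φ => by simp, fun ψ => by simp⟩
  | one =>
    refine ⟨C 3 - C 4 * X, by compute_degree, fun φ => ?_, fun ψ => ?_⟩
    · have h3 : (2 * ((1 : ℕ) : ℝ) + 1) * φ = 3 * φ := by norm_num
      rw [h3, Real.sin_three_mul]; simp; ring
    · have h3 : (2 * ((1 : ℕ) : ℝ) + 1) * ψ = 3 * ψ := by norm_num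
      rw [h3, Real.sinh_three_mul]; simp; ring
  | more n ih1 ih2 =>
    obtain ⟨p, hp, hps, hph⟩ := ih1
    obtain ⟨q, hq, hqs, hqh⟩ := ih2
    -- The recurrence is $\sin(a+2\varphi)+\sin(a-2\varphi)=2\cos 2\varphi\,\sin a$ with $2\cos
    -- 2\varphi=2-4\sin^2\varphi$. The hyperbolic identity obeys the same recurrence with
    -- $\sin^2\varphi$ replaced by $-\sinh^2\psi$.
    refine ⟨(C 2 - C 4 * X) * q - p, ?_, fun φ => ?_, fun ψ => ?_⟩
    · refine (natDegree_sub_le _ _).trans (max_le ?_ (by omega))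
      refine natDegree_mul_le.trans ?_
      have : (C (2 : ℝ) - C 4 * X).natDegree ≤ 1 := by compute_degree
      omega
    · specialize hps φ
      have e1 : (2 * ((n + 2 : ℕ) : ℝ) + 1) * φ = (2 * ((n + 1 : ℕ) : ℝ) + 1) * φ + 2 * φ := by
        push_cast; ring
      have e2 : (2 * (n : ℝ) + 1) * φ = (2 * ((n + 1 : ℕ) : ℝ) + 1) * φ - 2 * φ := by
        push_cast; ring
      rw [e2, Real.sin_sub] at hps
      rw [e1, Real.sin_add, eval_sub, mul_sub, hps, eval_mul]
      simp only [eval_sub, eval_mul, eval_C, eval_X]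
      have := hqs φ
      have hc : Real.cos (2 * φ) = 1 - 2 * Real.sin φ ^ 2 := by
        rw [Real.cos_two_mul, Real.cos_sq']; ring
      rw [← this, hc]; ring
    · specialize hph ψ
      have e1 : (2 * ((n + 2 : ℕ) : ℝ) + 1) * ψ = (2 * ((n + 1 : ℕ) : ℝ) + 1) * ψ + 2 * ψ := by
        push_cast; ring
      have e2 : (2 * (n : ℝ) + 1) * ψ = (2 * ((n + 1 : ℕ) : ℝ) + 1) * ψ - 2 * ψ := by
        push_cast; ring
      rw [e2, Real.sinh_sub] at hph
      rw [e1, Real.sinh_add, eval_sub, mul_sub, hph, eval_mul]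
      simp only [eval_sub, eval_mul, eval_C, eval_X]
      have := hqh ψ
      have hc : Real.cosh (2 * ψ) = 1 + 2 * Real.sinh ψ ^ 2 := by
        rw [Real.cosh_two_mul, Real.cosh_sq]; ring
      rw [← this, hc]; ring

open Polynomial in
/-- Among polynomials bounded in a weighted sense on `[a, b]`, one that is large at `a - ε`. -/
theorem exists_growth_polynomial (n : ℕ) {s : ℝ} (hs : 0 ≤ s) : ∃ p : ℝ[X], p.natDegree ≤ n ∧
    (∀ u, 0 ≤ u → u ≤ 1 → u * p.eval u ^ 2 ≤ 1) ∧
    s * p.eval (-s) ^ 2 = Real.sinh ((2 * n + 1) * Real.arsinh √s) ^ 2 := by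
  obtain ⟨p, hp, hps, hph⟩ := exists_odd_chebyshev n
  refine ⟨p, hp, fun u hu0 hu1 => ?_, ?_⟩
  · have h1 : Real.sin (Real.arcsin √u) = √u :=
      Real.sin_arcsin (by linarith [Real.sqrt_nonneg u]) (Real.sqrt_le_one.2 hu1)
    have h2 := hps (Real.arcsin √u)
    rw [h1, Real.sq_sqrt hu0] at h2
    calc u * p.eval u ^ 2 = (√u * p.eval u) ^ 2 := by rw [mul_pow, Real.sq_sqrt hu0]
      _ ≤ 1 := by rw [h2]; exact Real.sin_sq_le_one _
  · have h2 := hph (Real.arsinh √s)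
    rw [Real.sinh_arsinh, Real.sq_sqrt hs] at h2
    rw [← h2, mul_pow, Real.sq_sqrt hs]

/-! ### Accuracy of the Krylov space -/

open Polynomial in
theorem inner_aeval_apply {d : ℕ} {H : Vec d →L[ℝ] Vec d}
    (hH : (H : Vec d →ₗ[ℝ] Vec d).IsSymmetric)
    {e : OrthonormalBasis (Fin d) ℝ (Vec d)} {lam : Fin d → ℝ} (he : ∀ i, H (e i) = lam i • e i)
    (p : ℝ[X]) (g : Vec d) (i : Fin d) :
    inner ℝ (e i) (aeval (H : Vec d →ₗ[ℝ] Vec d) p g) = p.eval (lam i) * inner ℝ (e i) g := by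
  induction p using Polynomial.induction_on' with
  | add p q hp hq => simp [inner_add_right, hp, hq, add_mul]
  | monomial n a =>
    have key : ∀ n : ℕ, inner ℝ (e i) (((H : Vec d →ₗ[ℝ] Vec d) ^ n) g)
        = lam i ^ n * inner ℝ (e i) g := by
      intro n
      induction n with
      | zero => simp
      | succ n ih =>
        rw [pow_succ', Module.End.mul_apply, ← hH, ContinuousLinearMap.coe_coe, he,
          inner_smul_left, ih]
        simp only [conj_trivial]; ring
    simp [aeval_monomial, inner_smul_right, key, mul_assoc]

open Polynomial in
/-- If the start vector `g` has a large enough component along an eigenvector for the smallest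
eigenvalue, then the Krylov space of order `n + 1` contains a vector of small Rayleigh quotient. -/
theorem exists_krylov_rayleigh_le {d : ℕ} {H : Vec d →L[ℝ] Vec d}
    (hH : (H : Vec d →ₗ[ℝ] Vec d).IsSymmetric)
    {e : OrthonormalBasis (Fin d) ℝ (Vec d)} {lam : Fin d → ℝ} (he : ∀ i, H (e i) = lam i • e i)
    {i₀ : Fin d} (hmin : ∀ i, lam i₀ ≤ lam i) {L ε : ℝ} (hL : ‖H‖ ≤ L) (hε : 0 < ε)
    (hεL : ε < 2 * L) (n : ℕ) (g : Vec d)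
    (hg0 : inner ℝ (e i₀) g ≠ 0)
    (hg : ‖g‖ ≤ |inner ℝ (e i₀) g| * Real.sinh ((2 * n + 1) * Real.arsinh √(ε / (2 * L)))) :
    ∃ p : ℝ[X], p.natDegree ≤ n ∧ aeval (H : Vec d →ₗ[ℝ] Vec d) p g ≠ 0 ∧
      inner ℝ (aeval (H : Vec d →ₗ[ℝ] Vec d) p g) (H (aeval (H : Vec d →ₗ[ℝ] Vec d) p g)) ≤
        (lam i₀ + ε) * ‖aeval (H : Vec d →ₗ[ℝ] Vec d) p g‖ ^ 2 := by
  -- The goal is $\sum_i(\lambda_i-a)p(\lambda_i)^2g_i^2\le0$. The map $\lambda\mapsto(\lambda-a)/D$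
  -- sends every eigenvalue above $a$ into $[0,1]$, because the spectrum lies in $[-L,L]$, and sends
  -- the smallest one to $-\epsilon/D$. The weight $u$ of the growth polynomial is the factor
  -- $\lambda-a$.
  set a := lam i₀ + ε with ha
  set D := 2 * L - ε with hD
  have hDpos : 0 < D := by rw [hD]; linarith
  have hlam : ∀ i, |lam i| ≤ L := fun i => by
    have h1 := H.le_opNorm (e i)
    rw [he, norm_smul, e.orthonormal.1 i, mul_one, mul_one, Real.norm_eq_abs] at h1
    exact h1.trans hL
  have hs : 0 ≤ ε / D := by positivity
  obtain ⟨q, hq, hq1, hq2⟩ := exists_growth_polynomial n hs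
  set S := Real.sinh ((2 * n + 1) * Real.arsinh √(ε / D)) with hS
  have hgpos : 0 < ‖g‖ := norm_pos_iff.2 fun h => hg0 (by simp [h])
  have hSle : Real.sinh ((2 * n + 1) * Real.arsinh √(ε / (2 * L))) ≤ S := by
    rw [hS, Real.sinh_le_sinh]
    refine mul_le_mul_of_nonneg_left (Real.arsinh_le_arsinh.2 (Real.sqrt_le_sqrt ?_)) (by positivity)
    exact div_le_div_of_nonneg_left hε.le hDpos (by rw [hD]; linarith)
  have hgS : ‖g‖ ≤ |inner ℝ (e i₀) g| * S :=
    hg.trans (mul_le_mul_of_nonneg_left hSle (abs_nonneg _))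
  have hgS2 : ‖g‖ ^ 2 ≤ inner ℝ (e i₀) g ^ 2 * S ^ 2 := by
    rw [← sq_abs (inner ℝ (e i₀) g), ← mul_pow]
    exact pow_le_pow_left₀ hgpos.le hgS 2
  set p : ℝ[X] := q.comp (C D⁻¹ * (X - C a)) with hp
  have hpe : ∀ i, p.eval (lam i) = q.eval ((lam i - a) / D) := fun i => by
    simp [hp, div_eq_inv_mul]
  have hp0 : p.eval (lam i₀) = q.eval (-(ε / D)) := by
    rw [hpe]; congr 1; rw [ha]; ring
  have hD2 : ε * q.eval (-(ε / D)) ^ 2 = D * S ^ 2 := by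
    rw [← hq2]; field_simp
  refine ⟨p, ?_, fun h0 => ?_, ?_⟩
  · rw [hp]
    refine natDegree_comp_le.trans ?_
    have : (C D⁻¹ * (X - C a)).natDegree ≤ 1 := by compute_degree
    nlinarith
  · have h1 := inner_aeval_apply hH he p g i₀
    rw [h0, inner_zero_right, hp0] at h1
    have h2 : q.eval (-(ε / D)) = 0 := (mul_eq_zero.1 h1.symm).resolve_right hg0
    rw [h2] at hD2
    have : S ^ 2 = 0 := by
      rcases mul_eq_zero.1 (hD2.symm.trans (by ring) : D * S ^ 2 = 0) with h | h
      · exact absurd h hDpos.ne'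
      · exact h
    rw [this, mul_zero] at hgS2
    nlinarith
  · rw [← sub_nonpos, inner_apply_eq_sum hH he, norm_sq_eq_sum_inner e, Finset.mul_sum,
      ← Finset.sum_sub_distrib]
    -- Eigenvalues above $a$ contribute at most $Dg_i^2$, those below contribute nothing positive,
    -- and $i_0$ contributes $-DS^2g_{i_0}^2$, which outweighs $D\|g\|^2$ by `hgS2`.
    have hterm : ∀ i, lam i * inner ℝ (e i) (aeval (H : Vec d →ₗ[ℝ] Vec d) p g) ^ 2 -
        a * inner ℝ (e i) (aeval (H : Vec d →ₗ[ℝ] Vec d) p g) ^ 2 ≤ D * inner ℝ (e i) g ^ 2 -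
          (if i = i₀ then D * S ^ 2 * inner ℝ (e i₀) g ^ 2 else 0) := by
      intro i
      rw [inner_aeval_apply hH he, hpe]
      split_ifs with hi
      · subst hi
        have h3 : (lam i - a) / D = -(ε / D) := by rw [ha]; ring
        rw [h3, ← hD2]
        have : 0 ≤ D * inner ℝ (e i) g ^ 2 := by positivity
        rw [ha]; nlinarith
      · rw [sub_zero]
        rcases le_total 0 ((lam i - a) / D) with h | h
        · have h4 : (lam i - a) / D ≤ 1 := by
            rw [div_le_one hDpos, ha, hD]
            have h5 := (abs_le.1 (hlam i)).2
            have h6 := (abs_le.1 (hlam i₀)).1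
            linarith
          have h5 := hq1 _ h h4
          have h6 : lam i - a = D * ((lam i - a) / D) := by field_simp
          calc _ = (lam i - a) * (q.eval ((lam i - a) / D) * inner ℝ (e i) g) ^ 2 := by ring
            _ = D * (((lam i - a) / D) * q.eval ((lam i - a) / D) ^ 2) * inner ℝ (e i) g ^ 2 := by
              rw [mul_pow, ← mul_assoc, ← mul_assoc, ← h6]
            _ ≤ D * 1 * inner ℝ (e i) g ^ 2 := by gcongr
            _ = _ := by ring
        · have h6 : lam i - a = D * ((lam i - a) / D) := by field_simp
          have h7 : lam i - a ≤ 0 := by rw [h6]; exact mul_nonpos_of_nonneg_of_nonpos hDpos.le h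
          have h8 : 0 ≤ D * inner ℝ (e i) g ^ 2 := by positivity
          have h9 : 0 ≤ (q.eval ((lam i - a) / D) * inner ℝ (e i) g) ^ 2 := sq_nonneg _
          nlinarith
    refine (Finset.sum_le_sum fun i _ => hterm i).trans ?_
    rw [Finset.sum_sub_distrib, ← Finset.mul_sum, ← norm_sq_eq_sum_inner]
    simp only [Finset.sum_ite_eq', Finset.mem_univ, if_true]
    nlinarith

/-! ### The Lanczos routine -/

theorem inner_iterate_iterate {d : ℕ} {H : Vec d →L[ℝ] Vec d}
    (hH : (H : Vec d →ₗ[ℝ] Vec d).IsSymmetric) (g : Vec d) (a b : ℕ) :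
    inner ℝ (H^[a] g) (H^[b] g) = inner ℝ g (H^[a + b] g) := by
  induction a generalizing b with
  | zero => simp
  | succ a ih =>
    have h1 : inner ℝ (H (H^[a] g)) (H^[b] g) = inner ℝ (H^[a] g) (H (H^[b] g)) := hH _ _
    rw [Function.iterate_succ_apply', h1, ← Function.iterate_succ_apply' H, ih,
      Nat.add_right_comm, Nat.add_assoc]

theorem moment_add {d : ℕ} {H : Vec d →L[ℝ] Vec d}
    (hH : (H : Vec d →ₗ[ℝ] Vec d).IsSymmetric) (g : Vec d) (a b : ℕ) :
    moment H g (a + b) = inner ℝ (H^[a] g) (H^[b] g) := by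
  have h : (a + b) / 2 + (a + b + 1) / 2 = a + b := by omega
  rw [moment, inner_iterate_iterate hH, inner_iterate_iterate hH, h]

theorem moment_gram {d : ℕ} {H : Vec d →L[ℝ] Vec d}
    (hH : (H : Vec d →ₗ[ℝ] Vec d).IsSymmetric) (g : Vec d) {k : ℕ} (c : Fin k → ℝ) :
    ∑ i, ∑ j, c i * c j * moment H g (i + j) = ‖∑ i : Fin k, c i • (H^[(i : ℕ)] g)‖ ^ 2 := by
  rw [← real_inner_self_eq_norm_sq, sum_inner]
  refine Finset.sum_congr rfl fun i _ => ?_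
  rw [inner_sum]
  refine Finset.sum_congr rfl fun j _ => ?_
  rw [moment_add hH, inner_smul_left, inner_smul_right]
  simp only [conj_trivial]; ring

theorem moment_rayleigh {d : ℕ} {H : Vec d →L[ℝ] Vec d}
    (hH : (H : Vec d →ₗ[ℝ] Vec d).IsSymmetric) (g : Vec d) {k : ℕ} (c : Fin k → ℝ) :
    ∑ i, ∑ j, c i * c j * moment H g (i + j + 1) =
      inner ℝ (∑ i : Fin k, c i • (H^[(i : ℕ)] g)) (H (∑ i : Fin k, c i • (H^[(i : ℕ)] g))) := by
  rw [sum_inner]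
  refine Finset.sum_congr rfl fun i _ => ?_
  rw [map_sum, inner_sum]
  refine Finset.sum_congr rfl fun j _ => ?_
  rw [add_assoc, moment_add hH, map_smul, inner_smul_left, inner_smul_right,
    Function.iterate_succ_apply']
  simp only [conj_trivial]; ring

/-- The Ritz vector of the Krylov space of order `k`. -/
theorem ritzCoeffs_spec {d : ℕ} {H : Vec d →L[ℝ] Vec d}
    (hH : (H : Vec d →ₗ[ℝ] Vec d).IsSymmetric) {g : Vec d} (hg : g ≠ 0) (n : ℕ) :
    ‖∑ i : Fin (n + 1), ritzCoeffs (n + 1) (moment H g) i • (H^[(i : ℕ)] g)‖ = 1 ∧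
    ∀ c' : Fin (n + 1) → ℝ, ‖∑ i, c' i • (H^[(i : ℕ)] g)‖ = 1 →
      inner ℝ (∑ i : Fin (n + 1), ritzCoeffs (n + 1) (moment H g) i • (H^[(i : ℕ)] g))
        (H (∑ i : Fin (n + 1), ritzCoeffs (n + 1) (moment H g) i • (H^[(i : ℕ)] g))) ≤
      inner ℝ (∑ i, c' i • (H^[(i : ℕ)] g)) (H (∑ i, c' i • (H^[(i : ℕ)] g))) := by
  let Φ : (Fin (n + 1) → ℝ) →ₗ[ℝ] Vec d := Fintype.linearCombination ℝ fun i => H^[(i : ℕ)] g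
  have hΦ : ∀ c, Φ c = ∑ i, c i • (H^[(i : ℕ)] g) := fun c => rfl
  have hex : ∃ c : Fin (n + 1) → ℝ,
      ∑ i, ∑ j, c i * c j * moment H g (i + j) = 1 ∧
      ∀ c' : Fin (n + 1) → ℝ, ∑ i, ∑ j, c' i * c' j * moment H g (i + j) = 1 →
        ∑ i, ∑ j, c i * c j * moment H g (i + j + 1) ≤
          ∑ i, ∑ j, c' i * c' j * moment H g (i + j + 1) := by
    -- The minimum is taken over unit vectors of the range, not over coefficients: the vectors
    -- $H^ig$ may be dependent, and then the set of admissible coefficients is unbounded.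
    have hcomp : IsCompact (Metric.sphere (0 : Vec d) 1 ∩ (LinearMap.range Φ : Set (Vec d))) :=
      (isCompact_sphere _ _).inter_right (Submodule.closed_of_finiteDimensional _)
    have hne : (Metric.sphere (0 : Vec d) 1 ∩ (LinearMap.range Φ : Set (Vec d))).Nonempty := by
      refine ⟨‖g‖⁻¹ • g, ?_, Pi.single 0 ‖g‖⁻¹, ?_⟩
      · have := norm_ne_zero_iff.2 hg
        simp [norm_smul, this]
      · rw [hΦ, Finset.sum_eq_single 0] <;> simp +contextual
    obtain ⟨v, ⟨hv1, c, rfl⟩, hvmin⟩ := hcomp.exists_isMinOn hne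
      (f := fun v => inner ℝ v (H v)) (by fun_prop)
    refine ⟨c, ?_, fun c' hc' => ?_⟩
    · rw [moment_gram hH, ← hΦ, mem_sphere_zero_iff_norm.1 hv1, one_pow]
    · rw [moment_gram hH, ← hΦ] at hc'
      rw [moment_rayleigh hH, moment_rayleigh hH]
      refine hvmin ⟨mem_sphere_zero_iff_norm.2 ?_, c', rfl⟩
      exact (pow_eq_one_iff_of_nonneg (norm_nonneg _) two_ne_zero).1 hc'
  have hspec : ∑ i, ∑ j, ritzCoeffs (n + 1) (moment H g) i * ritzCoeffs (n + 1) (moment H g) j *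
      moment H g (i + j) = 1 ∧ ∀ c' : Fin (n + 1) → ℝ,
      ∑ i, ∑ j, c' i * c' j * moment H g (i + j) = 1 →
        ∑ i, ∑ j, ritzCoeffs (n + 1) (moment H g) i * ritzCoeffs (n + 1) (moment H g) j *
          moment H g (i + j + 1) ≤ ∑ i, ∑ j, c' i * c' j * moment H g (i + j + 1) :=
    Classical.epsilon_spec hex
  generalize ritzCoeffs (n + 1) (moment H g) = c at hspec ⊢
  obtain ⟨h1, h2⟩ := hspec
  rw [moment_gram hH] at h1
  refine ⟨(pow_eq_one_iff_of_nonneg (norm_nonneg _) two_ne_zero).1 h1, fun c' hc' => ?_⟩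
  have := h2 c' (by rw [moment_gram hH, hc', one_pow])
  rwa [moment_rayleigh hH, moment_rayleigh hH] at this

open Polynomial in
/-- The Ritz vector does at least as well as any polynomial in `H` applied to the start vector. -/
theorem inner_ritz_le {d : ℕ} {H : Vec d →L[ℝ] Vec d}
    (hH : (H : Vec d →ₗ[ℝ] Vec d).IsSymmetric) {g : Vec d} (hg : g ≠ 0) {n : ℕ} {p : ℝ[X]}
    (hp : p.natDegree ≤ n) {a : ℝ} (hp0 : aeval (H : Vec d →ₗ[ℝ] Vec d) p g ≠ 0)
    (ha : inner ℝ (aeval (H : Vec d →ₗ[ℝ] Vec d) p g) (H (aeval (H : Vec d →ₗ[ℝ] Vec d) p g)) ≤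
        a * ‖aeval (H : Vec d →ₗ[ℝ] Vec d) p g‖ ^ 2) :
    inner ℝ (∑ i : Fin (n + 1), ritzCoeffs (n + 1) (moment H g) i • (H^[(i : ℕ)] g))
      (H (∑ i : Fin (n + 1), ritzCoeffs (n + 1) (moment H g) i • (H^[(i : ℕ)] g))) ≤ a := by
  set w := aeval (H : Vec d →ₗ[ℝ] Vec d) p g with hw
  have hwn : ‖w‖ ≠ 0 := norm_ne_zero_iff.2 hp0
  have hsum : ∑ i : Fin (n + 1), p.coeff i • (H^[(i : ℕ)] g) = w := by
    rw [hw, aeval_eq_sum_range' (Nat.lt_succ_of_le hp), LinearMap.sum_apply,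
      ← Fin.sum_univ_eq_sum_range fun i => (p.coeff i • (H : Vec d →ₗ[ℝ] Vec d) ^ i) g]
    refine Finset.sum_congr rfl fun i _ => ?_
    rw [LinearMap.smul_apply, Module.End.pow_apply]; rfl
  have hsum' : ∑ i : Fin (n + 1), (‖w‖⁻¹ * p.coeff i) • (H^[(i : ℕ)] g) = ‖w‖⁻¹ • w := by
    rw [← hsum, Finset.smul_sum]
    exact Finset.sum_congr rfl fun i _ => (mul_smul _ _ _)
  have h2 := (ritzCoeffs_spec hH hg n).2 (fun i => ‖w‖⁻¹ * p.coeff i)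
    (by rw [hsum', norm_smul, norm_inv, norm_norm, inv_mul_cancel₀ hwn])
  rw [hsum'] at h2
  refine h2.trans ?_
  rw [map_smul, inner_smul_left, inner_smul_right, conj_trivial]
  calc _ = (‖w‖⁻¹) ^ 2 * inner ℝ w (H w) := by ring
    _ ≤ (‖w‖⁻¹) ^ 2 * (a * ‖w‖ ^ 2) := by gcongr
    _ = a := by field_simp

/-- Few start vectors on the integer grid are almost orthogonal to a given vector. -/
theorem card_small_sum_mul_le {d N : ℕ} (u : Fin d → ℝ) (i₁ : Fin d) :
    (Finset.univ.filter fun s : Fin d → Fin N =>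
      |∑ i, (((s i : ℕ) : ℝ) + 1) * u i| < |u i₁| / 2).card * N ≤ N ^ d := by
  classical
  set B := Finset.univ.filter fun s : Fin d → Fin N =>
      |∑ i, (((s i : ℕ) : ℝ) + 1) * u i| < |u i₁| / 2 with hB
  have hcard : Fintype.card ((j : {j : Fin d // j ≠ i₁}) → Fin N) * N = N ^ d := by
    have hd : 0 < d := i₁.pos
    rw [Fintype.card_fun, Fintype.card_fin, Fintype.card_subtype_compl, Fintype.card_fin,
      Fintype.card_subtype_eq, ← pow_succ]
    congr 1; omega
  rw [← hcard]
  refine Nat.mul_le_mul_right _ ?_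
  rw [← Finset.card_univ]
  -- Forgetting coordinate $i_1$ is injective on the bad set: two bad points that agree elsewhere
  -- have sums differing by an integer multiple of $u_{i_1}$ and by less than $|u_{i_1}|$.
  refine Finset.card_le_card_of_injOn (fun s j => s j.1) (fun _ _ => Finset.mem_coe.2
    (Finset.mem_univ _)) fun s hs t ht hst => ?_
  have hs' := (Finset.mem_filter.1 hs).2
  have ht' := (Finset.mem_filter.1 ht).2
  have hne : ∀ j, j ≠ i₁ → s j = t j := fun j hj => congrFun hst ⟨j, hj⟩
  rw [← Finset.add_sum_erase _ _ (Finset.mem_univ i₁)] at hs' ht'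
  have hrest : ∑ x ∈ Finset.univ.erase i₁, (((s x : ℕ) : ℝ) + 1) * u x =
      ∑ x ∈ Finset.univ.erase i₁, (((t x : ℕ) : ℝ) + 1) * u x :=
    Finset.sum_congr rfl fun x hx => by rw [hne x (Finset.ne_of_mem_erase hx)]
  rw [hrest] at hs'
  set c := ∑ x ∈ Finset.univ.erase i₁, (((t x : ℕ) : ℝ) + 1) * u x
  have hdiff : |(((s i₁ : ℕ) : ℝ) - ((t i₁ : ℕ) : ℝ))| * |u i₁| < 1 * |u i₁| := by
    rw [← abs_mul]
    have := abs_sub ((((s i₁ : ℕ) : ℝ) + 1) * u i₁ + c) ((((t i₁ : ℕ) : ℝ) + 1) * u i₁ + c)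
    have e : (((s i₁ : ℕ) : ℝ) + 1) * u i₁ + c - ((((t i₁ : ℕ) : ℝ) + 1) * u i₁ + c) =
      (((s i₁ : ℕ) : ℝ) - ((t i₁ : ℕ) : ℝ)) * u i₁ := by ring
    rw [e] at this
    linarith
  have h1 : |(((s i₁ : ℕ) : ℝ) - ((t i₁ : ℕ) : ℝ))| < 1 := lt_of_mul_lt_mul_right hdiff (abs_nonneg _)
  have h2 : s i₁ = t i₁ := by
    have h3 : |((s i₁ : ℕ) : ℤ) - ((t i₁ : ℕ) : ℤ)| < 1 := by exact_mod_cast h1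
    have := Int.abs_lt_one_iff.1 h3
    exact Fin.ext (by omega)
  funext j
  by_cases hj : j = i₁
  · rw [hj, h2]
  · exact hne j hj

/-- With probability at least `1 - 1/N`, a uniform start vector on the grid `{1, …, N}^d` is not
almost orthogonal to a given vector. -/
theorem uniform_large_sum_ge {d N : ℕ} (hN : 0 < N) (u : Fin d → ℝ) (i₁ : Fin d)
    [Nonempty (Fin d → Fin N)] :
    ENNReal.ofReal (1 - 1 / N) ≤ (PMF.uniformOfFintype (Fin d → Fin N)).toOuterMeasure
      {s | |u i₁| / 2 ≤ |∑ i, (((s i : ℕ) : ℝ) + 1) * u i|} := by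
  classical
  rw [PMF.toOuterMeasure_uniformOfFintype_apply, Fintype.card_fun, Fintype.card_fin,
    Fintype.card_fin]
  have hb := card_small_sum_mul_le (N := N) u i₁
  set b := (Finset.univ.filter fun s : Fin d → Fin N =>
      |∑ i, (((s i : ℕ) : ℝ) + 1) * u i| < |u i₁| / 2).card with hbdef
  have hcomp : Fintype.card {s : Fin d → Fin N | |u i₁| / 2 ≤ |∑ i, (((s i : ℕ) : ℝ) + 1) * u i|}
      + b = N ^ d := by
    have h1 := Finset.card_filter_add_card_filter_not (s := (Finset.univ : Finset (Fin d → Fin N)))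
      (fun s => |u i₁| / 2 ≤ |∑ i, (((s i : ℕ) : ℝ) + 1) * u i|)
    simp only [not_le, Finset.card_univ, Fintype.card_fun, Fintype.card_fin] at h1
    rw [← h1, hbdef]
    congr 1
    rw [← Set.toFinset_card]
    congr 1
    ext s; simp
  set G := Fintype.card {s : Fin d → Fin N | |u i₁| / 2 ≤ |∑ i, (((s i : ℕ) : ℝ) + 1) * u i|}
  have hN' : (0 : ℝ) < N := by exact_mod_cast hN
  have hreal : (1 - 1 / (N : ℝ)) ≤ (G : ℝ) / ((N ^ d : ℕ) : ℝ) := by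
    rw [le_div_iff₀ (by positivity)]
    have h1 : (G : ℝ) + b = ((N ^ d : ℕ) : ℝ) := by exact_mod_cast hcomp
    have h2 : (b : ℝ) * N ≤ ((N ^ d : ℕ) : ℝ) := by exact_mod_cast hb
    have h3 : (b : ℝ) ≤ ((N ^ d : ℕ) : ℝ) / N := by rwa [le_div_iff₀ hN']
    have h4 : (1 - 1 / (N : ℝ)) * ((N ^ d : ℕ) : ℝ) = ((N ^ d : ℕ) : ℝ) - ((N ^ d : ℕ) : ℝ) / N := by
      ring
    rw [h4]; linarith
  refine (ENNReal.ofReal_le_ofReal hreal).trans ?_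
  rw [ENNReal.ofReal_div_of_pos (by positivity), ENNReal.ofReal_natCast, ENNReal.ofReal_natCast]

theorem half_le_arsinh {s : ℝ} (hs0 : 0 ≤ s) (hs1 : s ≤ 1) : s / 2 ≤ Real.arsinh s := by
  rw [← Real.exp_le_exp, Real.exp_arsinh]
  have h1 := (abs_le.1 (Real.abs_exp_sub_one_sub_id_le (x := s / 2)
    (by rw [abs_of_nonneg (by linarith)]; linarith))).2
  have h2 : 1 ≤ √(1 + s ^ 2) := Real.one_le_sqrt.2 (by nlinarith)
  nlinarith

/-- The order of the Krylov space makes the Chebyshev growth factor larger than `6 d / δ`. -/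
theorem six_mul_le_sinh {L ε D : ℝ} (hε : 0 < ε) (hεL : ε < 2 * L) (hD : 2 ≤ D) {n : ℕ}
    (hn : 8 * √(L / ε) * Real.log D ≤ n) :
    6 * D ≤ Real.sinh ((2 * n + 1) * Real.arsinh √(ε / (2 * L))) := by
  have hL : 0 < L := by linarith
  set s := √(ε / (2 * L)) with hs
  have hs0 : 0 ≤ s := Real.sqrt_nonneg _
  have hs1 : s ≤ 1 := Real.sqrt_le_one.2 ((div_le_one (by linarith)).2 hεL.le)
  have hψ := half_le_arsinh hs0 hs1
  -- The product equals $1/\sqrt2$. With `half_le_arsinh` and the factor $8$ in the Krylov order,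
  -- the argument of $\sinh$ is at least $5\log D$. Then $\sinh\ge(D^5-1)/2\ge(16D-1)/2\ge6D$, using
  -- $D\ge2$.
  have hprod : 5 / 8 ≤ √(L / ε) * s := by
    rw [hs, ← Real.sqrt_mul (by positivity)]
    have : L / ε * (ε / (2 * L)) = 1 / 2 := by field_simp
    rw [this]
    exact Real.le_sqrt_of_sq_le (by norm_num)
  have hlog : 0 ≤ Real.log D := Real.log_nonneg (by linarith)
  have hx : 5 * Real.log D ≤ (2 * n + 1) * Real.arsinh s := by
    have h1 : 8 * √(L / ε) * Real.log D * s ≤ n * s := mul_le_mul_of_nonneg_right hn hs0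
    have h2 : 5 * Real.log D ≤ 8 * √(L / ε) * Real.log D * s := by nlinarith
    have hn0 : (0 : ℝ) ≤ n := Nat.cast_nonneg n
    nlinarith
  have h5 : Real.sinh (5 * Real.log D) ≤ Real.sinh ((2 * n + 1) * Real.arsinh s) :=
    Real.sinh_le_sinh.2 hx
  refine le_trans ?_ h5
  rw [Real.sinh_eq]
  have e1 : Real.exp (5 * Real.log D) = D ^ 5 := by
    have : 5 * Real.log D = Real.log (D ^ 5) := by rw [Real.log_pow]; norm_num
    rw [this, Real.exp_log (by positivity)]
  have e2 : Real.exp (-(5 * Real.log D)) ≤ 1 := Real.exp_le_one_iff.2 (by linarith)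
  rw [e1]
  have h16 : 2 ^ 4 * D ≤ D ^ 4 * D := by gcongr
  nlinarith

/-- The index is that of the largest coordinate of the unit vector, which is at least $1/\sqrt d$ in
absolute value. A good grid point then has overlap at least $1/(2\sqrt d)$ and norm at most $3\sqrt
d/\delta$; the ratio $6d/\delta$ is the growth that the Chebyshev polynomial has to supply. -/
theorem le_sinh_of_grid {d : ℕ} (hd : 0 < d) {e : Vec d} (he : ‖e‖ = 1) :
    ∃ i₁ : Fin d, ∀ {δ : ℝ} {N : ℕ} (s : Fin d → Fin N), 0 < δ → (N : ℝ) ≤ 3 / δ →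
      |e i₁| / 2 ≤ |∑ i, (((s i : ℕ) : ℝ) + 1) * e i| →
      0 < |inner ℝ e (WithLp.toLp 2 fun i => ((s i : ℕ) : ℝ) + 1 : Vec d)| ∧
      ‖(WithLp.toLp 2 fun i => ((s i : ℕ) : ℝ) + 1 : Vec d)‖ ≤
        |inner ℝ e (WithLp.toLp 2 fun i => ((s i : ℕ) : ℝ) + 1 : Vec d)| * (6 * (d / δ)) := by
  have : Nonempty (Fin d) := ⟨⟨0, hd⟩⟩
  have hd' : (0 : ℝ) < d := by exact_mod_cast hd
  obtain ⟨i₁, hi₁⟩ := Finite.exists_max fun i => |e i|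
  have hnorm : 1 ≤ d * |e i₁| ^ 2 := by
    have h1 : ‖e‖ ^ 2 = ∑ i, |e i| ^ 2 := by
      rw [EuclideanSpace.norm_sq_eq]; simp
    have h2 : ∑ i, |e i| ^ 2 ≤ ∑ _i : Fin d, |e i₁| ^ 2 :=
      Finset.sum_le_sum fun i _ => pow_le_pow_left₀ (abs_nonneg _) (hi₁ i) 2
    rw [he, one_pow] at h1
    simp only [Finset.sum_const, Finset.card_univ, Fintype.card_fin, nsmul_eq_mul] at h2
    linarith
  refine ⟨i₁, fun {δ N} s hδ hN hs => ?_⟩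
  have hin : inner ℝ e (WithLp.toLp 2 fun i => ((s i : ℕ) : ℝ) + 1 : Vec d) =
      ∑ i, (((s i : ℕ) : ℝ) + 1) * e i := by
    simp [PiLp.inner_apply]
  rw [hin]
  set a := |∑ i, (((s i : ℕ) : ℝ) + 1) * e i| with ha
  have hpos : 0 < |e i₁| := by
    rcases (abs_nonneg (e i₁)).eq_or_lt with h | h
    · rw [← h] at hnorm; norm_num at hnorm
    · exact h
  have ha0 : 0 < a := by linarith
  refine ⟨ha0, ?_⟩
  have hg : ‖(WithLp.toLp 2 fun i => ((s i : ℕ) : ℝ) + 1 : Vec d)‖ ^ 2 ≤ d * (3 / δ) ^ 2 := by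
    rw [EuclideanSpace.norm_sq_eq]
    have : ∀ i ∈ Finset.univ, ‖(WithLp.toLp 2 fun i => ((s i : ℕ) : ℝ) + 1 : Vec d) i‖ ^ 2 ≤
        (3 / δ) ^ 2 := by
      intro i _
      refine pow_le_pow_left₀ (norm_nonneg _) ?_ 2
      have h1 : ((s i : ℕ) : ℝ) + 1 ≤ N := by exact_mod_cast (s i).2
      have h2 : (0 : ℝ) ≤ ((s i : ℕ) : ℝ) + 1 := by positivity
      simp only [Real.norm_eq_abs, abs_of_nonneg h2]
      linarith
    refine (Finset.sum_le_sum this).trans ?_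
    simp
  refine (pow_le_pow_iff_left₀ (norm_nonneg _) (by positivity) two_ne_zero).1 ?_
  refine hg.trans ?_
  have ha2 : 1 ≤ 4 * d * a ^ 2 := by
    have h1 := pow_le_pow_left₀ (by positivity) hs 2
    have h2 := mul_le_mul_of_nonneg_left h1 hd'.le
    linarith [(by ring : (d : ℝ) * (|e i₁| / 2) ^ 2 = d * |e i₁| ^ 2 / 4)]
  calc (d : ℝ) * (3 / δ) ^ 2 = (9 * d / δ ^ 2) * 1 := by ring
    _ ≤ (9 * d / δ ^ 2) * (4 * d * a ^ 2) := by gcongr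
    _ = (a * (6 * (d / δ))) ^ 2 := by ring

/-- The Lanczos method is an eigenvector routine with constant `40`. -/
theorem lanczos_meets {d : ℕ} (hd : 0 < d) {tm : OpTimes} {T : ℝ} (hT : 0 < T)
    (htm : tm.Within T) : (lanczos d tm).Meets 40 T := by
  intro H hH L ε δ hL hε hεL hδ hδ1
  have hd1 : (1 : ℝ) ≤ d := by exact_mod_cast hd
  have hlog : 0 ≤ Real.log (d / δ) :=
    Real.log_nonneg ((one_le_div hδ).2 (by linarith))
  set n : ℕ := ⌈8 * √(L / ε) * Real.log (d / δ)⌉₊ with hn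
  set N : ℕ := ⌈1 / δ⌉₊ + 1 with hN
  have hg0 : ∀ s : Fin d → Fin N, (WithLp.toLp 2 fun i => ((s i : ℕ) : ℝ) + 1 : Vec d) ≠ 0 := by
    intro s h0
    have h1 := congrArg (fun v : Vec d => v ⟨0, hd⟩) h0
    simp only [PiLp.zero_apply] at h1
    have : (0 : ℝ) ≤ ((s ⟨0, hd⟩ : ℕ) : ℝ) := by positivity
    linarith
  constructor
  · intro p hp
    rw [lanczos, PMF.mem_support_map_iff] at hp
    obtain ⟨s, -, rfl⟩ := hp
    refine ⟨(ritzCoeffs_spec hH (hg0 s) n).1, ?_⟩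
    obtain ⟨-, h2, h3⟩ := htm
    have hk : ((n + 1 : ℕ) : ℝ) ≤ 8 * √(L / ε) * Real.log (d / δ) + 2 := by
      push_cast
      have := (Nat.ceil_lt_add_one (a := 8 * √(L / ε) * Real.log (d / δ)) (by positivity)).le
      linarith
    have hk0 : (0 : ℝ) ≤ ((n + 1 : ℕ) : ℝ) := Nat.cast_nonneg _
    calc ((n + 1 : ℕ) : ℝ) * tm.hess + (4 * ((n + 1 : ℕ) : ℝ) + 1) * tm.vec
        ≤ ((n + 1 : ℕ) : ℝ) * T + (4 * ((n + 1 : ℕ) : ℝ) + 1) * T := by gcongr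
      _ = (5 * ((n + 1 : ℕ) : ℝ) + 1) * T := by ring
      _ ≤ (5 * (8 * √(L / ε) * Real.log (d / δ) + 2) + 1) * T := by gcongr
      -- The left side is $(40x+11)T$ with $x=\sqrt{L/\epsilon}\,\log(d/\delta)$.
      _ ≤ 40 * T * (1 + Real.log (d / δ) * √(L / ε)) := by nlinarith
  · obtain ⟨e, lam, he, i₀, h0, hmin⟩ := exists_eigenbasis hd H hH
    obtain ⟨i₁, hi₁⟩ := le_sinh_of_grid hd (e.orthonormal.1 i₀)
    have hNδ : 1 / δ ≤ N := by
      have := Nat.le_ceil (1 / δ)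
      rw [hN]; push_cast; linarith
    have hNpos : (0 : ℝ) < N := lt_of_lt_of_le (by positivity) hNδ
    have hN3 : (N : ℝ) ≤ 3 / δ := by
      have h1 := (Nat.ceil_lt_add_one (a := 1 / δ) (by positivity)).le
      have h2 : 1 ≤ 1 / δ := (one_le_div hδ).2 hδ1.le
      have h3 : 3 / δ = 3 * (1 / δ) := by ring
      rw [hN, h3]; push_cast; linarith
    have h1N : 1 / (N : ℝ) ≤ δ := by
      rw [div_le_iff₀ hNpos]
      rwa [div_le_iff₀ hδ, mul_comm] at hNδ
    rw [lanczos, PMF.toOuterMeasure_map_apply]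
    refine (ENNReal.ofReal_le_ofReal (by linarith : 1 - δ ≤ 1 - 1 / (N : ℝ))).trans
      ((uniform_large_sum_ge (by exact_mod_cast hNpos) (fun i => e i₀ i) i₁).trans
        (MeasureTheory.measure_mono fun s hs => ?_))
    obtain ⟨hpos, hbig⟩ := hi₁ s hδ hN3 hs
    set g : Vec d := WithLp.toLp 2 fun i => ((s i : ℕ) : ℝ) + 1 with hg
    change inner ℝ (∑ i : Fin (n + 1), ritzCoeffs (n + 1) (moment H g) i • (H^[(i : ℕ)] g))
      (H (∑ i : Fin (n + 1), ritzCoeffs (n + 1) (moment H g) i • (H^[(i : ℕ)] g))) ≤ lamMin H + ε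
    -- In dimension one $d/\delta\ge2$ may fail, but $H$ is a scalar and every unit vector is
    -- optimal.
    rcases (Nat.succ_le_of_lt hd).eq_or_lt with hd1 | hd2
    · have hall : ∀ i, lam i = lamMin H := fun i => by
        rw [← h0]; congr 1; apply Fin.ext; omega
      rw [inner_apply_eq_sum hH he]
      simp only [hall]
      rw [← Finset.mul_sum, ← norm_sq_eq_sum_inner, (ritzCoeffs_spec hH (hg0 s) n).1]
      linarith
    · have hd2' : (2 : ℝ) ≤ d := by exact_mod_cast hd2
      have hD : 2 ≤ (d : ℝ) / δ := by rw [le_div_iff₀ hδ]; nlinarith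
      have h6 := six_mul_le_sinh hε hεL hD (Nat.le_ceil _ : _ ≤ (n : ℝ))
      obtain ⟨p, hp, hp0, hpa⟩ := exists_krylov_rayleigh_le hH he (fun i => h0 ▸ hmin i) hL hε hεL n g
        (abs_pos.1 hpos) (hbig.trans (mul_le_mul_of_nonneg_left h6 (abs_nonneg _)))
      rw [← h0]
      exact inner_ritz_le hH (hg0 s) hp hp0 hpa

/-! ### Growth of functions along segments -/

theorem sub_le_sub_of_deriv_le {φ ψ φ' ψ' : ℝ → ℝ} (hφ : ∀ t, HasDerivAt φ (φ' t) t)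
    (hψ : ∀ t, HasDerivAt ψ (ψ' t) t) (h : ∀ t, 0 ≤ t → t ≤ 1 → φ' t ≤ ψ' t) {t : ℝ}
    (ht0 : 0 ≤ t) (ht1 : t ≤ 1) : φ t - φ 0 ≤ ψ t - ψ 0 := by
  have hd : ∀ t, HasDerivAt (fun t => ψ t - φ t) (ψ' t - φ' t) t := fun t => (hψ t).sub (hφ t)
  have hm : MonotoneOn (fun t => ψ t - φ t) (Set.Icc 0 1) := by
    refine monotoneOn_of_deriv_nonneg (convex_Icc 0 1)
      (fun t _ => (hd t).continuousAt.continuousWithinAt)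
      (fun t _ => (hd t).differentiableAt.differentiableWithinAt) fun t ht => ?_
    rw [interior_Icc] at ht
    rw [(hd t).deriv]
    linarith [h t ht.1.le ht.2.le]
  have := hm ⟨le_rfl, zero_le_one⟩ ⟨ht0, ht1⟩ ht0
  simp only at this
  linarith

theorem hasDerivAt_comp_line {d : ℕ} {g : Vec d → ℝ} (hg : Differentiable ℝ g) (x h : Vec d)
    (t : ℝ) : HasDerivAt (fun t : ℝ => g (x + t • h)) (inner ℝ (gradient g (x + t • h)) h) t := by
  have h1 : HasDerivAt (fun t : ℝ => x + t • h) h t := by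
    simpa using ((hasDerivAt_id t).smul_const h).const_add x
  have h2 := (hg (x + t • h)).hasGradientAt.hasFDerivAt.comp_hasDerivAt t h1
  rwa [InnerProductSpace.toDual_apply_apply] at h2

/-- The gradient has monotonicity modulus `m`, which may be negative. -/
def GradMono {d : ℕ} (g : Vec d → ℝ) (m : ℝ) : Prop :=
  ∀ x y, m * ‖y - x‖ ^ 2 ≤ inner ℝ (gradient g y - gradient g x) (y - x)

theorem GradMono.le_add {d : ℕ} {g : Vec d → ℝ} {m : ℝ} (hm : GradMono g m)
    (hg : Differentiable ℝ g) (x y : Vec d) :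
    g x + inner ℝ (gradient g x) (y - x) + m / 2 * ‖y - x‖ ^ 2 ≤ g y := by
  set h := y - x with hh
  have hφ : ∀ t : ℝ, HasDerivAt (fun t : ℝ => t * inner ℝ (gradient g x) h + m / 2 * ‖h‖ ^ 2 * t ^ 2)
      (inner ℝ (gradient g x) h + m * ‖h‖ ^ 2 * t) t := by
    intro t
    have := ((hasDerivAt_id t).mul_const (inner ℝ (gradient g x) h)).add
      ((hasDerivAt_pow 2 t).const_mul (m / 2 * ‖h‖ ^ 2))
    refine this.congr_deriv ?_
    push_cast; ring
  have key := sub_le_sub_of_deriv_le hφ (hasDerivAt_comp_line hg x h) (t := 1) (fun t ht0 _ => ?_)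
    zero_le_one le_rfl
  · simp only [one_smul, zero_smul, add_zero] at key
    have hy : x + h = y := by rw [hh]; abel
    rw [hy] at key
    nlinarith
  · rcases ht0.eq_or_lt with h0 | h0
    · simp [← h0]
    · have h1 := hm x (x + t • h)
      rw [add_sub_cancel_left, norm_smul, inner_smul_right, inner_sub_left, mul_pow,
        Real.norm_eq_abs, sq_abs] at h1
      have h2 : t * (m * ‖h‖ ^ 2 * t) ≤
          t * (inner ℝ (gradient g (x + t • h)) h - inner ℝ (gradient g x) h) := by linarith
      linarith [le_of_mul_le_mul_left h2 h0]

theorem Smooth.le_add {d : ℕ} {g : Vec d → ℝ} {L : ℝ} (hg : Smooth g L) (x y : Vec d) :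
    g y ≤ g x + inner ℝ (gradient g x) (y - x) + L / 2 * ‖y - x‖ ^ 2 := by
  set h := y - x with hh
  have hφ : ∀ t : ℝ, HasDerivAt (fun t : ℝ => t * inner ℝ (gradient g x) h + L / 2 * ‖h‖ ^ 2 * t ^ 2)
      (inner ℝ (gradient g x) h + L * ‖h‖ ^ 2 * t) t := by
    intro t
    have := ((hasDerivAt_id t).mul_const (inner ℝ (gradient g x) h)).add
      ((hasDerivAt_pow 2 t).const_mul (L / 2 * ‖h‖ ^ 2))
    refine this.congr_deriv ?_
    push_cast; ring
  have key := sub_le_sub_of_deriv_le (hasDerivAt_comp_line hg.1 x h) hφ (t := 1) (fun t ht0 _ => ?_)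
    zero_le_one le_rfl
  · simp only [one_smul, zero_smul, add_zero] at key
    have hy : x + h = y := by rw [hh]; abel
    rw [hy] at key
    nlinarith
  · have h1 := hg.2 (x + t • h) x
    rw [add_sub_cancel_left, norm_smul, Real.norm_eq_abs, abs_of_nonneg ht0] at h1
    have h2 := real_inner_le_norm (gradient g (x + t • h) - gradient g x) h
    rw [inner_sub_left] at h2
    nlinarith [norm_nonneg h, mul_le_mul_of_nonneg_right h1 (norm_nonneg h)]

theorem Smooth.gradMono_neg {d : ℕ} {g : Vec d → ℝ} {L : ℝ} (hg : Smooth g L) :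
    GradMono g (-L) := by
  intro x y
  have h1 := hg.2 y x
  have h2 := abs_le.1 (abs_real_inner_le_norm (gradient g y - gradient g x) (y - x))
  nlinarith [h2.1, mul_le_mul_of_nonneg_right h1 (norm_nonneg (y - x))]

theorem Smooth.sub_smul_le {d : ℕ} {g : Vec d → ℝ} {L : ℝ} (hL : 0 < L) (hg : Smooth g L)
    (x : Vec d) : g (x - (1 / L) • gradient g x) ≤ g x - ‖gradient g x‖ ^ 2 / (2 * L) := by
  have h := hg.le_add x (x - (1 / L) • gradient g x)
  rw [sub_sub_cancel_left, inner_neg_right, inner_smul_right, real_inner_self_eq_norm_sq, norm_neg,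
    norm_smul, Real.norm_eq_abs, abs_of_pos (by positivity)] at h
  refine h.trans (le_of_eq ?_)
  field_simp; ring

/-- A gradient step of length $1/L$ gains $\|\nabla g\|^2/(2L)$ and cannot pass below a lower bound.
-/
theorem Smooth.norm_sq_le {d : ℕ} {g : Vec d → ℝ} {L : ℝ} (hL : 0 < L) (hg : Smooth g L)
    {m : ℝ} (hm : ∀ x, m ≤ g x) (x : Vec d) : ‖gradient g x‖ ^ 2 ≤ 2 * L * (g x - m) := by
  have h1 := (hm _).trans (hg.sub_smul_le hL x)
  have h2 : ‖gradient g x‖ ^ 2 / (2 * L) ≤ g x - m := by linarith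
  rwa [div_le_iff₀ (by positivity), mul_comm] at h2

/-- Minimizing the quadratic lower bound at $x$ over all displacements gives the Polyak–Łojasiewicz
inequality. -/
theorem GradMono.sub_le {d : ℕ} {g : Vec d → ℝ} {m : ℝ} (hm : GradMono g m) (hm0 : 0 < m)
    (hg : Differentiable ℝ g) (x y : Vec d) :
    g x - g y ≤ ‖gradient g x‖ ^ 2 / (2 * m) := by
  have h1 := hm.le_add hg x y
  have h2 := (abs_le.1 (abs_real_inner_le_norm (gradient g x) (y - x))).1
  rw [le_div_iff₀ (by positivity)]
  nlinarith [sq_nonneg (‖gradient g x‖ - m * ‖y - x‖)]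

/-- A function with strongly monotone gradient has a minimizer. -/
theorem GradMono.exists_min {d : ℕ} {g : Vec d → ℝ} {m : ℝ} (hm : GradMono g m) (hm0 : 0 < m)
    (hg : Differentiable ℝ g) : ∃ x, (∀ y, g x ≤ g y) ∧ gradient g x = 0 := by
  -- Outside this ball the quadratic term of the lower bound at $0$ beats the linear one, so a
  -- minimizer on the ball is global.
  set R := 2 * ‖gradient g 0‖ / m with hR
  have hR0 : 0 ≤ R := by positivity
  obtain ⟨x, -, hx⟩ := (isCompact_closedBall (0 : Vec d) R).exists_isMinOn
    ⟨0, Metric.mem_closedBall_self hR0⟩ hg.continuous.continuousOn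
  have hmin : ∀ y, g x ≤ g y := by
    intro y
    by_cases hy : ‖y‖ ≤ R
    · exact hx (mem_closedBall_zero_iff.2 hy)
    · have h0 : g x ≤ g 0 := hx (Metric.mem_closedBall_self hR0)
      have h1 := hm.le_add hg 0 y
      rw [sub_zero] at h1
      have h2 := (abs_le.1 (abs_real_inner_le_norm (gradient g 0) y)).1
      have h3 : 2 * ‖gradient g 0‖ ≤ m * ‖y‖ := by
        have := (not_le.1 hy).le
        rwa [hR, div_le_iff₀ hm0, mul_comm ‖y‖] at this
      nlinarith [mul_le_mul_of_nonneg_right h3 (norm_nonneg y)]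
  refine ⟨x, hmin, ?_⟩
  have h1 : IsLocalMin g x := Filter.Eventually.of_forall hmin
  rw [gradient, h1.fderiv_eq_zero, map_zero]

/-! ### Convergence of accelerated gradient descent -/

/-- One step of accelerated gradient descent contracts the Lyapunov function. -/
theorem agd_step_contracts {d : ℕ} {g : Vec d → ℝ} {L σ r : ℝ} (hσ : 0 < σ) (hr : 1 ≤ r)
    (hL : L = r ^ 2 * σ) (hg : Smooth g L) (hm : GradMono g σ) (xs y z : Vec d) :
    let y' := z - (1 / L) • gradient g z
    let z' := (1 + (r - 1) / (r + 1)) • y' - ((r - 1) / (r + 1)) • y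
    g y' - g xs + σ / 2 * ‖z' + r • (z' - y') - xs‖ ^ 2 ≤
      (1 - 1 / r) * (g y - g xs + σ / 2 * ‖z + r • (z - y) - xs‖ ^ 2) := by
  intro y' z'
  have hr0 : 0 < r := by linarith
  have hL0 : 0 < L := by rw [hL]; positivity
  set G := gradient g z with hG
  set b := z - xs with hb
  set p := z - y with hp
  -- For the auxiliary point $v=z+r(z-y)$ this says $v'=(1-\frac1r)v+\frac1rz-\frac rL\nabla g(z)$;
  -- the momentum coefficient $(r-1)/(r+1)$ is chosen to achieve it.
  have hvec : z' + r • (z' - y') - xs = (b + (r - 1) • p) - (r / L) • G := by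
    have h1 : z' = y' + ((r - 1) / (r + 1)) • (y' - y) := by simp only [z']; module
    have h2 : z' + r • (z' - y') = y' + (r - 1) • (y' - y) := by
      rw [h1, add_sub_cancel_left, add_assoc, smul_smul, ← add_smul]
      congr 2; field_simp; ring
    rw [h2]; simp only [y', hb, hp]
    rw [show r / L = (r - 1) * (1 / L) + 1 / L by ring]
    module
  have hvec2 : z + r • (z - y) - xs = b + r • p := by rw [hb, hp]; abel
  rw [hvec, hvec2]
  have h1 : g y' ≤ g z - ‖G‖ ^ 2 / (2 * L) := hg.sub_smul_le hL0 z
  have h2 := hm.le_add hg.1 z xs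
  have h3 := hm.le_add hg.1 z y
  have e2 : xs - z = -b := by rw [hb]; abel
  have e3 : y - z = -p := by rw [hp]; abel
  rw [e2, norm_neg, inner_neg_right, ← hG] at h2
  rw [e3, norm_neg, inner_neg_right, ← hG] at h3
  have n1 : ‖(b + (r - 1) • p) - (r / L) • G‖ ^ 2 = ‖b‖ ^ 2 + 2 * (r - 1) * inner ℝ b p +
      (r - 1) ^ 2 * ‖p‖ ^ 2 - 2 * (r / L) * (inner ℝ G b + (r - 1) * inner ℝ G p) +
      (r / L) ^ 2 * ‖G‖ ^ 2 := by
    rw [norm_sub_sq_real, norm_add_sq_real, norm_smul, norm_smul, inner_smul_right,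
      inner_smul_right, inner_add_left, inner_smul_left, mul_pow, mul_pow, Real.norm_eq_abs,
      Real.norm_eq_abs, sq_abs, sq_abs, real_inner_comm G b, real_inner_comm G p]
    simp only [conj_trivial]; ring
  have n2 : ‖b + r • p‖ ^ 2 = ‖b‖ ^ 2 + 2 * r * inner ℝ b p + r ^ 2 * ‖p‖ ^ 2 := by
    rw [norm_add_sq_real, norm_smul, inner_smul_right, mul_pow, Real.norm_eq_abs, sq_abs]
    ring
  rw [n1, n2]
  have c1 : σ / 2 * (r / L) ^ 2 = 1 / (2 * L) := by rw [hL]; field_simp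
  have c2 : σ / 2 * (2 * (r / L)) = 1 / r := by rw [hL]; field_simp
  have hθ0 : 0 < 1 / r := by positivity
  have hθ1 : 1 / r ≤ 1 := (div_le_one hr0).2 hr
  -- Strong convexity at $z$ is used towards `xs` with weight $1/r$ and towards $y$ with weight
  -- $1-1/r$. With these weights the inner products with $\nabla g(z)$ cancel those in
  -- $\|v'-x_s\|^2$, and the descent gain $\|\nabla g(z)\|^2/(2L)$ cancels its last term.
  have k2 := mul_le_mul_of_nonneg_left h2 hθ0.le
  have k3 := mul_le_mul_of_nonneg_left h3 (by linarith : 0 ≤ 1 - 1 / r)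
  have hexp : σ / 2 * (‖b‖ ^ 2 + 2 * (r - 1) * inner ℝ b p + (r - 1) ^ 2 * ‖p‖ ^ 2 -
      2 * (r / L) * (inner ℝ G b + (r - 1) * inner ℝ G p) + (r / L) ^ 2 * ‖G‖ ^ 2) =
      σ / 2 * (‖b‖ ^ 2 + 2 * (r - 1) * inner ℝ b p + (r - 1) ^ 2 * ‖p‖ ^ 2) -
      1 / r * (inner ℝ G b) - (1 - 1 / r) * inner ℝ G p + ‖G‖ ^ 2 / (2 * L) := by
    have c3 : 1 / r * (r - 1) = 1 - 1 / r := by field_simp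
    rw [← c3, ← c2]
    linear_combination ‖G‖ ^ 2 * c1
  rw [hexp]
  have hrhs : (1 - 1 / r) * (σ / 2 * (‖b‖ ^ 2 + 2 * r * inner ℝ b p + r ^ 2 * ‖p‖ ^ 2)) =
      σ / 2 * ((1 - 1 / r) * ‖b‖ ^ 2 + 2 * (r - 1) * inner ℝ b p + (r - 1) * r * ‖p‖ ^ 2) := by
    field_simp
  rw [mul_add (1 - 1 / r) (g y - g xs), hrhs]
  have hpp : 0 ≤ σ / 2 * ((r - 1) * ‖p‖ ^ 2) :=
    mul_nonneg (by positivity) (mul_nonneg (by linarith) (sq_nonneg _))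
  have hpp' : 0 ≤ (1 - 1 / r) * (σ / 2 * ‖p‖ ^ 2) :=
    mul_nonneg (by linarith) (by positivity)
  linarith

/-- Each pass multiplies the Lyapunov function by at most $1-1/\sqrt\kappa$. It dominates the value
gap, so once $2L$ times it is at most $\epsilon^2$, smoothness forces the gradient test to succeed.
The strict $k<n$ leaves a pass for that test; $9T$ pays for it and $22T$ for each update. -/
theorem agdLoop_spec {d : ℕ} {tm : OpTimes} {T w : ℝ} (hT : 0 ≤ T) (hv : tm.vec ≤ T)
    (hw : w ≤ 8 * T) {g : Vec d → ℝ} {L σ ε : ℝ} (hσ : 0 < σ) (hσL : σ ≤ L) (hε : 0 ≤ ε)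
    (hg : Smooth g L) (hm : GradMono g σ) {xs : Vec d} (hxs : ∀ x, g xs ≤ g x) (k n : ℕ)
    (hkn : k < n) (y z : Vec d)
    (hV : 2 * L * ((1 - 1 / √(L / σ)) ^ k *
      (g y - g xs + σ / 2 * ‖z + √(L / σ) • (z - y) - xs‖ ^ 2)) ≤ ε ^ 2) :
    ∃ x c, agdLoop tm w g ε L σ n y z = some (x, c) ∧ ‖gradient g x‖ ≤ ε ∧
      c ≤ 9 * T + 22 * T * k := by
  have hL : 0 < L := hσ.trans_le hσL
  have hr : 1 ≤ √(L / σ) := Real.one_le_sqrt.2 ((one_le_div hσ).2 hσL)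
  have hLr : L = √(L / σ) ^ 2 * σ := by
    rw [Real.sq_sqrt (by positivity)]; field_simp
  induction k generalizing n y z with
  | zero =>
    obtain ⟨n, rfl⟩ : ∃ m, n = m + 1 := ⟨n - 1, by omega⟩
    have h1 := hg.norm_sq_le hL hxs y
    have hy : ‖gradient g y‖ ≤ ε := by
      refine (pow_le_pow_iff_left₀ (norm_nonneg _) hε two_ne_zero).1 (h1.trans (le_trans ?_ hV))
      rw [pow_zero, one_mul]
      refine mul_le_mul_of_nonneg_left ?_ (by positivity)
      have : 0 ≤ σ / 2 * ‖z + √(L / σ) • (z - y) - xs‖ ^ 2 := by positivity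
      linarith
    refine ⟨y, w + tm.vec, by simp [agdLoop, hy], hy, ?_⟩
    push_cast; linarith
  | succ k ih =>
    obtain ⟨n, rfl⟩ : ∃ m, n = m + 1 := ⟨n - 1, by omega⟩
    by_cases hy : ‖gradient g y‖ ≤ ε
    · refine ⟨y, w + tm.vec, by simp [agdLoop, hy], hy, ?_⟩
      have : 0 ≤ 22 * T * ((k + 1 : ℕ) : ℝ) := by positivity
      linarith
    · have hstep := agd_step_contracts hσ hr hLr hg hm xs y z
      simp only at hstep
      obtain ⟨x, c, h1, h2, h3⟩ := ih n (by omega) _ _ (le_trans (mul_le_mul_of_nonneg_left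
        (mul_le_mul_of_nonneg_left hstep (pow_nonneg (sub_nonneg.2
          ((div_le_one (by linarith)).2 hr)) k)) (by positivity)) (by
            rw [← mul_assoc ((1 - 1 / √(L / σ)) ^ k), ← pow_succ]; exact hV))
      refine ⟨x, 2 * w + 6 * tm.vec + c, ?_, h2, ?_⟩
      · rw [agdLoop, if_neg hy]
        simp only [h1, Outcome.addTime, Option.map_some]
      · push_cast; linarith

/-- Accelerated gradient descent finds an `ε`-stationary point of a strongly convex function in
`√κ log (4 L (g y - min g) / ε²)` passes. -/
theorem agd_spec {d : ℕ} {tm : OpTimes} {T w : ℝ} (hT : 0 ≤ T) (hv : tm.vec ≤ T)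
    (hw : w ≤ 8 * T) {g : Vec d → ℝ} {L σ ε : ℝ} (hσ : 0 < σ) (hσL : σ ≤ L) (hε : 0 ≤ ε)
    (hg : Smooth g L) (hm : GradMono g σ) {xs : Vec d} (hxs : ∀ x, g xs ≤ g x)
    (hxs0 : gradient g xs = 0) (k n : ℕ) (hkn : k < n) (y : Vec d)
    (hk : 4 * L * (g y - g xs) ≤ ε ^ 2 * Real.exp (k / √(L / σ))) :
    ∃ x c, agd tm w n g y ε L σ = some (x, c) ∧ ‖gradient g x‖ ≤ ε ∧ c ≤ 9 * T + 22 * T * k := by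
  refine agdLoop_spec hT hv hw hσ hσL hε hg hm hxs k n hkn y y ?_
  have hL : 0 < L := hσ.trans_le hσL
  have hr : 1 ≤ √(L / σ) := Real.one_le_sqrt.2 ((one_le_div hσ).2 hσL)
  have h1 := hm.le_add hg.1 xs y
  rw [hxs0, inner_zero_left, add_zero] at h1
  rw [sub_self, smul_zero, add_zero]
  have hq : (1 - 1 / √(L / σ)) ^ k ≤ Real.exp (-(k / √(L / σ))) := by
    have h2 : 1 - 1 / √(L / σ) ≤ Real.exp (-(1 / √(L / σ))) := by
      have := Real.add_one_le_exp (-(1 / √(L / σ))); linarith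
    calc _ ≤ Real.exp (-(1 / √(L / σ))) ^ k :=
          pow_le_pow_left₀ (sub_nonneg.2 ((div_le_one (by linarith)).2 hr)) h2 k
      _ = _ := by rw [← Real.exp_nat_mul]; congr 1; ring
  have hV : g y - g xs + σ / 2 * ‖y - xs‖ ^ 2 ≤ 2 * (g y - g xs) := by linarith
  have hV0 : 0 ≤ 2 * (g y - g xs) := by linarith [hxs y]
  calc 2 * L * ((1 - 1 / √(L / σ)) ^ k * (g y - g xs + σ / 2 * ‖y - xs‖ ^ 2))
      ≤ 2 * L * (Real.exp (-(k / √(L / σ))) * (2 * (g y - g xs))) := by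
        refine mul_le_mul_of_nonneg_left ?_ (by positivity)
        exact (mul_le_mul_of_nonneg_left hV (pow_nonneg (sub_nonneg.2
          ((div_le_one (by linarith)).2 hr)) k)).trans (mul_le_mul_of_nonneg_right hq hV0)
    _ = Real.exp (-(k / √(L / σ))) * (4 * L * (g y - g xs)) := by ring
    _ ≤ Real.exp (-(k / √(L / σ))) * (ε ^ 2 * Real.exp (k / √(L / σ))) := by gcongr
    _ = ε ^ 2 := by
      rw [mul_left_comm, ← Real.exp_add, neg_add_cancel, Real.exp_zero, mul_one]

/-! ### The proximal model -/

theorem hasGradientAt_norm_sub_sq {d : ℕ} (z₀ z : Vec d) :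
    HasGradientAt (fun z => ‖z - z₀‖ ^ 2) ((2 : ℝ) • (z - z₀)) z := by
  rw [hasGradientAt_iff_hasFDerivAt]
  have h := ((hasFDerivAt_id (𝕜 := ℝ) z).sub_const z₀).norm_sq
  refine h.congr_fderiv ?_
  ext v
  simp [InnerProductSpace.toDual_apply_apply]

theorem hasGradientAt_proxModel {d : ℕ} {f : Vec d → ℝ} (hf : Differentiable ℝ f) (γ : ℝ)
    (z₀ z : Vec d) :
    HasGradientAt (proxModel f γ z₀) (gradient f z + (2 * γ) • (z - z₀)) z := by
  have h1 := (hf z).hasGradientAt.hasFDerivAt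
  have h2 := (hasGradientAt_norm_sub_sq z₀ z).hasFDerivAt.const_mul γ
  rw [hasGradientAt_iff_hasFDerivAt]
  refine (h1.add h2).congr_fderiv ?_
  ext v
  simp [InnerProductSpace.toDual_apply_apply]
  ring

theorem Smooth.proxModel {d : ℕ} {f : Vec d → ℝ} {L γ : ℝ} (hf : Smooth f L) (hγ : 0 ≤ γ)
    (z₀ : Vec d) : Smooth (proxModel f γ z₀) (L + 2 * γ) := by
  refine ⟨fun z => (hasGradientAt_proxModel hf.1 γ z₀ z).differentiableAt, fun x y => ?_⟩
  rw [(hasGradientAt_proxModel hf.1 γ z₀ x).gradient, (hasGradientAt_proxModel hf.1 γ z₀ y).gradient]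
  have e : gradient f x + (2 * γ) • (x - z₀) - (gradient f y + (2 * γ) • (y - z₀)) =
      (gradient f x - gradient f y) + (2 * γ) • (x - y) := by module
  rw [e]
  refine (norm_add_le _ _).trans ?_
  rw [norm_smul, Real.norm_eq_abs, abs_of_nonneg (by positivity)]
  linarith [hf.2 x y]

theorem GradMono.proxModel {d : ℕ} {f : Vec d → ℝ} {γ m : ℝ} (hf : Differentiable ℝ f)
    (hm : GradMono f m) (z₀ : Vec d) : GradMono (proxModel f γ z₀) (m + 2 * γ) := by
  intro x y
  rw [(hasGradientAt_proxModel hf γ z₀ x).gradient, (hasGradientAt_proxModel hf γ z₀ y).gradient]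
  have e : gradient f y + (2 * γ) • (y - z₀) - (gradient f x + (2 * γ) • (x - z₀)) =
      (gradient f y - gradient f x) + (2 * γ) • (y - x) := by module
  rw [e, inner_add_left, inner_smul_left, real_inner_self_eq_norm_sq, conj_trivial]
  linarith [hm x y]

/-! ### Convergence of the method for almost convex functions -/

/-- One proximal step decreases the function, and by a fixed amount if it does not reach an
approximately stationary point. -/
theorem prox_step_spec {d : ℕ} {tm : OpTimes} {T w : ℝ} (hT : 0 ≤ T) (hv : tm.vec ≤ T)
    (hw : w ≤ 5 * T) {f : Vec d → ℝ} {L γ ε m D : ℝ} (hγ : 0 < γ) (hγL : γ ≤ L) (hε : 0 < ε)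
    (hf : Smooth f L) (hm : GradMono f (-γ)) (hlow : ∀ x, m ≤ f x) (k N : ℕ) (hkN : k < N)
    (hk : 4 * (L + 2 * γ) * D ≤ (ε * √(γ / (50 * (L + 2 * γ)))) ^ 2 *
      Real.exp (k / √((L + 2 * γ) / γ)))
    (z : Vec d) (hz : ε < ‖gradient f z‖) (hzD : f z - m ≤ D) :
    ∃ z' c, agd tm (w + 3 * tm.vec) N (proxModel f γ z) z (ε * √(γ / (50 * (L + 2 * γ))))
        (L + 2 * γ) γ = some (z', c) ∧ c ≤ 9 * T + 22 * T * k ∧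
      γ * ‖z' - z‖ ^ 2 ≤ f z - f z' ∧
      (‖gradient f z'‖ ≤ ε ∨ 9 / 20 * ε ≤ γ * ‖z' - z‖) := by
  have hL : 0 < L := hγ.trans_le hγL
  have hg := hf.proxModel hγ.le z
  have hgm : GradMono (proxModel f γ z) γ := by
    have := GradMono.proxModel (γ := γ) hf.1 hm z
    rwa [show -γ + 2 * γ = γ by ring] at this
  obtain ⟨xs, hxs, hxs0⟩ := hgm.exists_min hγ hg.1
  have hgz : proxModel f γ z z = f z := by simp [proxModel]
  have hgrad : ∀ y, gradient (proxModel f γ z) y = gradient f y + (2 * γ) • (y - z) :=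
    fun y => (hasGradientAt_proxModel hf.1 γ z y).gradient
  have hgxs : m ≤ proxModel f γ z xs := (hlow xs).trans (by
    rw [proxModel]; have : 0 ≤ γ * ‖xs - z‖ ^ 2 := by positivity
    linarith)
  set ε' := ε * √(γ / (50 * (L + 2 * γ))) with hε'
  have hε'2 : ε' ^ 2 = ε ^ 2 * (γ / (50 * (L + 2 * γ))) := by
    rw [hε', mul_pow, Real.sq_sqrt (by positivity)]
  have hε'0 : 0 ≤ ε' := by positivity
  have hε'le : ε' ≤ ε / 10 := by
    refine (pow_le_pow_iff_left₀ hε'0 (by positivity) two_ne_zero).1 ?_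
    rw [hε'2, div_pow, div_eq_mul_inv (ε ^ 2)]
    refine mul_le_mul_of_nonneg_left ?_ (by positivity)
    rw [div_le_iff₀ (by positivity)]
    norm_num
    linarith
  obtain ⟨z', c, h1, h2, h3⟩ := agd_spec (w := w + 3 * tm.vec) hT hv (by linarith) hγ
    (by linarith : γ ≤ L + 2 * γ) hε'0 hg hgm hxs hxs0 k N hkN z (le_trans (by
      refine mul_le_mul_of_nonneg_left ?_ (by positivity)
      rw [hgz]; linarith) hk)
  refine ⟨z', c, h1, h3, ?_, ?_⟩
  -- The tolerance leaves a model gap of at most $\epsilon^2/(100(L+2\gamma))$ at $z'$, whereas the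
  -- gap at $z$ is at least $\epsilon^2/(2(L+2\gamma))$. So the model does not increase, and its
  -- quadratic term becomes a decrease of $f$.
  · have h4 := hgm.sub_le hγ hg.1 z' xs
    have h5 := hg.norm_sq_le (by positivity) hxs z
    rw [hgz, hgrad, sub_self, smul_zero, add_zero] at h5
    have h6 : ‖gradient (proxModel f γ z) z'‖ ^ 2 / (2 * γ) ≤ ε ^ 2 / (100 * (L + 2 * γ)) := by
      calc _ ≤ ε' ^ 2 / (2 * γ) := by gcongr
        _ = _ := by rw [hε'2]; field_simp; norm_num
    have h7 : ε ^ 2 / (2 * (L + 2 * γ)) ≤ f z - proxModel f γ z xs := by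
      rw [div_le_iff₀ (by positivity), mul_comm]
      exact (pow_le_pow_left₀ hε.le hz.le 2).trans h5
    have h8 : ε ^ 2 / (100 * (L + 2 * γ)) ≤ ε ^ 2 / (2 * (L + 2 * γ)) := by
      gcongr; norm_num
    have h9 : proxModel f γ z z' = f z' + γ * ‖z' - z‖ ^ 2 := rfl
    linarith
  -- Since $\nabla f(z')$ is the model gradient, of norm at most $\epsilon/10$, minus
  -- $2\gamma(z'-z)$, a non-stationary $z'$ forces $2\gamma\|z'-z\|\ge\frac9{10}\epsilon$.
  · rw [or_iff_not_imp_left, not_le]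
    intro h4
    have h5 : gradient f z' = gradient (proxModel f γ z) z' - (2 * γ) • (z' - z) := by
      rw [hgrad]; abel
    have h6 := norm_sub_le (gradient (proxModel f γ z) z') ((2 * γ) • (z' - z))
    rw [← h5, norm_smul, Real.norm_eq_abs, abs_of_pos (by positivity)] at h6
    linarith

/-- Every proximal step but the last moves at least $9\epsilon/(20\gamma)$, hence lowers $f$ by at
least $\epsilon^2/(5\gamma)$; this bounds the passes, with $1$ added for the last step. The final
alternatives relate distance to decrease: quadratically for a single step, linearly for several.
They later show that leaving a neighbourhood of the start is expensive. -/
theorem acagdLoop_spec {d : ℕ} {tm : OpTimes} {T w : ℝ} (hT : 0 ≤ T) (hv : tm.vec ≤ T)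
    (hw : w ≤ 5 * T) {f : Vec d → ℝ} {L γ ε m D : ℝ} (hγ : 0 < γ) (hγL : γ ≤ L) (hε : 0 < ε)
    (hf : Smooth f L) (hm : GradMono f (-γ)) (hlow : ∀ x, m ≤ f x) (k N : ℕ) (hkN : k < N)
    (hk : 4 * (L + 2 * γ) * D ≤ (ε * √(γ / (50 * (L + 2 * γ)))) ^ 2 *
      Real.exp (k / √((L + 2 * γ) / γ))) (n : ℕ)
    (z : Vec d) (hzD : f z - m ≤ D) (hn : 1 + 5 * γ / ε ^ 2 * (f z - m) < n) :
    ∃ x c, acagdLoop tm w N f ε γ L n z = some (x, c) ∧ ‖gradient f x‖ ≤ ε ∧ f x ≤ f z ∧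
      c ≤ 6 * T + (15 * T + 22 * T * k) * (1 + 5 * γ / ε ^ 2 * (f z - f x)) ∧
      ((‖gradient f z‖ ≤ ε ∧ x = z) ∨ γ * ‖x - z‖ ^ 2 ≤ f z - f x ∨
        ε / 3 * ‖x - z‖ ≤ f z - f x) := by
  induction n generalizing z with
  | zero =>
    have : 0 ≤ 5 * γ / ε ^ 2 * (f z - m) := mul_nonneg (by positivity) (sub_nonneg.2 (hlow z))
    push_cast at hn; linarith
  | succ n ih =>
    by_cases hz : ‖gradient f z‖ ≤ ε
    · refine ⟨z, w + tm.vec, by simp [acagdLoop, hz], hz, le_rfl, ?_, Or.inl ⟨hz, rfl⟩⟩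
      have : 0 ≤ T * k := by positivity
      rw [sub_self, mul_zero, add_zero, mul_one]; linarith
    · obtain ⟨z', c, h1, h2, h3, h4⟩ := prox_step_spec hT hv hw hγ hγL hε hf hm hlow k N hkN hk z
        (not_le.1 hz) hzD
      have hle : f z' ≤ f z := by
        have : 0 ≤ γ * ‖z' - z‖ ^ 2 := by positivity
        linarith
      have hrun : acagdLoop tm w N f ε γ L (n + 1) z =
          Outcome.addTime (w + tm.vec + c) (acagdLoop tm w N f ε γ L n z') := by
        rw [acagdLoop, if_neg hz]
        simp only [h1]
      by_cases hz' : ‖gradient f z'‖ ≤ ε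
      · have hn1 : 0 < n := by
          have h5 : 0 ≤ 5 * γ / ε ^ 2 * (f z - m) :=
            mul_nonneg (by positivity) (sub_nonneg.2 (hlow z))
          have h6 : (0 : ℝ) < n := by push_cast at hn; linarith
          exact_mod_cast h6
        obtain ⟨n, rfl⟩ : ∃ j, n = j + 1 := ⟨n - 1, by omega⟩
        have hres : acagdLoop tm w N f ε γ L (n + 1) z' = some (z', w + tm.vec) := by
          simp [acagdLoop, hz']
        refine ⟨z', w + tm.vec + c + (w + tm.vec), ?_, hz', hle, ?_, Or.inr (Or.inl h3)⟩
        · rw [hrun, hres]; rfl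
        · have h5 : 0 ≤ (15 * T + 22 * T * k) * (5 * γ / ε ^ 2 * (f z - f z')) :=
            mul_nonneg (by positivity) (mul_nonneg (by positivity) (by linarith))
          rw [mul_add, mul_one]; linarith
      · have h5 := h4.resolve_left hz'
        have hdrop : 1 ≤ 5 * γ / ε ^ 2 * (f z - f z') := by
          have h6 : (9 / 20 * ε) ^ 2 ≤ (γ * ‖z' - z‖) ^ 2 := pow_le_pow_left₀ (by positivity) h5 2
          rw [div_mul_eq_mul_div, one_le_div (by positivity)]
          have h7 := mul_le_mul_of_nonneg_left h3 hγ.le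
          nlinarith
        obtain ⟨x, c', g1, g2, g3, g4, g5⟩ := ih z' (by linarith) (by
          have : 5 * γ / ε ^ 2 * (f z - m) = 5 * γ / ε ^ 2 * (f z - f z') +
            5 * γ / ε ^ 2 * (f z' - m) := by ring
          push_cast at hn; linarith)
        refine ⟨x, w + tm.vec + c + c', ?_, g2, g3.trans hle, ?_, Or.inr (Or.inr ?_)⟩
        · rw [hrun, g1]; rfl
        · have h6 : 5 * γ / ε ^ 2 * (f z - f x) = 5 * γ / ε ^ 2 * (f z - f z') +
            5 * γ / ε ^ 2 * (f z' - f x) := by ring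
          rw [h6]
          have h7 : 0 ≤ 15 * T + 22 * T * k := by positivity
          nlinarith [mul_le_mul_of_nonneg_left hdrop h7]
        · have htri : ‖x - z‖ ≤ ‖z' - z‖ + ‖x - z'‖ := by
            have := norm_add_le (z' - z) (x - z')
            rwa [show z' - z + (x - z') = x - z by abel] at this
          have hfirst : 9 / 20 * ε * ‖z' - z‖ ≤ γ * ‖z' - z‖ ^ 2 := by
            have := mul_le_mul_of_nonneg_right h5 (norm_nonneg (z' - z))
            linarith
          refine (mul_le_mul_of_nonneg_left htri (by positivity)).trans ?_
          rcases g5 with ⟨g5, -⟩ | g5 | g5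
          · exact absurd g5 hz'
          -- The last step may be short, and then its quadratic decrease falls short of the linear
          -- bound by at most $\epsilon^2/(36\gamma)$. The first step, with
          -- $\gamma\|z'-z\|\ge\frac9{20}\epsilon$, has a larger surplus.
          · have key : ε / 3 * (‖z' - z‖ + ‖x - z'‖) ≤
                γ * ‖z' - z‖ ^ 2 + γ * ‖x - z'‖ ^ 2 := by
              refine le_of_mul_le_mul_left ?_ hγ
              have := norm_nonneg (x - z')
              nlinarith [sq_nonneg (γ * ‖x - z'‖ - ε / 6),
                mul_nonneg (sub_nonneg.2 h5) hε.le, sq_nonneg (γ * ‖z' - z‖ - 9 / 20 * ε)]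
            linarith
          · have : 0 ≤ ε * ‖z' - z‖ := by positivity
            linarith

/-! ### Radial projection -/

/-- The projection to the closed ball of radius `r` around the origin. -/
noncomputable def radialProj {d : ℕ} (r : ℝ) (x : Vec d) : Vec d :=
  if ‖x‖ ≤ r then x else (r / ‖x‖) • x

theorem radialProj_of_le {d : ℕ} {r : ℝ} {x : Vec d} (h : ‖x‖ ≤ r) : radialProj r x = x :=
  if_pos h

theorem radialProj_of_ge {d : ℕ} {r : ℝ} (hr : 0 < r) {x : Vec d} (h : r ≤ ‖x‖) :
    radialProj r x = (r / ‖x‖) • x := by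
  rcases h.eq_or_lt with h | h
  · rw [radialProj_of_le h.ge, ← h, div_self hr.ne', one_smul]
  · exact if_neg (not_le.2 h)

theorem norm_radialProj_sub_le {d : ℕ} {r : ℝ} (hr : 0 < r) (x y : Vec d) :
    ‖radialProj r x - radialProj r y‖ ≤ ‖x - y‖ := by
  have mixed : ∀ x y : Vec d, r ≤ ‖x‖ → ‖y‖ ≤ r → ‖(r / ‖x‖) • x - y‖ ≤ ‖x - y‖ := by
    intro x y hx hy
    have hx0 : 0 < ‖x‖ := hr.trans_le hx
    refine (pow_le_pow_iff_left₀ (norm_nonneg _) (norm_nonneg _) two_ne_zero).1 ?_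
    rw [norm_sub_sq_real, norm_sub_sq_real, norm_smul, inner_smul_left, Real.norm_eq_abs,
      abs_of_pos (by positivity), conj_trivial, div_mul_cancel₀ _ hx0.ne']
    have hc := real_inner_le_norm x y
    have hq : inner ℝ x y ≤ ‖x‖ * r := hc.trans (by gcongr)
    have e : r / ‖x‖ * inner ℝ x y = inner ℝ x y - (‖x‖ - r) * (inner ℝ x y / ‖x‖) := by
      field_simp; ring
    have hq' : inner ℝ x y / ‖x‖ ≤ r := by rwa [div_le_iff₀ hx0, mul_comm]
    rw [e]
    nlinarith [mul_le_mul_of_nonneg_left hq' (sub_nonneg.2 hx)]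
  rcases le_total ‖x‖ r with hx | hx <;> rcases le_total ‖y‖ r with hy | hy
  · rw [radialProj_of_le hx, radialProj_of_le hy]
  · rw [radialProj_of_le hx, radialProj_of_ge hr hy, norm_sub_rev, norm_sub_rev x]
    exact mixed y x hy hx
  · rw [radialProj_of_le hy, radialProj_of_ge hr hx]
    exact mixed x y hx hy
  · rw [radialProj_of_ge hr hx, radialProj_of_ge hr hy]
    have hx0 : 0 < ‖x‖ := hr.trans_le hx
    have hy0 : 0 < ‖y‖ := hr.trans_le hy
    refine (pow_le_pow_iff_left₀ (norm_nonneg _) (norm_nonneg _) two_ne_zero).1 ?_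
    rw [norm_sub_sq_real, norm_sub_sq_real, norm_smul, norm_smul, inner_smul_left,
      inner_smul_right, Real.norm_eq_abs, Real.norm_eq_abs, abs_of_pos (by positivity),
      abs_of_pos (by positivity), conj_trivial, div_mul_cancel₀ _ hx0.ne', div_mul_cancel₀ _ hy0.ne']
    set q := inner ℝ x y / (‖x‖ * ‖y‖) with hq
    have hq1 : q ≤ 1 := (div_le_one (by positivity)).2 (real_inner_le_norm x y)
    have e1 : inner ℝ x y = ‖x‖ * ‖y‖ * q := by rw [hq]; field_simp
    have e2 : r / ‖x‖ * (r / ‖y‖ * inner ℝ x y) = r ^ 2 * q := by rw [e1]; field_simp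
    rw [e2, e1]
    have hxy : r ^ 2 ≤ ‖x‖ * ‖y‖ := by rw [sq]; gcongr
    nlinarith [mul_nonneg (sub_nonneg.2 hxy) (sub_nonneg.2 hq1), sq_nonneg (‖x‖ - ‖y‖)]

/-- The identity minus a nonexpansive map is monotone, by Cauchy–Schwarz; thus the penalty never
harms convexity. -/
theorem inner_sub_radialProj_nonneg {d : ℕ} {r : ℝ} (hr : 0 < r) (x y : Vec d) :
    0 ≤ inner ℝ ((y - radialProj r y) - (x - radialProj r x)) (y - x) := by
  have h1 := norm_radialProj_sub_le hr y x
  have h2 := real_inner_le_norm (radialProj r y - radialProj r x) (y - x)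
  have e : (y - radialProj r y) - (x - radialProj r x) =
      (y - x) - (radialProj r y - radialProj r x) := by abel
  rw [e, inner_sub_left, real_inner_self_eq_norm_sq]
  nlinarith [mul_le_mul_of_nonneg_right h1 (norm_nonneg (y - x))]

/-- Outside radius $2r$ the projection to radius $r$ is half the projection to radius $2r$, which is
nonexpansive, so half of the identity survives. -/
theorem half_le_inner_sub_radialProj {d : ℕ} {r : ℝ} (hr : 0 < r) {x y : Vec d}
    (hx : 2 * r ≤ ‖x‖) (hy : 2 * r ≤ ‖y‖) :
    1 / 2 * ‖y - x‖ ^ 2 ≤ inner ℝ ((y - radialProj r y) - (x - radialProj r x)) (y - x) := by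
  have half : ∀ x : Vec d, 2 * r ≤ ‖x‖ → radialProj r x = (1 / 2 : ℝ) • radialProj (2 * r) x := by
    intro x hx
    rw [radialProj_of_ge hr (by linarith), radialProj_of_ge (by linarith) hx, smul_smul]
    congr 1; ring
  have h1 := norm_radialProj_sub_le (by linarith : 0 < 2 * r) y x
  have h2 := real_inner_le_norm (radialProj (2 * r) y - radialProj (2 * r) x) (y - x)
  have e : (y - radialProj r y) - (x - radialProj r x) =
      (y - x) - (1 / 2 : ℝ) • (radialProj (2 * r) y - radialProj (2 * r) x) := by
    rw [half x hx, half y hy]; module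
  rw [e, inner_sub_left, real_inner_self_eq_norm_sq, inner_smul_left, conj_trivial]
  nlinarith [mul_le_mul_of_nonneg_right h1 (norm_nonneg (y - x))]

/-! ### The penalized function -/

theorem hasDerivAt_max_sq (s : ℝ) : HasDerivAt (fun s : ℝ => (max s 0) ^ 2) (2 * max s 0) s := by
  rcases lt_trichotomy s 0 with h | h | h
  · rw [max_eq_right h.le, mul_zero]
    refine (hasDerivAt_const s (0 : ℝ)).congr_of_eventuallyEq ?_
    filter_upwards [eventually_lt_nhds h] with t ht
    simp [max_eq_right ht.le]
  · subst h
    rw [max_self, mul_zero, hasDerivAt_iff_isLittleO_nhds_zero]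
    have hO : (fun h : ℝ => (max (0 + h) 0) ^ 2 - (max (0 : ℝ) 0) ^ 2 - h • (0 : ℝ)) =O[nhds 0]
        fun h : ℝ => h ^ 2 := by
      refine Asymptotics.isBigO_of_le _ fun h => ?_
      simp only [zero_add, max_self, smul_zero, sub_zero, norm_pow, Real.norm_eq_abs, ne_eq,
        OfNat.ofNat_ne_zero, not_false_eq_true, zero_pow]
      refine pow_le_pow_left₀ (abs_nonneg _) ?_ 2
      rw [abs_of_nonneg (le_max_right _ _)]
      exact max_le (le_abs_self h) (abs_nonneg h)
    refine hO.trans_isLittleO ?_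
    simpa using Asymptotics.isLittleO_pow_id (𝕜 := ℝ) (n := 2) (by norm_num)
  · rw [max_eq_left h.le]
    refine ((hasDerivAt_pow 2 s).congr_of_eventuallyEq ?_).congr_deriv (by simp)
    filter_upwards [eventually_gt_nhds h] with t ht
    simp [max_eq_left ht.le]

/-- The radial formula $(\|x\|-r)_+\,x/\|x\|$ equals $x-P_r(x)$, with $P_r$ the projection to the
ball. In this form smoothness and monotonicity of the penalty follow from nonexpansiveness, without
second derivatives. -/
theorem hasGradientAt_penalized {d : ℕ} {f : Vec d → ℝ} (hf : Differentiable ℝ f)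
    {L₁ L₂ α : ℝ} (hr : 0 < α / L₂) (x₀ x : Vec d) :
    HasGradientAt (penalized f L₁ L₂ α x₀)
      (gradient f x + (2 * L₁) • ((x - x₀) - radialProj (α / L₂) (x - x₀))) x := by
  set r := α / L₂ with hrdef
  have h1 := (hf x).hasGradientAt.hasFDerivAt
  suffices h2 : HasFDerivAt (fun x => L₁ * (max (‖x - x₀‖ - r) 0) ^ 2)
      (InnerProductSpace.toDual ℝ (Vec d)
        ((2 * L₁) • ((x - x₀) - radialProj r (x - x₀)))) x by
    rw [hasGradientAt_iff_hasFDerivAt, map_add]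
    exact h1.add h2
  rcases lt_or_ge ‖x - x₀‖ r with h | h
  · rw [radialProj_of_le h.le, sub_self, smul_zero, map_zero]
    refine (hasFDerivAt_const (0 : ℝ) x).congr_of_eventuallyEq ?_
    have hc : ContinuousAt (fun x : Vec d => ‖x - x₀‖) x := by fun_prop
    filter_upwards [hc.eventually_lt continuousAt_const h] with y hy
    rw [max_eq_right (by linarith)]; simp
  · have hx0 : 0 < ‖x - x₀‖ := hr.trans_le h
    have hn : HasFDerivAt (fun x : Vec d => ‖x - x₀‖)
        (InnerProductSpace.toDual ℝ (Vec d) ((1 / ‖x - x₀‖) • (x - x₀))) x := by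
      have h3 := (hasGradientAt_norm_sub_sq x₀ x).hasFDerivAt.sqrt (by positivity)
      simp only [Real.sqrt_sq (norm_nonneg _)] at h3
      refine h3.congr_fderiv ?_
      ext v
      simp [InnerProductSpace.toDual_apply_apply]
      ring
    have h4 := ((hasDerivAt_max_sq (‖x - x₀‖ - r)).comp_hasFDerivAt x (hn.sub_const r)).const_mul L₁
    refine h4.congr_fderiv ?_
    rw [radialProj_of_ge hr h, max_eq_left (by linarith)]
    have e : (x - x₀) - (r / ‖x - x₀‖) • (x - x₀) = (1 - r / ‖x - x₀‖) • (x - x₀) := by module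
    rw [e]
    ext v
    simp only [smul_apply, InnerProductSpace.toDual_apply_apply, inner_smul_left, conj_trivial,
      smul_eq_mul]
    field_simp

theorem Smooth.penalized {d : ℕ} {f : Vec d → ℝ} {L₁ L₂ α : ℝ} (hL : 0 ≤ L₁) (hf : Smooth f L₁)
    (hr : 0 < α / L₂) (x₀ : Vec d) : Smooth (penalized f L₁ L₂ α x₀) (5 * L₁) := by
  refine ⟨fun z => (hasGradientAt_penalized hf.1 hr x₀ z).differentiableAt, fun x y => ?_⟩
  rw [(hasGradientAt_penalized hf.1 hr x₀ x).gradient,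
    (hasGradientAt_penalized hf.1 hr x₀ y).gradient]
  set P := radialProj (α / L₂) (x - x₀)
  set Q := radialProj (α / L₂) (y - x₀)
  have hPQ : ‖P - Q‖ ≤ ‖x - y‖ := by
    have := norm_radialProj_sub_le hr (x - x₀) (y - x₀)
    rwa [sub_sub_sub_cancel_right] at this
  have e : gradient f x + (2 * L₁) • (x - x₀ - P) - (gradient f y + (2 * L₁) • (y - x₀ - Q)) =
      (gradient f x - gradient f y) + (2 * L₁) • ((x - y) - (P - Q)) := by module
  rw [e]
  refine (norm_add_le _ _).trans ?_
  rw [norm_smul, Real.norm_eq_abs, abs_of_nonneg (by positivity)]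
  have h1 := hf.2 x y
  have h2 := norm_sub_le (x - y) (P - Q)
  nlinarith

theorem hess_isSymmetric {d : ℕ} {f : Vec d → ℝ} {L₂ : ℝ} (hf : HessianLipschitz f L₂) (x : Vec d) :
    (hess f x : Vec d →ₗ[ℝ] Vec d).IsSymmetric := by
  intro v w
  have h1 : ∀ y, HasFDerivAt f (InnerProductSpace.toDual ℝ (Vec d) (gradient f y)) y :=
    fun y => (hf.1 y).hasGradientAt.hasFDerivAt
  let Φ : Vec d →L[ℝ] (Vec d →L[ℝ] ℝ) := innerSL ℝ
  have h2 : HasFDerivAt (fun y => InnerProductSpace.toDual ℝ (Vec d) (gradient f y))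
      (Φ.comp (hess f x)) x := Φ.hasFDerivAt.comp x (hf.2.1 x).hasFDerivAt
  have h3 := second_derivative_symmetric h1 h2 v w
  change inner ℝ (hess f x v) w = inner ℝ (hess f x w) v at h3
  simp only [ContinuousLinearMap.coe_coe]
  rw [h3, real_inner_comm]

theorem hasDerivAt_inner_gradient_line {d : ℕ} {f : Vec d → ℝ}
    (hf : Differentiable ℝ (gradient f)) (x h : Vec d) (t : ℝ) :
    HasDerivAt (fun t : ℝ => inner ℝ (gradient f (x + t • h)) h)
      (inner ℝ (hess f (x + t • h) h) h) t := by
  have h1 : HasDerivAt (fun t : ℝ => x + t • h) h t := by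
    simpa using ((hasDerivAt_id t).smul_const h).const_add x
  have h2 := (hf (x + t • h)).hasFDerivAt.comp_hasDerivAt t h1
  have h3 := h2.inner ℝ (hasDerivAt_const t h)
  refine h3.congr_deriv ?_
  rw [inner_zero_right, zero_add]; rfl

theorem abs_inner_hess_sub_le {d : ℕ} {f : Vec d → ℝ} {L₂ : ℝ} (hf : HessianLipschitz f L₂)
    (x y h : Vec d) :
    |inner ℝ (hess f y h) h - inner ℝ (hess f x h) h| ≤ L₂ * ‖y - x‖ * ‖h‖ ^ 2 := by
  rw [← inner_sub_left, ← sub_apply]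
  refine (abs_real_inner_le_norm _ _).trans ?_
  have h1 := (hess f y - hess f x).le_opNorm h
  have h2 := hf.2.2 y x
  have h3 := norm_nonneg h
  calc _ ≤ ‖hess f y - hess f x‖ * ‖h‖ * ‖h‖ := by gcongr
    _ ≤ L₂ * ‖y - x‖ * ‖h‖ * ‖h‖ := by gcongr
    _ = _ := by ring

/-- Near a point of small negative curvature the gradient is almost monotone. -/
theorem inner_gradient_sub_ge_of_hess {d : ℕ} {f : Vec d → ℝ} {L₂ α R : ℝ} (hL₂ : 0 ≤ L₂)
    (hf : HessianLipschitz f L₂) {x₀ : Vec d}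
    (hα : ∀ h, -α * ‖h‖ ^ 2 ≤ inner ℝ (hess f x₀ h) h) {x y : Vec d}
    (hx : ‖x - x₀‖ ≤ R) (hy : ‖y - x₀‖ ≤ R) :
    (-α - L₂ * R) * ‖y - x‖ ^ 2 ≤ inner ℝ (gradient f y - gradient f x) (y - x) := by
  set h := y - x with hh
  have hlin : ∀ t : ℝ, HasDerivAt (fun t : ℝ => (-α - L₂ * R) * ‖h‖ ^ 2 * t)
      ((-α - L₂ * R) * ‖h‖ ^ 2) t := fun t => by
    simpa using (hasDerivAt_id t).const_mul ((-α - L₂ * R) * ‖h‖ ^ 2)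
  have key := sub_le_sub_of_deriv_le hlin (hasDerivAt_inner_gradient_line hf.2.1 x h) (t := 1)
    (fun t ht0 ht1 => ?_) zero_le_one le_rfl
  · have hy : x + h = y := by rw [hh]; abel
    simp only [one_smul, zero_smul, add_zero, hy, mul_one, mul_zero, sub_zero] at key
    rwa [inner_sub_left]
  · have h1 := (abs_le.1 (abs_inner_hess_sub_le hf x₀ (x + t • h) h)).1
    have h2 := hα h
    have h3 : ‖x + t • h - x₀‖ ≤ R := by
      have e : x + t • h - x₀ = (1 - t) • (x - x₀) + t • (y - x₀) := by rw [hh]; module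
      rw [e]
      refine (norm_add_le _ _).trans ?_
      rw [norm_smul, norm_smul, Real.norm_eq_abs, Real.norm_eq_abs, abs_of_nonneg ht0,
        abs_of_nonneg (by linarith)]
      nlinarith
    have h4 : L₂ * ‖x + t • h - x₀‖ * ‖h‖ ^ 2 ≤ L₂ * R * ‖h‖ ^ 2 := by gcongr
    linarith

/-- Within distance $2\alpha/L_2$ of $x_0$ the Lipschitz Hessian loses at most $2\alpha$ from
$-\alpha$. Outside, the penalty has monotonicity modulus $2L_1\cdot\frac12=L_1$, which absorbs the
modulus $-L_1$ of $\nabla f$. -/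
theorem GradMono.penalized {d : ℕ} {f : Vec d → ℝ} {L₁ L₂ α : ℝ} (hL₁ : 0 < L₁) (hL₂ : 0 < L₂)
    (hα0 : 0 < α) (hf : Smooth f L₁) (hf₂ : HessianLipschitz f L₂) {x₀ : Vec d}
    (hα : ∀ h, -α * ‖h‖ ^ 2 ≤ inner ℝ (hess f x₀ h) h) :
    GradMono (penalized f L₁ L₂ α x₀) (-(3 * α)) := by
  have hr : 0 < α / L₂ := by positivity
  set r := α / L₂ with hrdef
  have hLr : L₂ * (2 * r) = 2 * α := by rw [hrdef]; field_simp
  set F := gradient (NCAccel.penalized f L₁ L₂ α x₀) with hF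
  have hFe : ∀ x, F x = gradient f x + (2 * L₁) • ((x - x₀) - radialProj r (x - x₀)) :=
    fun x => (hasGradientAt_penalized hf.1 hr x₀ x).gradient
  have hdiff : ∀ x y, inner ℝ (F y - F x) (y - x) = inner ℝ (gradient f y - gradient f x) (y - x) +
      2 * L₁ * inner ℝ (((y - x₀) - radialProj r (y - x₀)) - ((x - x₀) - radialProj r (x - x₀)))
        ((y - x₀) - (x - x₀)) := by
    intro x y
    have e : F y - F x = (gradient f y - gradient f x) + (2 * L₁) •
        (((y - x₀) - radialProj r (y - x₀)) - ((x - x₀) - radialProj r (x - x₀))) := by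
      rw [hFe, hFe]; module
    rw [e, inner_add_left, inner_smul_left, conj_trivial, sub_sub_sub_cancel_right y x x₀]
  have hin : ∀ x y, ‖x - x₀‖ ≤ 2 * r → ‖y - x₀‖ ≤ 2 * r →
      -(3 * α) * ‖y - x‖ ^ 2 ≤ inner ℝ (F y - F x) (y - x) := by
    intro x y hx hy
    have h1 := inner_gradient_sub_ge_of_hess hL₂.le hf₂ hα hx hy
    have h2 := inner_sub_radialProj_nonneg hr (x - x₀) (y - x₀)
    rw [hdiff, hLr] at *
    have : 0 ≤ 2 * L₁ * inner ℝ (((y - x₀) - radialProj r (y - x₀)) -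
      ((x - x₀) - radialProj r (x - x₀))) ((y - x₀) - (x - x₀)) := by positivity
    linarith
  have hout : ∀ x y, 2 * r ≤ ‖x - x₀‖ → 2 * r ≤ ‖y - x₀‖ →
      -(3 * α) * ‖y - x‖ ^ 2 ≤ inner ℝ (F y - F x) (y - x) := by
    intro x y hx hy
    have h1 := hf.gradMono_neg x y
    have h2 := half_le_inner_sub_radialProj hr hx hy
    rw [sub_sub_sub_cancel_right y x x₀] at h2
    rw [hdiff, sub_sub_sub_cancel_right y x x₀]
    have h3 := mul_le_mul_of_nonneg_left h2 (by positivity : 0 ≤ 2 * L₁)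
    have : 0 ≤ α * ‖y - x‖ ^ 2 := by positivity
    linarith
  have hseg : ∀ x y h : Vec d, ∀ s : ℝ, 0 ≤ s → y - x = s • h →
      -(3 * α) * ‖y - x‖ ^ 2 ≤ inner ℝ (F y - F x) (y - x) →
      -(3 * α) * (s * ‖h‖ ^ 2) ≤ inner ℝ (F y - F x) h := by
    intro x y h s hs e hxy
    rcases hs.eq_or_lt with h0 | h0
    · rw [← h0, zero_smul, sub_eq_zero] at e
      simp [e, ← h0]
    · rw [e, norm_smul, inner_smul_right, Real.norm_eq_abs, mul_pow, sq_abs] at hxy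
      refine le_of_mul_le_mul_left ?_ h0
      linarith
  have hcross : ∀ x y, ‖x - x₀‖ ≤ 2 * r → 2 * r ≤ ‖y - x₀‖ →
      -(3 * α) * ‖y - x‖ ^ 2 ≤ inner ℝ (F y - F x) (y - x) := by
    intro x y hx hy
    -- A segment joining the two regions is cut at one point of the sphere of radius $2r$. The bound
    -- `hout` needs only the endpoints outside, so one cut suffices, and the two inequalities add up
    -- along the common direction.
    have hc : ContinuousOn (fun t : ℝ => ‖x + t • (y - x) - x₀‖) (Set.Icc 0 1) := by fun_prop
    obtain ⟨t, ht, htr⟩ := intermediate_value_Icc zero_le_one hc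
      (show 2 * r ∈ Set.Icc _ _ by simpa using ⟨hx, hy⟩)
    simp only at htr
    have h1 := hseg x (x + t • (y - x)) (y - x) t ht.1 (by abel) (hin _ _ hx htr.le)
    have h2 := hseg (x + t • (y - x)) y (y - x) (1 - t) (by linarith [ht.2]) (by module)
      (hout _ _ htr.ge hy)
    have e : F y - F x = (F y - F (x + t • (y - x))) + (F (x + t • (y - x)) - F x) := by abel
    rw [e, inner_add_left]
    linarith
  intro x y
  rcases le_total ‖x - x₀‖ (2 * r) with hx | hx <;> rcases le_total ‖y - x₀‖ (2 * r) with hy | hy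
  · exact hin x y hx hy
  · exact hcross x y hx hy
  · have := hcross y x hy hx
    rwa [norm_sub_rev, ← neg_sub (F y), ← neg_sub y x, inner_neg_neg] at this
  · exact hout x y hx hy

/-! ### Events that fail with small probability -/

/-- Under `p` the event `S` fails with probability at most `a`. -/
def HoldsExcept {β : Type*} (p : PMF β) (S : Set β) (a : ℝ) : Prop :=
  p.toOuterMeasure Sᶜ ≤ ENNReal.ofReal a

theorem toOuterMeasure_add_compl {β : Type*} (p : PMF β) (S : Set β) :
    p.toOuterMeasure S + p.toOuterMeasure Sᶜ = 1 := by
  rw [PMF.toOuterMeasure_apply, PMF.toOuterMeasure_apply, ← ENNReal.tsum_add, ← p.tsum_coe]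
  exact tsum_congr fun x => congrFun (Set.indicator_self_add_compl S p) x

theorem HoldsExcept.mono {β : Type*} {p : PMF β} {S S' : Set β} {a a' : ℝ}
    (h : HoldsExcept p S a) (hS : S ⊆ S') (ha : a ≤ a') : HoldsExcept p S' a' :=
  (MeasureTheory.measure_mono (Set.compl_subset_compl.2 hS)).trans
    (le_trans h (ENNReal.ofReal_le_ofReal ha))

theorem HoldsExcept.le_toOuterMeasure {β : Type*} {p : PMF β} {S : Set β} {a : ℝ} (ha : 0 ≤ a)
    (h : HoldsExcept p S a) : ENNReal.ofReal (1 - a) ≤ p.toOuterMeasure S := by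
  rw [ENNReal.ofReal_sub _ ha, ENNReal.ofReal_one, ← toOuterMeasure_add_compl p S,
    tsub_le_iff_right]
  gcongr
  exact h

theorem holdsExcept_of_le {β : Type*} {p : PMF β} {S : Set β} {a : ℝ} (ha : 0 ≤ a) (ha1 : a ≤ 1)
    (h : ENNReal.ofReal (1 - a) ≤ p.toOuterMeasure S) : HoldsExcept p S a := by
  have h1 := toOuterMeasure_add_compl p S
  have h2 : ENNReal.ofReal (1 - a) + ENNReal.ofReal a = 1 := by
    rw [← ENNReal.ofReal_add (by linarith) ha]; simp
  have h3 : ENNReal.ofReal (1 - a) + p.toOuterMeasure Sᶜ ≤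
      ENNReal.ofReal (1 - a) + ENNReal.ofReal a := by
    rw [h2, ← h1]; gcongr
  exact (ENNReal.add_le_add_iff_left ENNReal.ofReal_ne_top).1 h3

theorem HoldsExcept.inter_of_support_subset {β : Type*} {p : PMF β} {S Q : Set β} {a : ℝ}
    (h : HoldsExcept p S a) (hQ : ∀ x ∈ p.support, x ∈ Q) : HoldsExcept p (Q ∩ S) a := by
  have h0 : p.toOuterMeasure Qᶜ = 0 :=
    (PMF.toOuterMeasure_apply_eq_zero_iff _ _).2 (Set.disjoint_left.2 fun x hx hx' => hx' (hQ x hx))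
  rw [HoldsExcept, Set.compl_inter]
  refine (MeasureTheory.measure_union_le _ _).trans ?_
  rw [h0, zero_add]
  exact h

theorem holdsExcept_pure {β : Type*} {x : β} {S : Set β} (hx : x ∈ S) {a : ℝ} :
    HoldsExcept (PMF.pure x) S a := by
  rw [HoldsExcept, PMF.toOuterMeasure_pure_apply, if_neg (by simpa using hx)]
  exact zero_le

theorem HoldsExcept.map {β γ : Type*} {p : PMF β} {f : β → γ} {S : Set γ} {a : ℝ}
    (h : HoldsExcept p (f ⁻¹' S) a) : HoldsExcept (p.map f) S a := by
  rw [HoldsExcept, PMF.toOuterMeasure_map_apply]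
  exact h

/-- Union bound: either the first stage fails, or it succeeds and the second stage fails given its
outcome. -/
theorem HoldsExcept.bind {β γ : Type*} {p : PMF β} {q : β → PMF γ} {G : Set β} {S : Set γ}
    {a b : ℝ} (ha : 0 ≤ a) (hb : 0 ≤ b) (hp : HoldsExcept p G a)
    (hq : ∀ x ∈ G, HoldsExcept (q x) S b) : HoldsExcept (p.bind q) S (a + b) := by
  rw [HoldsExcept, PMF.toOuterMeasure_bind_apply, ENNReal.ofReal_add ha hb]
  calc ∑' x, p x * (q x).toOuterMeasure Sᶜ
      ≤ ∑' x, (Gᶜ.indicator p x + p x * ENNReal.ofReal b) := by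
        refine ENNReal.tsum_le_tsum fun x => ?_
        by_cases hx : x ∈ G
        · exact le_add_left (by gcongr; exact hq x hx)
        · rw [Set.indicator_of_mem (by exact hx)]
          refine le_add_right ?_
          have h1 : (q x).toOuterMeasure Sᶜ ≤ 1 :=
            (le_add_left le_rfl).trans_eq (toOuterMeasure_add_compl (q x) S)
          exact (mul_le_mul_right h1 _).trans_eq (mul_one _)
    _ = p.toOuterMeasure Gᶜ + ENNReal.ofReal b := by
        rw [ENNReal.tsum_add, ENNReal.tsum_mul_right, p.tsum_coe, one_mul,
          PMF.toOuterMeasure_apply]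
    _ ≤ _ := by gcongr; exact hp

/-! ### Negative curvature descent -/

/-- Third order Taylor bound. -/
theorem HessianLipschitz.le_add {d : ℕ} {f : Vec d → ℝ} {L₂ : ℝ} (hf : HessianLipschitz f L₂)
    (x h : Vec d) : f (x + h) ≤ f x + inner ℝ (gradient f x) h + 1 / 2 * inner ℝ (hess f x h) h +
      L₂ / 6 * ‖h‖ ^ 3 := by
  set a := inner ℝ (gradient f x) h
  set b := inner ℝ (hess f x h) h with hb
  have h1 : ∀ t, HasDerivAt (fun t : ℝ => b * t + L₂ * ‖h‖ ^ 3 / 2 * t ^ 2)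
      (b + L₂ * ‖h‖ ^ 3 * t) t := fun t => by
    refine (((hasDerivAt_id t).const_mul b).add
      ((hasDerivAt_pow 2 t).const_mul (L₂ * ‖h‖ ^ 3 / 2))).congr_deriv ?_
    push_cast; ring
  have k1 := @sub_le_sub_of_deriv_le _ _ _ _ (hasDerivAt_inner_gradient_line hf.2.1 x h) h1
    (fun t ht0 _ => by
      have h3 := (abs_le.1 (abs_inner_hess_sub_le hf x (x + t • h) h)).2
      rw [add_sub_cancel_left, norm_smul, Real.norm_eq_abs, abs_of_nonneg ht0] at h3
      rw [hb]; linarith)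
  have h2 : ∀ t, HasDerivAt (fun t : ℝ => a * t + b / 2 * t ^ 2 + L₂ * ‖h‖ ^ 3 / 6 * t ^ 3)
      (a + b * t + L₂ * ‖h‖ ^ 3 / 2 * t ^ 2) t := fun t => by
    refine ((((hasDerivAt_id t).const_mul a).add ((hasDerivAt_pow 2 t).const_mul (b / 2))).add
      ((hasDerivAt_pow 3 t).const_mul (L₂ * ‖h‖ ^ 3 / 6))).congr_deriv ?_
    push_cast; ring
  have k2 := sub_le_sub_of_deriv_le (hasDerivAt_comp_line hf.1 x h) h2 (t := 1)
    (fun t ht0 ht1 => by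
      have h3 := k1 ht0 ht1
      simp only [zero_smul, add_zero] at h3
      linarith) zero_le_one le_rfl
  simp only [one_smul, zero_smul, add_zero] at k2
  linarith

/-- A step along a direction of negative curvature decreases the function. -/
theorem ncd_step_le {d : ℕ} {f : Vec d → ℝ} {L₂ α : ℝ} (hL₂ : 0 < L₂) (hα : 0 < α)
    (hf : HessianLipschitz f L₂) (z v : Vec d) (hv : ‖v‖ = 1)
    (hq : inner ℝ v (hess f z v) ≤ -(α / 2)) :
    f (z - (2 * |inner ℝ v (hess f z v)| / L₂ *
      (if 0 ≤ inner ℝ v (gradient f z) then 1 else -1)) • v) ≤ f z - α ^ 3 / (12 * L₂ ^ 2) := by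
  set q := inner ℝ v (hess f z v) with hqdef
  set s : ℝ := if 0 ≤ inner ℝ v (gradient f z) then 1 else -1 with hs
  have hs2 : s ^ 2 = 1 := by rw [hs]; split_ifs <;> norm_num
  have hsabs : |s| = 1 := by rw [hs]; split_ifs <;> norm_num
  have hsg : 0 ≤ s * inner ℝ v (gradient f z) := by
    rw [hs]; split_ifs with h
    · linarith
    · linarith [not_le.1 h]
  have hqa : |q| = -q := abs_of_nonpos (by linarith)
  have h1 := hf.le_add z (-((2 * |q| / L₂ * s) • v))
  rw [map_neg, inner_neg_neg, inner_neg_right, norm_neg, norm_smul, hv, map_smul, inner_smul_left,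
    inner_smul_right, inner_smul_right, real_inner_comm v (hess f z v), ← hqdef,
    real_inner_comm v (gradient f z), conj_trivial, ← sub_eq_add_neg, mul_one, Real.norm_eq_abs,
    abs_mul, hsabs, mul_one, hqa,
    abs_of_nonneg (show 0 ≤ 2 * -q / L₂ from div_nonneg (by linarith) hL₂.le)] at h1
  rw [hqa]
  refine h1.trans ?_
  have h2 : 0 ≤ 2 * -q / L₂ * s * inner ℝ v (gradient f z) := by
    rw [mul_assoc]; exact mul_nonneg (div_nonneg (by linarith) hL₂.le) hsg
  -- The sign makes the linear term harmless. For step length $2|q|/L_2$ the quadratic term is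
  -- $-2|q|^3/L_2^2$ and the cubic remainder $\frac43|q|^3/L_2^2$; what is left is at most
  -- $-\frac23(\alpha/2)^3/L_2^2$.
  have h3 : 1 / 2 * (2 * -q / L₂ * s * (2 * -q / L₂ * s * q)) =
      2 * q ^ 3 / L₂ ^ 2 * s ^ 2 := by field_simp
  have h4 : L₂ / 6 * (2 * -q / L₂) ^ 3 = -(4 / 3 * q ^ 3 / L₂ ^ 2) := by field_simp; ring
  have h5 : (α / 2) ^ 3 ≤ (-q) ^ 3 := pow_le_pow_left₀ (by positivity) (by linarith) 3
  have h6 : α ^ 3 / (12 * L₂ ^ 2) = 2 / 3 * (α / 2) ^ 3 / L₂ ^ 2 := by field_simp; norm_num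
  have h7 : 2 / 3 * (α / 2) ^ 3 / L₂ ^ 2 ≤ 2 / 3 * (-q) ^ 3 / L₂ ^ 2 := by gcongr
  have h8 : 2 / 3 * (-q) ^ 3 / L₂ ^ 2 = 4 / 3 * q ^ 3 / L₂ ^ 2 * (-1) + 2 / 3 * q ^ 3 / L₂ ^ 2 := by
    ring
  have h9 : 2 * q ^ 3 / L₂ ^ 2 * s ^ 2 = 4 / 3 * q ^ 3 / L₂ ^ 2 + 2 / 3 * q ^ 3 / L₂ ^ 2 := by
    rw [hs2]; ring
  rw [h3, h4, h9, h6]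
  have h10 : 2 / 3 * q ^ 3 / L₂ ^ 2 = -(2 / 3 * (-q) ^ 3 / L₂ ^ 2) := by ring
  linarith

theorem Smooth.norm_hess_le {d : ℕ} {f : Vec d → ℝ} {L₁ : ℝ} (hL₁ : 0 ≤ L₁) (hf : Smooth f L₁)
    (x : Vec d) : ‖hess f x‖ ≤ L₁ := by
  have h : LipschitzWith ⟨L₁, hL₁⟩ (gradient f) := LipschitzWith.of_dist_le_mul fun x y => by
    rw [dist_eq_norm, dist_eq_norm]; exact hf.2 x y
  exact norm_fderiv_le_of_lipschitz ℝ h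

/-- What a call of the first phase of the method guarantees, for curvature `α`, descent unit `u`
and time unit `e`: a point of almost nonnegative curvature, reached after enough descent. -/
def FirstPhaseGood {d : ℕ} (f : Vec d → ℝ) (α u e : ℝ) (z : Vec d) : Set (Outcome d) :=
  {o | ∃ xh c, o = some (xh, c) ∧ -α ≤ lamMin (hess f xh) ∧ f xh ≤ f z ∧
    c ≤ e * (1 + (f z - f xh) / u) ∧ (xh = z ∨ f xh ≤ f z - u)}

/-- Every continuing pass lowers $f$ by $u$, so at most $1+(f(z)-m)/u$ eigenvector calls occur, each
failing with probability at most $\delta'$. On exit $q>-\alpha/2$, and accuracy $\alpha/2$ gives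
$\lambda_{\min}>-\alpha$. -/
theorem ncdLoop_spec {d : ℕ} {tm : OpTimes} {T A : ℝ} (hT : 0 < T)
    (htm : tm.Within T) {R : EigRoutine d} (hR : R.Meets A T) {f : Vec d → ℝ}
    {L₁ L₂ α δ' m E : ℝ} (hL₁ : 0 < L₁) (hL₂ : 0 < L₂) (hα : 0 < α) (hαL : α < L₁) (hδ : 0 < δ')
    (hδ1 : δ' < 1) (hf : Smooth f L₁) (hf₂ : HessianLipschitz f L₂) (hlow : ∀ x, m ≤ f x)
    (hE0 : 0 ≤ E) (hE : A * T * (1 + Real.log (d / δ') * √(L₁ / (α / 2))) ≤ E) (n : ℕ) (z : Vec d)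
    (hn : (f z - m) / (α ^ 3 / (12 * L₂ ^ 2)) < n) :
    HoldsExcept (ncdLoop tm R f L₁ L₂ α δ' n z)
      (FirstPhaseGood f α (α ^ 3 / (12 * L₂ ^ 2)) (E + 6 * T) z)
      (δ' * (1 + (f z - m) / (α ^ 3 / (12 * L₂ ^ 2)))) := by
  set u := α ^ 3 / (12 * L₂ ^ 2) with hu
  have hu0 : 0 < u := by positivity
  obtain ⟨t1, t2, t3⟩ := htm
  induction n generalizing z with
  | zero =>
    have : 0 ≤ (f z - m) / u := div_nonneg (sub_nonneg.2 (hlow z)) hu0.le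
    push_cast at hn; linarith
  | succ n ih =>
    obtain ⟨hR1, hR2⟩ := hR (hess f z) (hess_isSymmetric hf₂ z) L₁ (α / 2) δ'
      (hf.norm_hess_le hL₁.le z) (by positivity) (by linarith) hδ hδ1
    have hR3 := (holdsExcept_of_le hδ.le hδ1.le hR2).inter_of_support_subset
      (Q := {p : Vec d × ℝ | ‖p.1‖ = 1 ∧ p.2 ≤ A * T * (1 + Real.log (d / δ') * √(L₁ / (α / 2)))}) hR1
    rw [ncdLoop, mul_add, mul_one]
    have hb : 0 ≤ (f z - m) / u := div_nonneg (sub_nonneg.2 (hlow z)) hu0.le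
    refine HoldsExcept.bind hδ.le (by positivity) hR3 ?_
    rintro ⟨v, t⟩ ⟨⟨hv, ht⟩, hlam⟩
    simp only at hv ht
    change inner ℝ v (hess f z v) ≤ lamMin (hess f z) + α / 2 at hlam
    simp only
    by_cases hq : inner ℝ v (hess f z v) ≤ -(α / 2)
    · rw [if_pos hq]
      have hdrop := ncd_step_le hL₂ hα hf₂ z v hv hq
      rw [← hu] at hdrop
      set z' := z - (2 * |inner ℝ v (hess f z v)| / L₂ *
        (if 0 ≤ inner ℝ v (gradient f z) then 1 else -1)) • v with hz'
      have hdiv : (f z' - m) / u ≤ (f z - m) / u - 1 := by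
        rw [div_sub_one hu0.ne']
        exact div_le_div_of_nonneg_right (by linarith) hu0.le
      have h1 := ih z' (by push_cast at hn; linarith)
      refine HoldsExcept.map (h1.mono ?_ (mul_le_mul_of_nonneg_left (by linarith) hδ.le))
      rintro _ ⟨xh, c, rfl, g1, g2, g3, g4⟩
      refine ⟨xh, _, rfl, g1, by linarith, ?_, Or.inr (by linarith)⟩
      have h2 : 1 + (f z' - f xh) / u ≤ (f z - f xh) / u := by
        rw [← div_self hu0.ne', ← add_div]
        gcongr
        linarith
      have h3 := mul_le_mul_of_nonneg_left h2 (by positivity : 0 ≤ E + 6 * T)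
      linarith
    · rw [if_neg hq]
      refine holdsExcept_pure ?_
      refine ⟨z, _, rfl, by linarith [not_le.1 hq], le_rfl, ?_, Or.inl rfl⟩
      rw [sub_self, zero_div, add_zero, mul_one]
      linarith

/-! ### The accelerated non-convex method -/

theorem norm_sub_radialProj_le {d : ℕ} {r : ℝ} (hr : 0 < r) (x : Vec d) :
    ‖x - radialProj r x‖ ≤ ‖x‖ := by
  rcases le_total ‖x‖ r with h | h
  · rw [radialProj_of_le h, sub_self, norm_zero]; exact norm_nonneg x
  · have hx : 0 < ‖x‖ := hr.trans_le h
    have e : x - (r / ‖x‖) • x = (1 - r / ‖x‖) • x := by module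
    have h1 : r / ‖x‖ ≤ 1 := (div_le_one hx).2 h
    have h2 : 0 < r / ‖x‖ := by positivity
    rw [radialProj_of_ge hr h, e, norm_smul, Real.norm_eq_abs, abs_of_nonneg (by linarith)]
    exact mul_le_of_le_one_left hx.le (by linarith)

/-- If $\|\nabla f(x)\|>\epsilon$ although the penalized gradient is at most $\epsilon/2$, the
penalty is active at $x$ and contributes more than $\epsilon/2$. Thus $x$ is at distance at least
$\alpha/L_2$ and at least $\epsilon/(4L_1)$ from $\hat x$. Either value may serve as $\rho$, and the
distance-decrease alternatives give the drop $2u$. -/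
theorem acagd_penalized_spec {d : ℕ} (hd : 0 < d) {tm : OpTimes} {T : ℝ} (hT : 0 ≤ T)
    (htm : tm.Within T) {f : Vec d → ℝ} {ε L₁ L₂ α Δ m u ρ : ℝ} (hε : 0 < ε) (hL₁ : 0 < L₁)
    (hL₂ : 0 < L₂) (hα : 0 < α) (hαL : α ≤ L₁) (hf : Smooth f L₁) (hf₂ : HessianLipschitz f L₂)
    (hlow : ∀ x, m ≤ f x) (hρ0 : 0 ≤ ρ) (hρ : ρ ≤ α / L₂ ∨ ρ ≤ ε / (4 * L₁))
    (hu₁ : 2 * u ≤ 3 * α * ρ ^ 2) (hu₂ : 2 * u ≤ ε / 6 * ρ) (k N : ℕ) (hkN : k < N)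
    (hk : 4 * (5 * L₁ + 2 * (3 * α)) * Δ ≤
      (ε / 2 * √(3 * α / (50 * (5 * L₁ + 2 * (3 * α))))) ^ 2 *
        Real.exp (k / √((5 * L₁ + 2 * (3 * α)) / (3 * α))))
    (hN : 1 + 60 * α / ε ^ 2 * Δ < N) (xh : Vec d) (hxh : f xh - m ≤ Δ)
    (hlam : -α ≤ lamMin (hess f xh)) (hgrad : ε < ‖gradient f xh‖) :
    ∃ x c, acagd tm (tm.grad + 4 * tm.vec) N (penalized f L₁ L₂ α xh) xh (ε / 2) (3 * α) (5 * L₁) =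
        some (x, c) ∧ f x ≤ f xh ∧
      c ≤ (21 * T + 22 * T * k) * (1 + 60 * α / ε ^ 2 * (f xh - f x)) ∧
      (‖gradient f x‖ ≤ ε ∨ f x ≤ f xh - 2 * u) := by
  obtain ⟨t1, -, t3⟩ := htm
  have hr : 0 < α / L₂ := by positivity
  set F := penalized f L₁ L₂ α xh with hF
  have hFxh : F xh = f xh := by
    rw [hF, penalized, sub_self, norm_zero, zero_sub, max_eq_right (by linarith)]; ring
  have hfF : ∀ x, f x ≤ F x := fun x => by
    have : 0 ≤ L₁ * (max (‖x - xh‖ - α / L₂) 0) ^ 2 := by positivity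
    rw [hF, penalized]; linarith
  have hFg : ∀ x, gradient F x = gradient f x +
      (2 * L₁) • ((x - xh) - radialProj (α / L₂) (x - xh)) :=
    fun x => (hasGradientAt_penalized hf.1 hr xh x).gradient
  have hmono : GradMono F (-(3 * α)) := by
    refine GradMono.penalized hL₁ hL₂ hα hf hf₂ fun h => ?_
    rw [real_inner_comm]
    exact (mul_le_mul_of_nonneg_right hlam (sq_nonneg _)).trans
      (lamMin_mul_le_inner hd (hess_isSymmetric hf₂ xh) h)
  have hsm : Smooth F (5 * L₁) := Smooth.penalized hL₁.le hf hr xh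
  have hcoef : 5 * (3 * α) / (ε / 2) ^ 2 = 60 * α / ε ^ 2 := by field_simp; norm_num
  have hcoef0 : 0 ≤ 60 * α / ε ^ 2 := by positivity
  obtain ⟨x, c, h1, h2, h3, h4, h5⟩ := acagdLoop_spec (w := tm.grad + 4 * tm.vec) hT t3
    (by linarith) (by positivity : 0 < 3 * α) (by linarith : 3 * α ≤ 5 * L₁)
    (by positivity : 0 < ε / 2) hsm hmono
    (fun x => (hlow x).trans (hfF x)) k N hkN hk N xh (by rw [hFxh]; exact hxh) (by
      rw [hcoef, hFxh]
      exact lt_of_le_of_lt (by gcongr) hN)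
  rw [hFxh] at h3 h4 h5
  rw [hcoef] at h4
  have hdrop : f xh - F x ≤ f xh - f x := by linarith [hfF x]
  have hxle : f x ≤ f xh := (hfF x).trans h3
  refine ⟨x, c, h1, hxle, ?_, ?_⟩
  · have h6 : 0 ≤ 15 * T + 22 * T * k := by positivity
    have h7 : 1 + 60 * α / ε ^ 2 * (f xh - F x) ≤ 1 + 60 * α / ε ^ 2 * (f xh - f x) := by gcongr
    have h8 : 0 ≤ 60 * α / ε ^ 2 * (f xh - f x) := mul_nonneg hcoef0 (by linarith)
    nlinarith [mul_le_mul_of_nonneg_left h7 h6]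
  · rw [or_iff_not_imp_left, not_le]
    intro hx
    have hdist : ρ ≤ ‖x - xh‖ := by
      rcases hρ with hρ | hρ
      · refine hρ.trans ?_
        by_contra! hlt
        have h6 := hFg x
        rw [radialProj_of_le hlt.le, sub_self, smul_zero, add_zero] at h6
        rw [h6] at h2
        linarith
      · refine hρ.trans ?_
        have h6 : gradient f x = gradient F x -
            (2 * L₁) • ((x - xh) - radialProj (α / L₂) (x - xh)) := by rw [hFg]; abel
        have h7 := norm_sub_le (gradient F x)
          ((2 * L₁) • ((x - xh) - radialProj (α / L₂) (x - xh)))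
        rw [← h6, norm_smul, Real.norm_eq_abs, abs_of_pos (by positivity)] at h7
        have h8 := mul_le_mul_of_nonneg_left (norm_sub_radialProj_le hr (x - xh))
          (by positivity : 0 ≤ 2 * L₁)
        rw [div_le_iff₀ (by positivity)]
        linarith
    rcases h5 with ⟨h5, -⟩ | h5 | h5
    · have h6 := hFg xh
      rw [sub_self, radialProj_of_le (by rw [norm_zero]; exact hr.le), sub_self, smul_zero,
        add_zero] at h6
      rw [h6] at h5
      linarith
    · have : 3 * α * ρ ^ 2 ≤ 3 * α * ‖x - xh‖ ^ 2 := by gcongr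
      linarith
    · have : ε / 6 * ρ ≤ ε / 6 * ‖x - xh‖ := by gcongr
      linarith

open Classical in
/-- An upper bound for the number of passes of the main loop when it is started at `x`. -/
noncomputable def passBound {d : ℕ} (f : Vec d → ℝ) (m u ε : ℝ) (x : Vec d) : ℝ :=
  (f x - m) / u + 1 + if ‖gradient f x‖ ≤ ε then 0 else 1

theorem passBound_le {d : ℕ} (f : Vec d → ℝ) (m u ε : ℝ) (x : Vec d) :
    passBound f m u ε x ≤ (f x - m) / u + 2 := by
  rw [passBound]; split_ifs <;> linarith

theorem le_passBound {d : ℕ} (f : Vec d → ℝ) (m u ε : ℝ) (x : Vec d) :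
    (f x - m) / u + 1 ≤ passBound f m u ε x := by
  rw [passBound]; split_ifs <;> linarith

/-- Time splits into a fixed cost per pass, counted by the potential `passBound`, and costs
proportional to the decrease of $f$, which telescope. The failure probability is $p$ per pass. -/
theorem accncLoop_spec {d : ℕ} {tm : OpTimes} {T : ℝ} (hT : 0 ≤ T)
    (htm : tm.Within T) {R : EigRoutine d} {N : ℕ} {f : Vec d → ℝ}
    {ε L₁ L₂ α Δ δ'' m u p e S v : ℝ} (hlow : ∀ x, m ≤ f x) (hu : 0 < u) (hp : 0 ≤ p)
    (he : 0 ≤ e) (hS : 0 ≤ S) (hv : 0 ≤ v)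
    (hfirst : ∀ x, f x - m ≤ Δ → HoldsExcept
      (if α < L₁ then ncd tm R N x f L₁ L₂ α Δ δ'' else PMF.pure (some (x, 0)))
      (FirstPhaseGood f α u e x) p)
    (hsecond : ∀ xh, f xh - m ≤ Δ → -α ≤ lamMin (hess f xh) → ε < ‖gradient f xh‖ →
      ∃ x c, acagd tm (tm.grad + 4 * tm.vec) N (penalized f L₁ L₂ α xh) xh
          (ε / 2) (3 * α) (5 * L₁) = some (x, c) ∧ f x ≤ f xh ∧
        c ≤ S * (1 + v * (f xh - f x)) ∧ (‖gradient f x‖ ≤ ε ∨ f x ≤ f xh - 2 * u))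
    (n : ℕ) (x : Vec d) (hx : f x - m ≤ Δ) (hn : passBound f m u ε x ≤ n) :
    HoldsExcept (accncLoop tm R N f ε L₁ L₂ α Δ δ'' n x)
      {o | ∃ y s, o = some (y, s) ∧ ‖gradient f y‖ ≤ ε ∧ -α ≤ lamMin (hess f y) ∧
        s ≤ (e + 2 * T + S) * passBound f m u ε x + (e / u + S * v) * (f x - m)}
      (p * passBound f m u ε x) := by
  obtain ⟨t1, -, t3⟩ := htm
  have hM1 : ∀ x, 1 ≤ passBound f m u ε x := fun x =>
    le_trans (by linarith [div_nonneg (sub_nonneg.2 (hlow x)) hu.le]) (le_passBound f m u ε x)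
  have hW : 0 ≤ e / u + S * v := by positivity
  have hU : 0 ≤ e + 2 * T + S := by positivity
  induction n generalizing x with
  | zero => have := hM1 x; push_cast at hn; linarith
  | succ n ih =>
    have hsplit : p * passBound f m u ε x = p + p * (passBound f m u ε x - 1) := by ring
    rw [accncLoop, hsplit]
    refine HoldsExcept.bind hp (mul_nonneg hp (by linarith [hM1 x])) (hfirst x hx) ?_
    rintro _ ⟨xh, c, rfl, hlam, hle, hc, hor⟩
    have hfx : 0 ≤ f x - f xh := by linarith
    have hcs : e * (1 + (f x - f xh) / u) = e + e / u * (f x - f xh) := by ring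
    rw [hcs] at hc
    simp only
    by_cases hg : ‖gradient f xh‖ ≤ ε
    · rw [if_pos hg]
      refine holdsExcept_pure ?_
      refine ⟨xh, _, rfl, hg, hlam, ?_⟩
      have h1 := mul_le_mul_of_nonneg_left (hM1 x) hU
      have h2 : (e / u) * (f x - f xh) ≤ (e / u) * (f x - m) := by
        have := hlow xh
        gcongr
      have h3 : 0 ≤ S * v * (f x - m) := mul_nonneg (by positivity) (sub_nonneg.2 (hlow x))
      rw [add_mul]
      linarith
    · rw [if_neg hg]
      obtain ⟨x', c', g1, g2, g3, g4⟩ := hsecond xh (by linarith) hlam (not_le.1 hg)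
      rw [g1]
      simp only
      -- If $x'$ is stationary and $x$ was not, the indicator drops. If both are stationary, the
      -- first phase must have moved, since $\hat x$ is not stationary, so $f$ fell by $u$.
      -- Otherwise $f$ fell by $2u$: one unit pays for the pass, one for a possible rise of the
      -- indicator.
      have hM : passBound f m u ε x' ≤ passBound f m u ε x - 1 := by
        rcases g4 with g4 | g4
        · have e1 : passBound f m u ε x' = (f x' - m) / u + 1 := by
            rw [passBound, if_pos g4, add_zero]
          by_cases hgx : ‖gradient f x‖ ≤ ε
          · have hne : xh ≠ x := fun h => hg (h ▸ hgx)
            have h1 := hor.resolve_left hne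
            have h2 : (f x' - m) / u ≤ (f x - m) / u - 1 := by
              rw [div_sub_one hu.ne']
              exact div_le_div_of_nonneg_right (by linarith) hu.le
            linarith [le_passBound f m u ε x]
          · have e2 : passBound f m u ε x = (f x - m) / u + 1 + 1 := by
              rw [passBound, if_neg hgx]
            have h2 : (f x' - m) / u ≤ (f x - m) / u :=
              div_le_div_of_nonneg_right (by linarith) hu.le
            linarith
        · have h2 : (f x' - m) / u ≤ (f x - m) / u - 2 := by
            have e3 : (f x - m) / u - 2 = (f x - m - 2 * u) / u := by field_simp
            rw [e3]
            exact div_le_div_of_nonneg_right (by linarith) hu.le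
          linarith [le_passBound f m u ε x, passBound_le f m u ε x']
      have h1 := ih x' (by linarith) (by push_cast at hn; linarith)
      refine HoldsExcept.map (h1.mono ?_ (mul_le_mul_of_nonneg_left hM hp))
      rintro _ ⟨y, s, rfl, k1, k2, k3⟩
      refine ⟨y, _, rfl, k1, k2, ?_⟩
      have h4 := mul_le_mul_of_nonneg_left hM hU
      have h5 : e / u * (f x - f xh) ≤ e / u * (f x - f x') := by gcongr
      have h6 : S * v * (f xh - f x') ≤ S * v * (f x - f x') := by gcongr
      have e4 : (e / u + S * v) * (f x - m) = e / u * (f x - f x') + S * v * (f x - f x') +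
        (e / u + S * v) * (f x' - m) := by ring
      rw [e4]
      linarith

/-- Success of the whole method from guarantees for its two phases. -/
theorem succeedsWithin_of_phases {d : ℕ} (hd : 0 < d) {tm : OpTimes} {T : ℝ} (hT : 0 ≤ T)
    (htm : tm.Within T) {R : EigRoutine d} {f : Vec d → ℝ} {x₁ : Vec d}
    {ε L₁ L₂ α Δ δ u ρ p e t : ℝ} (hε : 0 < ε) (hL₁ : 0 < L₁)
    (hL₂ : 0 < L₂) (hα : 0 < α) (hαL : α ≤ L₁) (hαdef : alphaParam ε L₁ L₂ Δ = α)
    (hf : Smooth f L₁) (hf₂ : HessianLipschitz f L₂) (hgap : OptGap f x₁ Δ)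
    (hu : 0 < u) (hρ0 : 0 ≤ ρ) (hρ : ρ ≤ α / L₂ ∨ ρ ≤ ε / (4 * L₁))
    (hu₁ : 2 * u ≤ 3 * α * ρ ^ 2) (hu₂ : 2 * u ≤ ε / 6 * ρ) (k : ℕ)
    (hk : 4 * (5 * L₁ + 2 * (3 * α)) * Δ ≤
      (ε / 2 * √(3 * α / (50 * (5 * L₁ + 2 * (3 * α))))) ^ 2 *
        Real.exp (k / √((5 * L₁ + 2 * (3 * α)) / (3 * α))))
    (hp : 0 ≤ p) (he : 0 ≤ e) (hpδ : p * (Δ / u + 2) ≤ δ)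
    (hfirst : ∃ N₁ : ℕ, ∀ N ≥ N₁, ∀ x, f x - ⨅ y, f y ≤ Δ → HoldsExcept
      (if α < L₁ then ncd tm R N x f L₁ L₂ α Δ
        (δ / (⌈1 + Δ * (12 * L₂ ^ 2 / α ^ 3 + √10 * L₂ / (α * ε))⌉₊ : ℕ))
        else PMF.pure (some (x, 0)))
      (FirstPhaseGood f α u e x) p)
    (hlamε : -2 * ε ^ (1 / 2 : ℝ) * L₂ ^ (1 / 2 : ℝ) ≤ -α)
    (ht : (e + 2 * T + (21 * T + 22 * T * k)) * (Δ / u + 2) +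
      (e / u + (21 * T + 22 * T * k) * (60 * α / ε ^ 2)) * Δ ≤ t) :
    SucceedsWithin tm R x₁ f ε L₁ L₂ Δ δ t := by
  obtain ⟨N₁, hN₁⟩ := hfirst
  have hlow : ∀ x, ⨅ y, f y ≤ f x := fun x => ciInf_le hgap.1 x
  have hgap₁ : f x₁ - ⨅ y, f y ≤ Δ := hgap.2
  have hS : 0 ≤ 21 * T + 22 * T * k := by positivity
  refine ⟨N₁ + (k + 1) + (⌈1 + 60 * α / ε ^ 2 * Δ⌉₊ + 1) + ⌈Δ / u + 2⌉₊, fun n hn => ?_⟩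
  have hn1 : N₁ ≤ n := by omega
  have hn2 : k < n := by omega
  have hn3 : 1 + 60 * α / ε ^ 2 * Δ < n := by
    have h1 : (⌈1 + 60 * α / ε ^ 2 * Δ⌉₊ : ℝ) + 1 ≤ n := by
      exact_mod_cast (by omega : ⌈1 + 60 * α / ε ^ 2 * Δ⌉₊ + 1 ≤ n)
    linarith [Nat.le_ceil (1 + 60 * α / ε ^ 2 * Δ)]
  have hn4 : Δ / u + 2 ≤ n := by
    have h1 : (⌈Δ / u + 2⌉₊ : ℝ) ≤ n := by
      exact_mod_cast (by omega : ⌈Δ / u + 2⌉₊ ≤ n)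
    linarith [Nat.le_ceil (Δ / u + 2)]
  have hM : passBound f (⨅ y, f y) u ε x₁ ≤ Δ / u + 2 :=
    (passBound_le _ _ _ _ _).trans (by gcongr)
  have key := accncLoop_spec hT htm hlow hu hp he hS (by positivity : 0 ≤ 60 * α / ε ^ 2)
    (hN₁ n hn1)
    (fun xh h1 h2 h3 => acagd_penalized_spec hd hT htm hε hL₁ hL₂ hα hαL hf hf₂ hlow hρ0 hρ hu₁
      hu₂ k n hn2 hk hn3 xh h1 h2 h3) n x₁ hgap₁ (hM.trans hn4)
  have hδ0 : p * passBound f (⨅ y, f y) u ε x₁ ≤ δ :=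
    (mul_le_mul_of_nonneg_left hM hp).trans hpδ
  rw [hαdef]
  refine HoldsExcept.le_toOuterMeasure (le_trans ?_ hδ0) (key.mono ?_ hδ0)
  · refine mul_nonneg hp (le_trans ?_ (le_passBound f _ u ε x₁))
    linarith [div_nonneg (sub_nonneg.2 (hlow x₁)) hu.le]
  · rintro _ ⟨x, s, rfl, h1, h2, h3⟩
    refine ⟨x, s, rfl, h1, hlamε.trans h2, h3.trans (le_trans ?_ ht)⟩
    gcongr

theorem SucceedsWithin.mono {d : ℕ} {tm : OpTimes} {R : EigRoutine d} {x₁ : Vec d}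
    {f : Vec d → ℝ} {ε L₁ L₂ Δ δ t t' : ℝ} (h : SucceedsWithin tm R x₁ f ε L₁ L₂ Δ δ t)
    (ht : t ≤ t') : SucceedsWithin tm R x₁ f ε L₁ L₂ Δ δ t' := by
  obtain ⟨n₀, h⟩ := h
  refine ⟨n₀, fun n hn => (h n hn).trans (MeasureTheory.measure_mono ?_)⟩
  rintro o ⟨x, s, h1, h2, h3, h4⟩
  exact ⟨x, s, h1, h2, h3, h4.trans ht⟩

/-! ### Logarithmic factors -/

/-- The number `18 √κ log τ` of passes suffices for every call of accelerated gradient descent. -/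
theorem agd_passes_suffice {ε L₁ α Δ τ : ℝ} (hε : 0 < ε) (hα : 0 < α) (hαL : α ≤ L₁)
    (hΔ0 : 0 ≤ Δ) (hτ3 : 3 ≤ τ) (hΔ : Δ ≤ τ) (hετ : 1 / ε ≤ τ) (hLα : L₁ ^ 2 ≤ α * τ ^ 5) {k : ℕ}
    (hk : 18 * √((5 * L₁ + 2 * (3 * α)) / (3 * α)) * Real.log τ ≤ k) :
    4 * (5 * L₁ + 2 * (3 * α)) * Δ ≤
      (ε / 2 * √(3 * α / (50 * (5 * L₁ + 2 * (3 * α))))) ^ 2 *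
        Real.exp (k / √((5 * L₁ + 2 * (3 * α)) / (3 * α))) := by
  have hL₁ : 0 < L₁ := hα.trans_le hαL
  set B := 5 * L₁ + 2 * (3 * α) with hB
  have hB0 : 0 < B := by positivity
  have hτ0 : 0 < τ := by linarith
  have hexp : τ ^ 18 ≤ Real.exp (k / √(B / (3 * α))) := by
    have h1 : Real.exp (18 * Real.log τ) = τ ^ 18 := by
      have : 18 * Real.log τ = Real.log (τ ^ 18) := by rw [Real.log_pow]; norm_num
      rw [this, Real.exp_log (by positivity)]
    rw [← h1, Real.exp_le_exp, le_div_iff₀ (by positivity)]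
    linarith
  rw [mul_pow, Real.sq_sqrt (by positivity)]
  have h1 : 1 ≤ ε * τ := by rwa [div_le_iff₀ hε, mul_comm] at hετ
  have h2 : 1 ≤ ε ^ 2 * τ ^ 2 := by rw [← mul_pow]; exact one_le_pow₀ h1
  have h3 : B ^ 2 ≤ 121 * (α * τ ^ 5) := by
    have : B ^ 2 ≤ (11 * L₁) ^ 2 := pow_le_pow_left₀ hB0.le (by linarith) 2
    linarith
  have h4 : (59049 : ℝ) ≤ τ ^ 10 :=
    le_trans (by norm_num) (pow_le_pow_left₀ (by norm_num) hτ3 10)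
  -- The exponent is $18=6+10+2$: $\tau^6$ bounds $L_1^2\Delta/\alpha$, $\tau^{10}\ge3^{10}$ absorbs
  -- the numerical constants, and $\tau^2$ absorbs $\epsilon^{-2}$.
  have h5 : 800 * B ^ 2 * Δ ≤ 3 * α * ε ^ 2 * τ ^ 18 := by
    calc 800 * B ^ 2 * Δ ≤ 800 * (121 * (α * τ ^ 5)) * τ := by gcongr
      _ = 96800 * (α * τ ^ 6) := by ring
      _ ≤ (3 * τ ^ 10) * (α * τ ^ 6) := by gcongr; linarith
      _ = 3 * α * τ ^ 16 * 1 := by ring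
      _ ≤ 3 * α * τ ^ 16 * (ε ^ 2 * τ ^ 2) := by gcongr
      _ = _ := by ring
  calc 4 * B * Δ = 800 * B ^ 2 * Δ / (200 * B) := by field_simp; ring
    _ ≤ 3 * α * ε ^ 2 * τ ^ 18 / (200 * B) := by gcongr
    _ = (ε / 2) ^ 2 * (3 * α / (50 * B)) * τ ^ 18 := by field_simp; norm_num
    _ ≤ _ := by gcongr

theorem acagd_unit_cost_le {T L₁ α τ : ℝ} (hT : 0 ≤ T) (hα : 0 < α) (hαL : α ≤ L₁)
    (hlog : 1 ≤ Real.log τ) :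
    21 * T + 22 * T * (⌈18 * √((5 * L₁ + 2 * (3 * α)) / (3 * α)) * Real.log τ⌉₊ : ℕ) ≤
      835 * (T * √(L₁ / α) * Real.log τ) := by
  set s := √(L₁ / α) with hs
  have hs1 : 1 ≤ s := Real.one_le_sqrt.2 ((one_le_div hα).2 hαL)
  have hκ : √((5 * L₁ + 2 * (3 * α)) / (3 * α)) ≤ 2 * s := by
    rw [Real.sqrt_le_left (by positivity), mul_pow, hs,
      Real.sq_sqrt (div_nonneg (by linarith) hα.le), ← mul_div_assoc,
      div_le_div_iff₀ (by positivity) hα]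
    nlinarith
  have hk := (Nat.ceil_lt_add_one (a := 18 * √((5 * L₁ + 2 * (3 * α)) / (3 * α)) * Real.log τ)
    (by positivity)).le
  have hsl : 1 ≤ s * Real.log τ := one_le_mul_of_one_le_of_one_le hs1 hlog
  have h1 : 18 * √((5 * L₁ + 2 * (3 * α)) / (3 * α)) * Real.log τ ≤
      18 * (2 * s) * Real.log τ := by gcongr
  calc _ ≤ 21 * T + 22 * T * (37 * (s * Real.log τ)) := by gcongr; linarith
    _ = 21 * T * 1 + 814 * (T * (s * Real.log τ)) := by ring
    _ ≤ 21 * T * (s * Real.log τ) + 814 * (T * (s * Real.log τ)) := by gcongr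
    _ = _ := by ring

/-- The bound for the time of one eigenvector computation. -/
theorem eig_cost_le {A T L₁ α D τ : ℝ} (hA : 0 < A) (hT : 0 < T) (hα : 0 < α) (hαL : α ≤ L₁)
    (hlog : 1 ≤ Real.log τ) (hD : Real.log D ≤ 13 * Real.log τ) :
    A * T * (1 + Real.log D * √(L₁ / (α / 2))) ≤ 21 * A * (T * √(L₁ / α) * Real.log τ) := by
  set s := √(L₁ / α) with hs
  have hs1 : 1 ≤ s := Real.one_le_sqrt.2 ((one_le_div hα).2 hαL)
  have h1 : √(L₁ / (α / 2)) ≤ 3 / 2 * s := by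
    rw [Real.sqrt_le_left (by positivity), mul_pow, hs,
      Real.sq_sqrt (div_nonneg (by linarith) hα.le)]
    have e : L₁ / (α / 2) = 2 * (L₁ / α) := by field_simp
    have : 0 ≤ L₁ / α := div_nonneg (by linarith) hα.le
    rw [e]; linarith
  have hsl : 1 ≤ s * Real.log τ := one_le_mul_of_one_le_of_one_le hs1 hlog
  have h2 : Real.log D * √(L₁ / (α / 2)) ≤ 13 * Real.log τ * (3 / 2 * s) := by
    calc _ ≤ 13 * Real.log τ * √(L₁ / (α / 2)) := by gcongr
      _ ≤ _ := by gcongr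
  calc _ ≤ A * T * (21 * (s * Real.log τ)) := by gcongr; linarith
    _ = _ := by ring

/-! ### The rate -/

theorem rpow_half_mul {ε L₂ : ℝ} (hε : 0 ≤ ε) :
    ε ^ (1 / 2 : ℝ) * L₂ ^ (1 / 2 : ℝ) = √(ε * L₂) := by
  rw [← Real.sqrt_eq_rpow, ← Real.sqrt_eq_rpow, Real.sqrt_mul hε]

/-- With $b=\sqrt{\epsilon L_2}$ this is $(\Delta b/\epsilon^2)\sqrt{L_1/b}$: units of work times
cost per unit. -/
theorem rate_eq {ε L₁ L₂ Δ : ℝ} (hε : 0 < ε) (hL₁ : 0 < L₁) (hL₂ : 0 < L₂) :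
    rate ε L₁ L₂ Δ = Δ * √(L₁ * √(ε * L₂)) / ε ^ 2 := by
  have h4 : ∀ x : ℝ, 0 < x → √√x = x ^ (1 / 4 : ℝ) := fun x hx => by
    rw [Real.sqrt_eq_rpow, Real.sqrt_eq_rpow, ← Real.rpow_mul hx.le]; norm_num
  have h5 : ε ^ (-(7 / 4) : ℝ) = ε ^ (1 / 4 : ℝ) / ε ^ 2 := by
    rw [← Real.rpow_natCast ε 2, ← Real.rpow_sub hε]; norm_num
  rw [rate, h5, Real.sqrt_mul hL₁.le, Real.sqrt_mul hε.le, Real.sqrt_mul (Real.sqrt_nonneg ε),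
    h4 ε hε, h4 L₂ hL₂, ← Real.sqrt_eq_rpow]
  ring

/-- The conclusion says $\epsilon^2/\Delta\le\sqrt{\epsilon L_2}$, which decides the maximum in the
definition of $\alpha$. -/
theorem sq_le_mul_sqrt_of_le {ε L₂ Δ : ℝ} (hε : 0 < ε) (hL₂ : 0 < L₂) (hΔ : 0 < Δ)
    (h : ε ≤ (Δ ^ 2 * L₂) ^ (1 / 3 : ℝ)) : ε ^ 2 ≤ Δ * √(ε * L₂) := by
  have h3 : ε ^ 3 ≤ Δ ^ 2 * L₂ := by
    have := pow_le_pow_left₀ hε.le h 3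
    rwa [← Real.rpow_natCast ((Δ ^ 2 * L₂) ^ (1 / 3 : ℝ)), ← Real.rpow_mul (by positivity), Nat.cast_ofNat,
      one_div_mul_cancel (by norm_num), Real.rpow_one] at this
  refine (pow_le_pow_iff_left₀ (by positivity) (by positivity) two_ne_zero).1 ?_
  rw [mul_pow, Real.sq_sqrt (by positivity)]
  nlinarith

theorem alphaParam_eq {ε L₁ L₂ Δ : ℝ} (hε : 0 < ε) (hΔ : 0 < Δ)
    (h : ε ^ 2 ≤ Δ * √(ε * L₂)) : alphaParam ε L₁ L₂ Δ = min L₁ √(ε * L₂) := by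
  rw [alphaParam, rpow_half_mul hε.le, max_eq_right]
  rwa [← div_eq_mul_inv, div_le_iff₀ hΔ, mul_comm]

/-- The method when the curvature parameter is `L₁`, so that no negative curvature is sought. -/
theorem succeedsWithin_of_le_sqrt {d : ℕ} (hd : 0 < d) {tm : OpTimes} {T : ℝ} (hT : 0 < T)
    (htm : tm.Within T) {R : EigRoutine d} {f : Vec d → ℝ} {x₁ : Vec d}
    {ε L₁ L₂ Δ δ τ : ℝ} (hε : 0 < ε) (hL₁ : 0 < L₁) (hL₂ : 0 < L₂) (hΔ : 0 < Δ) (hδ : 0 < δ)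
    (hf : Smooth f L₁) (hf₂ : HessianLipschitz f L₂) (hgap : OptGap f x₁ Δ)
    (hcond : ε ^ 2 ≤ Δ * √(ε * L₂)) (hL₁b : L₁ ≤ √(ε * L₂))
    (hτ3 : 3 ≤ τ) (hlog : 1 ≤ Real.log τ) (hL₁τ : L₁ ≤ τ) (hΔτ : Δ ≤ τ) (hετ : 1 / ε ≤ τ) :
    SucceedsWithin tm R x₁ f ε L₁ L₂ Δ δ
      (100000 * T * max 1 (rate ε L₁ L₂ Δ) * Real.log τ) := by
  set X := max 1 (rate ε L₁ L₂ Δ) with hX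
  have hX1 : 1 ≤ X := le_max_left _ _
  set Y := L₁ * Δ / ε ^ 2 with hY
  have hYX : Y ≤ X := by
    refine le_trans ?_ (le_max_right _ _)
    rw [rate_eq hε hL₁ hL₂, hY, mul_comm L₁]
    have : L₁ ≤ √(L₁ * √(ε * L₂)) := Real.le_sqrt_of_sq_le (by rw [sq]; gcongr)
    gcongr
  have hα := alphaParam_eq (L₁ := L₁) hε hΔ hcond
  rw [min_eq_left hL₁b] at hα
  have hτ0 : 0 < τ := by linarith
  -- Here $\rho$ is the second escape distance and $u$ is chosen so that $2u=\frac\epsilon6\rho$.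
  -- The first phase is void: it costs nothing, never fails, and $\lambda_{\min}\ge-L_1$ holds
  -- everywhere.
  refine succeedsWithin_of_phases (u := ε ^ 2 / (48 * L₁)) (ρ := ε / (4 * L₁)) (p := 0) (e := 0)
    hd hT.le htm hε hL₁ hL₂ hL₁ le_rfl hα hf hf₂ hgap (by positivity) (by positivity)
    (Or.inr le_rfl) ?_ ?_ _ (agd_passes_suffice hε hL₁ le_rfl hΔ.le hτ3 hΔτ hετ ?_ (Nat.le_ceil _))
    le_rfl le_rfl (by rw [zero_mul]; exact hδ.le) ⟨0, fun N _ x _ => ?_⟩ ?_ ?_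
  · have e1 : 2 * (ε ^ 2 / (48 * L₁)) = 2 / 48 * (ε ^ 2 / L₁) := by field_simp
    have e2 : 3 * L₁ * (ε / (4 * L₁)) ^ 2 = 3 / 16 * (ε ^ 2 / L₁) := by field_simp; norm_num
    rw [e1, e2]
    have : 0 ≤ ε ^ 2 / L₁ := by positivity
    linarith
  · refine le_of_eq ?_
    field_simp; norm_num
  · calc L₁ ^ 2 = L₁ * L₁ := sq L₁
      _ ≤ L₁ * τ ^ 5 := by
        gcongr
        exact hL₁τ.trans (le_self_pow₀ (by linarith) (by norm_num))
  · rw [if_neg (lt_irrefl L₁)]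
    refine holdsExcept_pure ?_
    refine ⟨x, 0, rfl, ?_, le_rfl, by simp, Or.inl rfl⟩
    have h1 := neg_norm_le_lamMin hd (hess_isSymmetric hf₂ x)
    have h2 := hf.norm_hess_le hL₁.le x
    linarith
  · rw [mul_assoc, rpow_half_mul hε.le]
    linarith [Real.sqrt_nonneg (ε * L₂)]
  · have hS := acagd_unit_cost_le hT.le hL₁ le_rfl hlog
    rw [div_self hL₁.ne', Real.sqrt_one, mul_one] at hS
    set S := 21 * T + 22 * T *
      (⌈18 * √((5 * L₁ + 2 * (3 * L₁)) / (3 * L₁)) * Real.log τ⌉₊ : ℕ) with hSdef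
    have hS0 : 0 ≤ S := by positivity
    have e1 : Δ / (ε ^ 2 / (48 * L₁)) = 48 * Y := by rw [hY]; field_simp
    have e2 : S * (60 * L₁ / ε ^ 2) * Δ = 60 * (S * Y) := by rw [hY]; ring
    have hTl : T ≤ T * Real.log τ := le_mul_of_one_le_right hT.le hlog
    have hTl0 : 0 ≤ T * Real.log τ := by positivity
    rw [e1, zero_add, zero_div, zero_add, e2]
    calc (2 * T + S) * (48 * Y + 2) + 60 * (S * Y)
        ≤ (2 * T + S) * (48 * X + 2 * X) + 60 * (S * X) := by gcongr; linarith
      _ = (100 * T + 110 * S) * X := by ring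
      _ ≤ (100 * (T * Real.log τ) + 110 * (835 * (T * Real.log τ))) * X := by gcongr
      _ = 91950 * (T * Real.log τ * X) := by ring
      _ ≤ 100000 * (T * Real.log τ * X) := by gcongr; norm_num
      _ = _ := by ring

theorem total_time_le {A T W E S Q : ℝ} (hT : 0 ≤ T) (hW : 0 ≤ W) (hE0 : 0 ≤ E)
    (hS0 : 0 ≤ S) (hQ : 1 ≤ Q) (hTW : T ≤ W) (hE : E ≤ 21 * A * W) (hS : S ≤ 835 * W) :
    (E + 6 * T + 2 * T + S) * (12 * Q + 2) + ((E + 6 * T) * (12 * Q) + 60 * (S * Q)) ≤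
      (546 * A + 100000) * (W * Q) := by
  have hQ0 : 0 ≤ Q := by linarith
  calc (E + 6 * T + 2 * T + S) * (12 * Q + 2) + ((E + 6 * T) * (12 * Q) + 60 * (S * Q))
      ≤ (E + 6 * T + 2 * T + S) * (12 * Q + 2 * Q) + ((E + 6 * T) * (12 * Q) + 60 * (S * Q)) := by
        gcongr; linarith
    _ = (26 * E + 184 * T + 74 * S) * Q := by ring
    _ ≤ (26 * (21 * A * W) + 184 * W + 74 * (835 * W)) * Q := by gcongr
    _ = (546 * A + 61974) * (W * Q) := by ring
    _ ≤ (546 * A + 100000) * (W * Q) := by gcongr; norm_num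

/-- The method when the curvature parameter is `√(ε L₂)`. -/
theorem succeedsWithin_of_sqrt_lt {d : ℕ} (hd : 0 < d) {tm : OpTimes} {A T : ℝ} (hA : 0 < A)
    (hT : 0 < T) (htm : tm.Within T) {R : EigRoutine d} (hR : R.Meets A T) {f : Vec d → ℝ}
    {x₁ : Vec d} {ε L₁ L₂ Δ δ τ : ℝ} (hε : 0 < ε) (hL₁ : 0 < L₁) (hL₂ : 0 < L₂) (hΔ : 0 < Δ)
    (hδ : 0 < δ) (hδ1 : δ < 1) (hf : Smooth f L₁) (hf₂ : HessianLipschitz f L₂)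
    (hgap : OptGap f x₁ Δ) (hcond : ε ^ 2 ≤ Δ * √(ε * L₂)) (hbL₁ : √(ε * L₂) < L₁)
    (hτ3 : 3 ≤ τ) (hlog : 1 ≤ Real.log τ) (hL₁τ : L₁ ≤ τ) (hL₂τ : L₂ ≤ τ) (hΔτ : Δ ≤ τ)
    (hdτ : d ≤ τ) (hδτ : 1 / δ ≤ τ) (hετ : 1 / ε ≤ τ) :
    SucceedsWithin tm R x₁ f ε L₁ L₂ Δ δ
      ((546 * A + 100000) * T * rate ε L₁ L₂ Δ * Real.log τ) := by
  set b := √(ε * L₂) with hb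
  have hb0 : 0 < b := by positivity
  have hb2 : b ^ 2 = ε * L₂ := Real.sq_sqrt (by positivity)
  have hL₂b : L₂ = b ^ 2 / ε := by rw [hb2]; field_simp
  have hτ0 : 0 < τ := by linarith
  have hd0 : (0 : ℝ) < d := by exact_mod_cast hd
  -- Since $L_2=b^2/\epsilon$, all counts are multiples of $Q$: $\Delta/u=12Q$ and
  -- $K=\lceil1+12Q+\sqrt{10}\,Q\rceil$.
  set Q := Δ * b / ε ^ 2 with hQ
  have hQ1 : 1 ≤ Q := (one_le_div (by positivity)).2 hcond
  set s := √(L₁ / b) with hs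
  have hrate : rate ε L₁ L₂ Δ = Q * s := by
    rw [rate_eq hε hL₁ hL₂, ← hb, hQ, hs]
    have : √(L₁ * b) = b * √(L₁ / b) := by
      have e : L₁ * b = b ^ 2 * (L₁ / b) := by
        rw [sq, mul_assoc, mul_div_cancel₀ _ hb0.ne', mul_comm]
      rw [e, Real.sqrt_mul (sq_nonneg b), Real.sqrt_sq hb0.le]
    rw [this]; ring
  have hQ2 : Q ^ 2 ≤ τ ^ 6 := by
    calc Q ^ 2 = Δ ^ 2 * b ^ 2 / ε ^ 4 := by rw [hQ]; ring
      _ = Δ ^ 2 * L₂ * (1 / ε) ^ 3 := by rw [hb2]; field_simp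
      _ ≤ τ ^ 2 * τ * τ ^ 3 := by gcongr
      _ = τ ^ 6 := by ring
  have hα := alphaParam_eq (L₁ := L₁) hε hΔ hcond
  rw [min_eq_right hbL₁.le] at hα
  set u := b ^ 3 / (12 * L₂ ^ 2) with hu
  have hu0 : 0 < u := by positivity
  have hΔu : Δ / u = 12 * Q := by rw [hu, hQ, hL₂b]; field_simp
  have hΔu' : 12 * L₂ ^ 2 * Δ / b ^ 3 = 12 * Q := by rw [hQ, hL₂b]; field_simp
  set K : ℕ := ⌈1 + Δ * (12 * L₂ ^ 2 / b ^ 3 + √10 * L₂ / (b * ε))⌉₊ with hK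
  have hKarg : 1 + Δ * (12 * L₂ ^ 2 / b ^ 3 + √10 * L₂ / (b * ε)) = 1 + 12 * Q + √10 * Q := by
    rw [hQ, hL₂b]; field_simp; ring
  have h10 : 1 ≤ √(10 : ℝ) := Real.one_le_sqrt.2 (by norm_num)
  have h10' : √(10 : ℝ) ≤ 4 := by rw [Real.sqrt_le_left (by norm_num)]; norm_num
  -- As $12Q+2=\Delta/u+2$ bounds the number of passes, granting $\delta/K$ to each keeps the total
  -- failure probability below $\delta$.
  have hK1 : 12 * Q + 2 ≤ K := by
    have := Nat.le_ceil (1 + Δ * (12 * L₂ ^ 2 / b ^ 3 + √10 * L₂ / (b * ε)))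
    rw [← hK, hKarg] at this
    nlinarith
  have hK2 : (K : ℝ) ≤ 18 * Q := by
    have := (Nat.ceil_lt_add_one
      (a := 1 + Δ * (12 * L₂ ^ 2 / b ^ 3 + √10 * L₂ / (b * ε))) (by positivity)).le
    rw [← hK, hKarg] at this
    nlinarith
  have hK0 : (1 : ℝ) < K := by linarith
  have hδ'' : 0 < δ / K := by positivity
  have hδ''1 : δ / K < 1 := (div_lt_one (by linarith)).2 (by linarith)
  set δ' := δ / K / (1 + 12 * L₂ ^ 2 * Δ / b ^ 3) with hδ'
  have hδ'0 : 0 < δ' := by positivity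
  have hδ'1 : δ' < 1 := by
    rw [hδ', hΔu', div_lt_one (by linarith)]
    linarith
  have hDlog : Real.log (d / δ') ≤ 13 * Real.log τ := by
    have h1 : (d : ℝ) / δ' ≤ τ ^ 13 := by
      calc (d : ℝ) / δ' = d * (1 / δ) * (K * (1 + 12 * Q)) := by
            rw [hδ', hΔu']; field_simp
        _ ≤ τ * τ * (18 * Q * (13 * Q)) := by gcongr; linarith
        _ = 234 * τ ^ 2 * Q ^ 2 := by ring
        _ ≤ 243 * τ ^ 2 * τ ^ 6 := by gcongr; norm_num
        _ = 3 ^ 5 * τ ^ 8 := by ring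
        _ ≤ τ ^ 5 * τ ^ 8 := by gcongr
        _ = τ ^ 13 := by ring
    have h2 : 13 * Real.log τ = Real.log (τ ^ 13) := by rw [Real.log_pow]; norm_num
    rw [h2]
    exact Real.log_le_log (by positivity) h1
  set E := 21 * A * (T * s * Real.log τ) with hE
  have hE0 : 0 ≤ E := by positivity
  -- Here $\rho=\alpha/L_2$ is the radius where the penalty sets in, and $2u=\frac\epsilon6\rho$
  -- holds exactly because $b^2=\epsilon L_2$: both phases gain the same unit.
  refine succeedsWithin_of_phases (u := u) (ρ := b / L₂) (p := δ / K) (e := E + 6 * T)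
    hd hT.le htm hε hL₁ hL₂ hb0 hbL₁.le hα hf hf₂ hgap hu0 (by positivity)
    (Or.inl le_rfl) ?_ ?_ _ (agd_passes_suffice hε hb0 hbL₁.le hΔ.le hτ3 hΔτ hετ ?_ (Nat.le_ceil _))
    hδ''.le (by positivity) ?_ ⟨⌈Δ / u⌉₊ + 1, fun N hN x hx => ?_⟩ ?_ ?_
  · have e1 : 2 * u = 1 / 6 * (b ^ 3 / L₂ ^ 2) := by rw [hu]; field_simp; norm_num
    have e2 : 3 * b * (b / L₂) ^ 2 = 3 * (b ^ 3 / L₂ ^ 2) := by ring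
    rw [e1, e2]
    have : 0 ≤ b ^ 3 / L₂ ^ 2 := by positivity
    linarith
  · refine le_of_eq ?_
    rw [hu, hL₂b]; field_simp; norm_num
  · have h1 : 1 ≤ b * (Δ / ε ^ 2) := hQ1.trans_eq (by rw [hQ]; ring)
    have h2 : Δ / ε ^ 2 ≤ τ ^ 3 := by
      calc Δ / ε ^ 2 = Δ * (1 / ε) ^ 2 := by ring
        _ ≤ τ * τ ^ 2 := by gcongr
        _ = τ ^ 3 := by ring
    calc L₁ ^ 2 ≤ τ ^ 2 * 1 := by rw [mul_one]; gcongr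
      _ ≤ τ ^ 2 * (b * τ ^ 3) := by gcongr; exact h1.trans (by gcongr)
      _ = b * τ ^ 5 := by ring
  · rw [hΔu, div_mul_eq_mul_div, div_le_iff₀ (by linarith)]
    gcongr
  · rw [if_pos hbL₁, ncd, ← hδ']
    have hlow : ∀ x, ⨅ y, f y ≤ f x := fun x => ciInf_le hgap.1 x
    have hxu : (f x - ⨅ y, f y) / u ≤ Δ / u := by gcongr
    have h1 := ncdLoop_spec hT htm hR hL₁ hL₂ hb0 hbL₁ hδ'0 hδ'1 hf hf₂ hlow hE0
      (eig_cost_le hA hT hb0 hbL₁.le hlog hDlog) N x (by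
        rw [← hu]
        have h2 : (⌈Δ / u⌉₊ : ℝ) + 1 ≤ N := by exact_mod_cast hN
        linarith [Nat.le_ceil (Δ / u)])
    refine h1.mono subset_rfl ?_
    rw [← hu]
    calc δ' * (1 + (f x - ⨅ y, f y) / u) ≤ δ' * (1 + Δ / u) := by gcongr
      _ = δ / K := by rw [hδ', hΔu', hΔu]; field_simp
  · rw [mul_assoc, rpow_half_mul hε.le, ← hb]
    linarith
  · have hS := acagd_unit_cost_le hT.le hb0 hbL₁.le hlog
    rw [← hs] at hS
    set S := 21 * T + 22 * T *
      (⌈18 * √((5 * L₁ + 2 * (3 * b)) / (3 * b)) * Real.log τ⌉₊ : ℕ) with hSdef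
    have hS0 : 0 ≤ S := by positivity
    have hs1 : 1 ≤ s := Real.one_le_sqrt.2 ((one_le_div hb0).2 hbL₁.le)
    set W := T * s * Real.log τ with hW
    have hTW : T ≤ W := by
      rw [hW, mul_assoc]
      exact le_mul_of_one_le_right hT.le (one_le_mul_of_one_le_of_one_le hs1 hlog)
    have hW0 : 0 ≤ W := by positivity
    have e1 : ((E + 6 * T) / u + S * (60 * b / ε ^ 2)) * Δ =
        (E + 6 * T) * (12 * Q) + 60 * (S * Q) := by
      rw [← hΔu, hQ]; ring
    rw [e1, hΔu]
    have hrhs : (546 * A + 100000) * T * rate ε L₁ L₂ Δ * Real.log τ =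
        (546 * A + 100000) * (W * Q) := by rw [hrate, hW]; ring
    rw [hrhs]
    exact total_time_le hT.le hW0 hE0 hS0 hQ1 hTW le_rfl hS

/-- The extra condition says $\sqrt{\epsilon L_2}\le L_1$, so the rate is at least
$\Delta\sqrt{\epsilon L_2}/\epsilon^2\ge1$ and the maximum with $1$ is superfluous. -/
theorem one_le_rate {ε L₁ L₂ Δ : ℝ} (hε : 0 < ε) (hL₁ : 0 < L₁) (hL₂ : 0 < L₂) (hΔ : 0 < Δ)
    (hcond : ε ^ 2 ≤ Δ * √(ε * L₂)) (h : ε ≤ L₁ ^ 2 / L₂) : 1 ≤ rate ε L₁ L₂ Δ := by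
  have hb : √(ε * L₂) ≤ L₁ := by
    rw [Real.sqrt_le_left hL₁.le]
    rwa [le_div_iff₀ hL₂] at h
  have h1 : √(ε * L₂) ≤ √(L₁ * √(ε * L₂)) := Real.le_sqrt_of_sq_le (by rw [sq]; gcongr)
  rw [rate_eq hε hL₁ hL₂, one_le_div (by positivity)]
  exact hcond.trans (by gcongr)

end NCAccel

open NCAccel
theorem mainTheorem3 :
    (∃ A : ℝ, 0 < A ∧ ∀ d : ℕ, 0 < d → ∀ (tm : OpTimes) (T : ℝ), 0 < T → tm.Within T →
      (lanczos d tm).Meets A T) ∧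
    (∀ A : ℝ, 0 < A → ∃ C : ℝ, 0 < C ∧
      ∀ d : ℕ, 0 < d → ∀ (tm : OpTimes) (T : ℝ), 0 < T → tm.Within T →
      ∀ R : EigRoutine d, R.Meets A T →
      ∀ (f : Vec d → ℝ) (x₁ : Vec d) (ε L₁ L₂ Δ δ : ℝ),
        0 < ε → 0 < L₁ → 0 < L₂ → 0 < Δ → 0 < δ → δ < 1 →
        Smooth f L₁ → HessianLipschitz f L₂ → OptGap f x₁ Δ →
        ε ≤ (Δ ^ 2 * L₂) ^ (1 / 3 : ℝ) →
        SucceedsWithin tm R x₁ f ε L₁ L₂ Δ δ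
          (C * T * max 1 (rate ε L₁ L₂ Δ) * logFactor d ε L₁ L₂ Δ δ) ∧
        (ε ≤ L₁ ^ 2 / L₂ →
          SucceedsWithin tm R x₁ f ε L₁ L₂ Δ δ
            (C * T * rate ε L₁ L₂ Δ * logFactor d ε L₁ L₂ Δ δ))) := by
  refine ⟨⟨40, by norm_num, fun d hd tm T hT htm => lanczos_meets hd hT htm⟩,
    fun A hA => ⟨546 * A + 100000, by positivity, ?_⟩⟩
  intro d hd tm T hT htm R hR f x₁ ε L₁ L₂ Δ δ hε hL₁ hL₂ hΔ hδ hδ1 hf hf₂ hgap hεΔ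
  have hcond := sq_le_mul_sqrt_of_le hε hL₂ hΔ hεΔ
  have hmain : SucceedsWithin tm R x₁ f ε L₁ L₂ Δ δ
      ((546 * A + 100000) * T * max 1 (rate ε L₁ L₂ Δ) * logFactor d ε L₁ L₂ Δ δ) := by
    have hd1 : (1 : ℝ) ≤ d := by exact_mod_cast hd
    have hδ1' : 1 ≤ 1 / δ := (one_le_div hδ).2 hδ1.le
    have hε' : 0 < 1 / ε := by positivity
    rw [logFactor]
    set τ := 1 + L₁ + L₂ + Δ + d + 1 / δ + 1 / ε with hτ
    -- The summands $1$, $d$ and $1/\delta$ are each at least $1$.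
    have hτ3 : 3 ≤ τ := by linarith
    have hlog : 1 ≤ Real.log τ := by
      rw [Real.le_log_iff_exp_le (by linarith)]
      linarith [Real.exp_one_lt_d9]
    rcases le_or_gt L₁ √(ε * L₂) with h | h
    · refine (succeedsWithin_of_le_sqrt hd hT htm hε hL₁ hL₂ hΔ hδ hf hf₂ hgap hcond h hτ3 hlog
        (by linarith) (by linarith) (by linarith)).mono ?_
      gcongr
      linarith
    · refine (succeedsWithin_of_sqrt_lt hd hA hT htm hR hε hL₁ hL₂ hΔ hδ hδ1 hf hf₂ hgap hcond h hτ3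
        hlog (by linarith) (by linarith) (by linarith) (by linarith) (by linarith)
        (by linarith)).mono ?_
      gcongr
      exact le_max_right _ _
  refine ⟨hmain, fun hεL => ?_⟩
  rwa [max_eq_right (one_le_rate hε hL₁ hL₂ hΔ hcond hεL)] at hmain
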